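/- **Setting.** Let $K$ be a field of characteristic $0$ containing elements $q^{1/4},t^{1/4}$ that are algebraically independent over $\mathbb Q$, let $u,v,w\in K^\times$ (for instance indeterminates over $\mathbb Q(q^{1/4},t^{1/4})$, with $w$ possibly a function of $u,v$), and let $N\in\mathbb Z$. *Fock space.* Let $\mathcal F=K[p_1,p_2,\dots]$ be the ring of symmetric functions ($p_n$ the power sums, $\deg p_n=n$), with the operators $a_{-n}=p_n\cdot$ and $a_n=n\frac{1-q^n}{1-t^n}\frac{\partial}{\partial p_n}$ for $n>0$. Let $\widehat{\mathcal F}=\prod_{d\ge 0}\mathcal F_d$ be its completion with respect to the degree, and let $P_\lambda=P_\lambda(x;q,t)\in\mathcal F$ be the Macdonald symmetric functions. *Algebra.* Put $G^\pm(z)=(1-q^{\pm1}z)(1-t^{\mp1}z)(1-q^{\mp1}t^{\pm1}z)$, $g(z)=G^+(z)/G^-(z)$, and $\delta(z)=\sum_{n\in\mathbb Z}z^n$. Let $\mathcal U$ be the unital associative algebra generated by the modes of $x^\pm(z)=\sum_{n\in\mathbb Z}x^\pm_nz^{-n}$, $\psi^\pm(z)=\sum_{n\ge0}\psi^\pm_{\pm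 n}z^{\mp n}$ and by central invertible elements $\gamma^{\pm1/2}$, with the relations $\psi^\pm(z)\psi^\pm(w)=\psi^\pm(w)\psi^\pm(z)$, $\psi^+(z)\psi^-(w)=\frac{g(\gamma w/z)}{g(\gamma^{-1}w/z)}\psi^-(w)\psi^+(z)$, $\psi^+(z)x^\pm(w)=g(\gamma^{\mp1/2}w/z)^{\mp1}x^\pm(w)\psi^+(z)$, $\psi^-(z)x^\pm(w)=g(\gamma^{\mp1/2}z/w)^{\pm1}x^\pm(w)\psi^-(z)$, $G^\mp(z/w)x^\pm(z)x^\pm(w)=G^\pm(z/w)x^\pm(w)x^\pm(z)$ and $$[x^+(z),x^-(w)]=\tfrac{(1-q)(1-1/t)}{1-q/t}\bigl(\delta(\gamma^{-1}z/w)\psi^+(\gamma^{1/2}w)-\delta(\gamma z/w)\psi^-(\gamma^{-1/2}w)\bigr).$$ Its coproduct is $\Delta(\gamma^{\pm1/2})=\gamma^{\pm1/2}\otimes\gamma^{\pm1/2}$, $\Delta(x^+(z))=x^+(z)\otimes1+\psi^-(\gamma_{(1)}^{1/2}z)\otimes x^+(\gamma_{(1)}z)$, $\Delta(x^-(z))=x^-(\gamma_{(2)}z)\otimes\psi^+(\gamma_{(2)}^{1/2}z)+1\otimes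 x^-(z)$, $\Delta(\psi^\pm(z))=\psi^\pm(\gamma_{(2)}^{\pm1/2}z)\otimes\psi^\pm(\gamma_{(1)}^{\mp1/2}z)$, where $\gamma_{(1)}=\gamma\otimes1$ and $\gamma_{(2)}=1\otimes\gamma$. *Vertical module.* $\mathcal F^{(0,1)}_v$ is $\mathcal F$ with $\gamma^{1/2}=1$ and $$x^+(z)P_\lambda=\sum_{i=1}^{\ell(\lambda)+1}A^+_{\lambda,i}\,\delta(q^{\lambda_i}t^{-i+1}v/z)P_{\lambda+\mathbf 1_i},\qquad x^-(z)P_\lambda=q^{1/2}t^{-1/2}\sum_{i=1}^{\ell(\lambda)}A^-_{\lambda,i}\,\delta(q^{\lambda_i-1}t^{-i+1}v/z)P_{\lambda-\mathbf 1_i},$$ $\psi^+(z)P_\lambda=q^{1/2}t^{-1/2}B^+_\lambda(v/z)P_\lambda$ and $\psi^-(z)P_\lambda=q^{-1/2}t^{1/2}B^-_\lambda(z/v)P_\lambda$. Here $\lambda\pm\mathbf 1_i$ is $\lambda$ with a box added to, or removed from, row $i$ (the coefficient vanishes if this is not a partition), and $$A^+_{\lambda,i}=(1-t)\prod_{j=1}^{i-1}\frac{(1-q^{\lambda_i-\lambda_j}t^{-i+j+1})(1-q^{\lambda_i-\lambda_j+1}t^{-i+j-1})}{(1-q^{\lambda_i-\lambda_j}t^{-i+j})(1-q^{\lambda_i-\lambda_j+1}t^{-i+j})},$$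 $$A^-_{\lambda,i}=(1-t^{-1})\frac{1-q^{\lambda_{i+1}-\lambda_i}}{1-q^{\lambda_{i+1}-\lambda_i+1}t^{-1}}\prod_{j>i}\frac{(1-q^{\lambda_j-\lambda_i+1}t^{-j+i-1})(1-q^{\lambda_{j+1}-\lambda_i}t^{-j+i})}{(1-q^{\lambda_{j+1}-\lambda_i+1}t^{-j+i-1})(1-q^{\lambda_j-\lambda_i}t^{-j+i})},$$ $$B^+_\lambda(z)=\frac{1-q^{\lambda_1-1}tz}{1-q^{\lambda_1}z}\prod_{i\ge1}\frac{(1-q^{\lambda_i}t^{-i}z)(1-q^{\lambda_{i+1}-1}t^{-i+1}z)}{(1-q^{\lambda_{i+1}}t^{-i}z)(1-q^{\lambda_i-1}t^{-i+1}z)},$$ $$B^-_\lambda(z)=\frac{1-q^{-\lambda_1+1}t^{-1}z}{1-q^{-\lambda_1}z}\prod_{i\ge1}\frac{(1-q^{-\lambda_i}t^{i}z)(1-q^{-\lambda_{i+1}+1}t^{i-1}z)}{(1-q^{-\lambda_{i+1}}t^{i}z)(1-q^{-\lambda_i+1}t^{i-1}z)},$$ the last two expanded in nonnegative powers of $z$.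 *Horizontal modules.* $\mathcal F^{(1,N)}_u$ is $\mathcal F$ with $\gamma^{1/2}=(t/q)^{1/4}$, $x^+(z)=uz^{-N}q^{-N/2}t^{N/2}\eta(z)$, $x^-(z)=u^{-1}z^{N}q^{N/2}t^{-N/2}\xi(z)$, $\psi^\pm(z)=q^{\pm N/2}t^{\mp N/2}\varphi^\pm(z)$, where $$\eta(z)=\exp\Bigl(\sum_{n\ge1}\tfrac{1-t^{-n}}{n}a_{-n}z^n\Bigr)\exp\Bigl(-\sum_{n\ge1}\tfrac{1-t^n}{n}a_nz^{-n}\Bigr),$$ $$\xi(z)=\exp\Bigl(-\sum_{n\ge1}\tfrac{1-t^{-n}}{n}q^{-n/2}t^{n/2}a_{-n}z^n\Bigr)\exp\Bigl(\sum_{n\ge1}\tfrac{1-t^n}{n}q^{-n/2}t^{n/2}a_nz^{-n}\Bigr),$$ $$\varphi^+(z)=\exp\Bigl(-\sum_{n\ge1}\tfrac{1-t^n}{n}(1-t^nq^{-n})q^{n/4}t^{-n/4}a_nz^{-n}\Bigr),\quad \varphi^-(z)=\exp\Bigl(\sum_{n\ge1}\tfrac{1-t^{-n}}{n}(1-t^nq^{-n})q^{n/4}t^{-n/4}a_{-n}z^n\Bigr).$$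 The modes of these currents also act on the completion $\widehat{\mathcal F}^{(1,N)}_u$. *Intertwiners.* A normalized trivalent intertwining operator is a $K$-linear map $\Phi:\mathcal F^{(0,1)}_v\otimes\mathcal F^{(1,N)}_u\to\widehat{\mathcal F}^{(1,N+1)}_w$ with $a\Phi=\Phi\Delta(a)$ for all $a\in\mathcal U$, whose components $\Phi_\lambda(\alpha)=\Phi(P_\lambda\otimes\alpha)$ satisfy $\Phi_\emptyset(1)=1+(\text{terms of positive degree})$. **Theorem.** A normalized trivalent intertwining operator exists only when $w=-vu$. In this case it exists and is unique, and for every partition $\lambda$ $$\Phi_\lambda=(-vu)^{|\lambda|}(-v)^{-(N+1)|\lambda|}f_\lambda^{-N-1}\cdot\frac{q^{n(\lambda')}}{c_\lambda}:\widetilde\Phi_\emptyset(v)\,\eta_\lambda(v):,$$ where $:\ :$ is the normal ordering (all $a_{-n}$, $n>0$, to the left of all $a_n$, $n>0$), $$\widetilde\Phi_\emptyset(v)=\exp\Bigl(-\sum_{n\ge1}\frac1n\frac1{1-q^n}a_{-n}v^n\Bigr)\exp\Bigl(-\sum_{n\ge1}\frac1n\frac{q^n}{1-q^n}a_nv^{-n}\Bigr),\qquad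 \eta_\lambda(v)=\,:\prod_{i=1}^{\ell(\lambda)}\prod_{j=1}^{\lambda_i}\eta(q^{j-1}t^{-i+1}v):,$$ $c_\lambda=\prod_{(i,j)\in\lambda}\bigl(1-q^{\lambda_i-j}t^{\lambda'_j-i+1}\bigr)$, $n(\lambda)=\sum_i(i-1)\lambda_i$, $\lambda'$ is the conjugate partition, and $f_\lambda=(-1)^{|\lambda|}q^{n(\lambda')+|\lambda|/2}t^{-n(\lambda)-|\lambda|/2}$. -/

import Mathlib

namespace FockVertex

/-! ### Partitions -/

section Partitions

/-- The part `lam_i` (`i = 1, 2, ...`) of a partition, which is encoded by its Young diagram. -/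
def part (lam : YoungDiagram) (i : ℕ) : ℕ := lam.rowLen (i - 1)

/-- The length `l(lam)`: the number of nonzero parts. -/
def len (lam : YoungDiagram) : ℕ := lam.colLen 0

/-- `n(lam) = ∑ (i - 1) lam_i`. A cell `c` has row index `i = c.1 + 1`. -/
def nStat (lam : YoungDiagram) : ℕ := ∑ c ∈ lam.cells, c.1

open Classical in
/-- The partition `lam + 1_i` (`i ≥ 1`): a box is added to the `i`-th row. If the result is not a
partition, the value is `lam`. -/
noncomputable def addBox (lam : YoungDiagram) (i : ℕ) : YoungDiagram :=
  if h : IsLowerSet ((insert (i - 1, part lam i) lam.cells : Finset (ℕ × ℕ)) : Set (ℕ × ℕ))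
  then ⟨insert (i - 1, part lam i) lam.cells, h⟩ else lam

open Classical in
/-- The partition `lam - 1_i` (`i ≥ 1`): a box is removed from the `i`-th row. If the result is not
a partition, the value is `lam`. -/
noncomputable def removeBox (lam : YoungDiagram) (i : ℕ) : YoungDiagram :=
  if h : IsLowerSet ((lam.cells.erase (i - 1, part lam i - 1) : Finset (ℕ × ℕ)) : Set (ℕ × ℕ))
  then ⟨lam.cells.erase (i - 1, part lam i - 1), h⟩ else lam

/-- `mu ≤ lam` in the dominance ordering. -/
def DominanceLE (mu lam : YoungDiagram) : Prop :=
  mu.card = lam.card ∧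
    ∀ k, ∑ i ∈ Finset.range k, mu.rowLen i ≤ ∑ i ∈ Finset.range k, lam.rowLen i

/-- `mu < lam` in the dominance ordering. -/
def DominanceLT (mu lam : YoungDiagram) : Prop := DominanceLE mu lam ∧ mu ≠ lam

/-- An auxiliary rank which increases strictly along the dominance ordering. -/
def dominanceRank (lam : YoungDiagram) : ℕ :=
  ∑ k ∈ Finset.range (lam.card + 1), ∑ i ∈ Finset.range k, lam.rowLen i

theorem rowLen_eq_zero_of_card_le {lam : YoungDiagram} {i : ℕ} (h : lam.card ≤ i) :
    lam.rowLen i = 0 := by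
  by_contra hne
  have hmem : (i, 0) ∈ lam := YoungDiagram.mem_iff_lt_rowLen.2 (Nat.pos_of_ne_zero hne)
  have h1 : i < lam.colLen 0 := YoungDiagram.mem_iff_lt_colLen.1 hmem
  have h2 : lam.colLen 0 ≤ lam.card := by
    rw [YoungDiagram.colLen_eq_card]
    exact Finset.card_le_card (Finset.filter_subset _ _)
  omega

theorem dominanceRank_lt {mu lam : YoungDiagram} (h : DominanceLT mu lam) :
    dominanceRank mu < dominanceRank lam := by
  obtain ⟨⟨hc, hle⟩, hne⟩ := h
  unfold dominanceRank
  rw [hc]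
  refine lt_of_le_of_ne (Finset.sum_le_sum fun k _ => hle k) fun heq => hne ?_
  have hall := (Finset.sum_eq_sum_iff_of_le (fun k _ => hle k)).1 heq
  have hrow : ∀ i, mu.rowLen i = lam.rowLen i := by
    intro i
    rcases lt_or_ge i lam.card with hi | hi
    · have h1 := hall i (Finset.mem_range.2 (by omega))
      have h2 := hall (i + 1) (Finset.mem_range.2 (by omega))
      rw [Finset.sum_range_succ, Finset.sum_range_succ] at h2
      omega
    · rw [rowLen_eq_zero_of_card_le hi, rowLen_eq_zero_of_card_le (hc ▸ hi)]
  ext ⟨i, j⟩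
  rw [YoungDiagram.mem_cells, YoungDiagram.mem_cells, YoungDiagram.mem_iff_lt_rowLen,
    YoungDiagram.mem_iff_lt_rowLen, hrow]

/-- The exponent of the power sum monomial `p_lam = ∏ p_(lam_i)`, the variable `p_n` having the
index `n - 1`. -/
noncomputable def exponent (lam : YoungDiagram) : ℕ →₀ ℕ :=
  Multiset.toFinsupp ((lam.rowLens.map (· - 1) : List ℕ) : Multiset ℕ)

theorem exponent_bijective : Function.Bijective exponent := by
  constructor
  · intro mu lam h
    have h1 := Multiset.coe_eq_coe.1 (Multiset.toFinsupp.injective h)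
    have h2 := h1.map (· + 1)
    have key : ∀ nu : YoungDiagram, (nu.rowLens.map (· - 1)).map (· + 1) = nu.rowLens := by
      intro nu
      rw [List.map_map]
      conv_rhs => rw [← List.map_id nu.rowLens]
      refine List.map_congr_left fun x hx => ?_
      have := nu.pos_of_mem_rowLens x hx
      simp; omega
    rw [key, key] at h2
    exact YoungDiagram.equivListRowLens.injective
      (Subtype.ext (h2.eq_of_sortedGE mu.rowLens_sorted lam.rowLens_sorted))
  · intro m
    let l : List ℕ := ((Finsupp.toMultiset m).map (· + 1)).sort (· ≥ ·)
    have hs : l.SortedGE := (Multiset.pairwise_sort _ _).sortedGE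
    have hp : ∀ x ∈ l, 0 < x := by
      intro x hx
      obtain ⟨y, _, rfl⟩ := Multiset.mem_map.1 ((Multiset.mem_sort _).1 hx)
      omega
    refine ⟨YoungDiagram.ofRowLens l hs, ?_⟩
    unfold exponent
    rw [YoungDiagram.rowLens_ofRowLens_eq_self hp, ← Multiset.map_coe, Multiset.sort_eq,
      Multiset.map_map]
    simp

end Partitions

/-! ### The Fock space as the ring of symmetric functions -/

section Fock

variable (K : Type*) [Field K]

/-- The Fock space with basis `|a_lam⟩`, identified with the ring of symmetric functions through
`|a_lam⟩ ↦ p_lam`. It is the polynomial ring in the power sums `p_1, p_2, ...`, the variable `X i`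
being `p_(i+1)`. -/
abbrev Fock : Type _ := MvPolynomial ℕ K

/-- The completion of the Fock space with respect to the grading `deg p_n = n`: the product of its
(finite dimensional) homogeneous components. -/
abbrev FockHat : Type _ := MvPowerSeries ℕ K

/-- The power sum `p_n`, for `n ≥ 1`. -/
noncomputable def powerSum (n : ℕ) : Fock K := MvPolynomial.X (n - 1)

/-- The degree of a monomial in the power sums, where `p_n` has degree `n`. -/
def weight (m : ℕ →₀ ℕ) : ℕ := m.sum fun i e => e * (i + 1)

variable {K}

/-- Macdonald's scalar product
`⟨p_lam, p_mu⟩ = δ_(lam, mu) ∏ n^(m_n) m_n! ∏ (1 - q^(lam_i)) / (1 - t^(lam_i))`. -/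
noncomputable def scalarProduct (q t : K) (f g : Fock K) : K :=
  ∑ m ∈ f.support, f.coeff m * g.coeff m *
    m.prod fun i e => ((i + 1 : ℕ) : K) ^ e * (e.factorial : K) *
      ((1 - q ^ (i + 1)) / (1 - t ^ (i + 1))) ^ e

variable (K)

/-- The augmented monomial symmetric function `∑ x_(i_1)^(l_1) ⋯ x_(i_r)^(l_r)`, the sum over all
`r`-tuples of distinct indices, as a polynomial in the power sums. The recursion removes the
coincidences `i_1 = i_j` from the product of `p_(l_1)` with the function of the other parts; see
`aeval_augmentedMonomial`. -/
noncomputable def augmentedMonomial : List ℕ → Fock K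
  | [] => 1
  | k :: l => powerSum K k * augmentedMonomial l -
      ∑ j : Fin l.length, augmentedMonomial (l.set j (l[j] + k))
termination_by l => l.length
decreasing_by all_goals simp

/-- The monomial symmetric function `m_lam`. -/
noncomputable def monomialSymm (lam : YoungDiagram) : Fock K :=
  (∏ n ∈ lam.rowLens.toFinset, ((lam.rowLens.count n).factorial : K))⁻¹ •
    augmentedMonomial K lam.rowLens

/-- In finitely many variables `x_1, ..., x_n`, the recursively defined `augmentedMonomial` is what
its name says. -/
theorem aeval_augmentedMonomial (n : ℕ) : ∀ l : List ℕ, (∀ x ∈ l, 0 < x) →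
    MvPolynomial.aeval (fun i => MvPolynomial.psum (Fin n) K (i + 1)) (augmentedMonomial K l) =
      ∑ f : Fin l.length ↪ Fin n, ∏ i, (MvPolynomial.X (f i) : MvPolynomial (Fin n) K) ^ l[i]
  | [], _ => by
      rw [augmentedMonomial]
      simp
  | k :: l, h => by
      have hk : 0 < k := h k (by simp)
      have hl : ∀ x ∈ l, 0 < x := fun x hx => h x (by simp [hx])
      have hset : ∀ j : Fin l.length, ∀ x ∈ l.set j (l[j] + k), 0 < x := by
        intro j x hx
        rcases List.mem_or_eq_of_mem_set hx with hx | rfl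
        · exact hl x hx
        · omega
      have ih : ∀ j : Fin l.length,
          MvPolynomial.aeval (fun i => MvPolynomial.psum (Fin n) K (i + 1))
            (augmentedMonomial K (l.set j (l[j] + k))) =
          ∑ f : Fin l.length ↪ Fin n, (MvPolynomial.X (f j) : MvPolynomial (Fin n) K) ^ k *
            ∏ i, (MvPolynomial.X (f i) : MvPolynomial (Fin n) K) ^ l[i] := by
        intro j
        rw [aeval_augmentedMonomial n _ (hset j)]
        have hlen : (l.set j (l[j] + k)).length = l.length := by simp
        rw [← Equiv.sum_comp ((finCongr hlen).symm.embeddingCongr (Equiv.refl (Fin n)))]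
        refine Finset.sum_congr rfl fun f _ => ?_
        rw [← Equiv.prod_comp (finCongr hlen).symm]
        have : ∀ i : Fin l.length, (MvPolynomial.X (f i) : MvPolynomial (Fin n) K) ^
            (l.set j (l[j] + k))[(i : ℕ)]'(by simp) =
            (if i = j then (MvPolynomial.X (f j) : MvPolynomial (Fin n) K) ^ k else 1) *
              (MvPolynomial.X (f i) : MvPolynomial (Fin n) K) ^ l[i] := by
          intro i
          by_cases hij : i = j
          · subst hij; simp [pow_add, mul_comm]
          · have : (j : ℕ) ≠ i := fun e => hij (Fin.ext e.symm)
            simp [hij, this]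
        calc _ = ∏ i : Fin l.length, (MvPolynomial.X (f i) : MvPolynomial (Fin n) K) ^
            (l.set j (l[j] + k))[(i : ℕ)]'(by simp) := by
              refine Finset.prod_congr rfl fun i _ => ?_
              simp [Equiv.embeddingCongr]
          _ = _ := by
              simp_rw [this]
              rw [Finset.prod_mul_distrib]
              simp
      rw [augmentedMonomial]
      simp only [map_sub, map_mul, map_sum, ih, aeval_augmentedMonomial n l hl]
      refine Eq.trans ?_ ((Equiv.embeddingFinSucc l.length (Fin n)).symm.sum_comp
        (fun f : Fin (l.length + 1) ↪ Fin n => ∏ i : Fin (l.length + 1),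
          (MvPolynomial.X (f i) : MvPolynomial (Fin n) K) ^ (k :: l)[i]))
      rw [Fintype.sum_sigma, Finset.sum_comm, Finset.mul_sum, ← Finset.sum_sub_distrib]
      refine Finset.sum_congr rfl fun f _ => ?_
      have hprod : ∀ i : {i // i ∉ Set.range f}, ∏ a : Fin (l.length + 1),
          (MvPolynomial.X ((Equiv.embeddingFinSucc l.length (Fin n)).symm ⟨f, i⟩ a) :
            MvPolynomial (Fin n) K) ^ (k :: l)[a] =
          MvPolynomial.X i.1 ^ k * ∏ i, (MvPolynomial.X (f i) : MvPolynomial (Fin n) K) ^ l[i] := by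
        intro i
        rw [Fin.prod_univ_succ]
        simp [Equiv.coe_embeddingFinSucc_symm]
      simp_rw [hprod]
      rw [← Finset.sum_mul, ← Finset.sum_mul, ← sub_mul]
      congr 1
      have hps : MvPolynomial.aeval (fun i => MvPolynomial.psum (Fin n) K (i + 1))
          (powerSum K k) = ∑ i : Fin n, (MvPolynomial.X i : MvPolynomial (Fin n) K) ^ k := by
        simp [powerSum, MvPolynomial.psum, Nat.sub_add_cancel hk]
      classical
      rw [hps, ← Finset.sum_subtype (Finset.univ.filter fun i => i ∉ Set.range f) (by simp)
        (fun i => (MvPolynomial.X i : MvPolynomial (Fin n) K) ^ k), sub_eq_iff_eq_add,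
        ← Finset.sum_filter_not_add_sum_filter Finset.univ (fun i => i ∈ Set.range f)]
      congr 1
      have himg : Finset.univ.filter (fun i => i ∈ Set.range f) = Finset.univ.map f := by
        ext i; simp
      rw [himg, Finset.sum_map]
termination_by l => l.length
decreasing_by all_goals simp

/-- A family which is triangular with respect to a basis is a basis. -/
theorem triangular_basis {I V : Type*} [AddCommGroup V] [Module K V] (b : Module.Basis I K V)
    (rank : I → ℕ) (w : I → V) (c : I → K) (hc : ∀ i, c i ≠ 0)
    (h : ∀ i, w i - c i • b i ∈ Submodule.span K (b '' {j | rank j < rank i})) :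
    LinearIndependent K w ∧ ⊤ ≤ Submodule.span K (Set.range w) := by
  classical
  have hlow : ∀ i j, rank j ≤ rank i → b.repr (w j) i = if j = i then c i else 0 := by
    intro i j hij
    have hz : b.repr (w j - c j • b j) i = 0 := by
      have := (Module.Basis.mem_span_image b).1 (h j)
      by_contra hne
      have := this (Finsupp.mem_support_iff.2 hne)
      simp only [Set.mem_ofPred_eq] at this
      omega
    rw [map_sub, map_smul, Finsupp.sub_apply, Finsupp.smul_apply, Module.Basis.repr_self,
      sub_eq_zero] at hz
    rw [hz, Finsupp.single_apply]
    split_ifs with e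
    · simp [e]
    · simp
  constructor
  · rw [linearIndependent_iff]
    intro l hl
    by_contra hne
    obtain ⟨i, hi, hmax⟩ := Finset.exists_max_image l.support rank
      (Finsupp.support_nonempty_iff.2 hne)
    have h0 : b.repr (Finsupp.linearCombination K w l) i = 0 := by rw [hl]; simp
    rw [Finsupp.linearCombination_apply, Finsupp.sum, map_sum, Finsupp.finsetSum_apply] at h0
    rw [Finset.sum_eq_single i] at h0
    · rw [map_smul, Finsupp.smul_apply, hlow i i le_rfl, if_pos rfl, smul_eq_mul] at h0
      rcases mul_eq_zero.1 h0 with h0 | h0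
      · exact (Finsupp.mem_support_iff.1 hi) h0
      · exact hc i h0
    · intro j hj hji
      rw [map_smul, Finsupp.smul_apply, hlow i j (hmax j hj), if_neg hji, smul_zero]
    · intro hni; exact absurd hi hni
  · have hb : ∀ n, ∀ i, rank i < n → b i ∈ Submodule.span K (Set.range w) := by
      intro n
      induction n with
      | zero => intro i hi; omega
      | succ n ih =>
        intro i hi
        have hsub : Submodule.span K (b '' {j | rank j < rank i}) ≤
            Submodule.span K (Set.range w) := by
          rw [Submodule.span_le]
          rintro _ ⟨j, hj, rfl⟩
          simp only [Set.mem_ofPred_eq] at hj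
          exact ih j (by omega)
        have h1 : c i • b i ∈ Submodule.span K (Set.range w) := by
          have := Submodule.sub_mem _ (Submodule.subset_span (Set.mem_range_self i)) (hsub (h i))
          simpa using this
        have := Submodule.smul_mem _ (c i)⁻¹ h1
        rwa [inv_smul_smul₀ (hc i)] at this
    rw [← b.span_eq, Submodule.span_le]
    rintro _ ⟨i, rfl⟩
    exact hb _ i (Nat.lt_succ_self _)

/-- The power sum monomials `p_lam` form a basis. -/
noncomputable def powerSumBasis : Module.Basis YoungDiagram K (Fock K) :=
  (MvPolynomial.basisMonomials ℕ K).reindex (Equiv.ofBijective exponent exponent_bijective).symm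

theorem powerSumBasis_apply (lam : YoungDiagram) :
    powerSumBasis K lam = (lam.rowLens.map (powerSum K)).prod := by
  have key : ∀ l : List ℕ, (MvPolynomial.monomial (Multiset.toFinsupp
      ((l.map (· - 1) : List ℕ) : Multiset ℕ)) (1 : K)) = (l.map (powerSum K)).prod := by
    intro l
    induction l with
    | nil => simp
    | cons a l ih =>
      rw [List.map_cons, List.map_cons, List.prod_cons, ← ih, powerSum, MvPolynomial.X,
        MvPolynomial.monomial_mul, ← Multiset.cons_coe, ← Multiset.singleton_add, map_add,
        Multiset.toFinsupp_singleton, one_mul]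
  rw [← key]
  simp [powerSumBasis, exponent]

theorem degree_exponent (lam : YoungDiagram) : (exponent lam).degree = lam.rowLens.length := by
  have key : ∀ s : Multiset ℕ, (Multiset.toFinsupp s).degree = Multiset.card s := by
    intro s
    induction s using Multiset.induction with
    | empty => simp
    | cons a s ih =>
      rw [← Multiset.singleton_add, map_add, map_add, ih, Multiset.toFinsupp_singleton]
      simp [add_comm]
  rw [exponent, key]
  simp

/-- The leading term of the augmented monomial symmetric function. -/
theorem totalDegree_augmentedMonomial : ∀ l : List ℕ,
    (∀ m ∈ (augmentedMonomial K l - (l.map (powerSum K)).prod).support, m.degree < l.length) ∧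
      ∀ m ∈ (augmentedMonomial K l).support, m.degree ≤ l.length
  | [] => by
      rw [augmentedMonomial]
      refine ⟨by simp, fun m hm => ?_⟩
      have : m = 0 := by
        by_contra hne
        exact (MvPolynomial.mem_support_iff.1 hm) (by rw [MvPolynomial.coeff_one, if_neg (Ne.symm hne)])
      simp [this]
  | k :: l => by
      classical
      have ih := totalDegree_augmentedMonomial l
      have ihj := fun j : Fin l.length => totalDegree_augmentedMonomial (l.set j (l[j] + k))
      have hX : ∀ f : Fock K, ∀ d : ℕ, (∀ m ∈ f.support, m.degree < d) →
          ∀ m ∈ (powerSum K k * f).support, m.degree < d + 1 := by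
        intro f d hf m hm
        rw [powerSum, MvPolynomial.support_X_mul, Finset.mem_map] at hm
        obtain ⟨m', hm', rfl⟩ := hm
        have := hf m' hm'
        simp only [addLeftEmbedding_apply, map_add, Finsupp.degree_single]
        omega
      have hS : ∀ m ∈ (∑ j : Fin l.length, augmentedMonomial K (l.set j (l[j] + k))).support,
          m.degree < l.length + 1 := by
        intro m hm
        obtain ⟨j, _, hj⟩ := Finset.mem_biUnion.1 (MvPolynomial.support_sum hm)
        have := (ihj j).2 m hj
        simp only [List.length_set] at this
        omega
      have hsub : ∀ f g : Fock K, ∀ d : ℕ, (∀ m ∈ f.support, m.degree < d) →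
          (∀ m ∈ g.support, m.degree < d) → ∀ m ∈ (f - g).support, m.degree < d := by
        intro f g d hf hg m hm
        rcases Finset.mem_union.1 (MvPolynomial.support_sub ℕ f g hm) with hm | hm
        · exact hf m hm
        · exact hg m hm
      rw [augmentedMonomial]
      constructor
      · rw [List.map_cons, List.prod_cons, sub_right_comm, ← mul_sub, List.length_cons]
        exact hsub _ _ _ (hX _ _ ih.1) hS
      · rw [List.length_cons]
        intro m hm
        have := hsub _ _ (l.length + 1 + 1) (hX _ (l.length + 1) fun m hm => by
          have := ih.2 m hm; omega) (fun m hm => by have := hS m hm; omega) m hm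
        omega
termination_by l => l.length
decreasing_by all_goals simp

theorem monomialSymm_triangular [CharZero K] :
    LinearIndependent K (monomialSymm K) ∧ ⊤ ≤ Submodule.span K (Set.range (monomialSymm K)) := by
  refine triangular_basis K (powerSumBasis K) (fun lam => lam.rowLens.length) _
    (fun lam => (∏ n ∈ lam.rowLens.toFinset, ((lam.rowLens.count n).factorial : K))⁻¹) ?_ ?_
  · intro lam
    exact inv_ne_zero (Finset.prod_ne_zero_iff.2 fun n _ => Nat.cast_ne_zero.2
      (Nat.factorial_ne_zero _))
  · intro lam
    rw [monomialSymm, ← smul_sub, powerSumBasis_apply]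
    refine Submodule.smul_mem _ _ ?_
    rw [MvPolynomial.as_sum (augmentedMonomial K lam.rowLens - _)]
    refine Submodule.sum_mem _ fun m hm => ?_
    have hdeg := (totalDegree_augmentedMonomial K lam.rowLens).1 m hm
    obtain ⟨mu, rfl⟩ := exponent_bijective.2 m
    rw [← mul_one (MvPolynomial.coeff _ _), ← smul_eq_mul, ← MvPolynomial.smul_monomial]
    refine Submodule.smul_mem _ _ (Submodule.subset_span ⟨mu, ?_, ?_⟩)
    · rw [degree_exponent] at hdeg
      exact hdeg
    · simp [powerSumBasis]

/-- The monomial symmetric functions form a basis. -/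
noncomputable def monomialSymmBasis [CharZero K] : Module.Basis YoungDiagram K (Fock K) :=
  Module.Basis.mk (monomialSymm_triangular K).1 (monomialSymm_triangular K).2

variable {K}

/-- The Macdonald symmetric function `P_lam(x; q, t)`, by the Gram-Schmidt recursion along the
dominance ordering. It is forced by the two conditions which characterize the family:
`P_lam = m_lam + ∑_(mu < lam) u_(lam mu) m_mu`, and `⟨P_lam, P_mu⟩ = 0` for `lam ≠ mu`. The sum is
finite, because there are finitely many partitions of a given size. -/
noncomputable def macdonaldP (q t : K) (lam : YoungDiagram) : Fock K :=
  monomialSymm K lam - ∑ᶠ mu : {mu : YoungDiagram // DominanceLT mu lam},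
    (scalarProduct q t (monomialSymm K lam) (macdonaldP q t mu.1) /
      scalarProduct q t (macdonaldP q t mu.1) (macdonaldP q t mu.1)) • macdonaldP q t mu.1
termination_by dominanceRank lam
decreasing_by all_goals exact dominanceRank_lt mu.2

theorem macdonaldP_triangular [CharZero K] (q t : K) :
    LinearIndependent K (macdonaldP q t) ∧ ⊤ ≤ Submodule.span K (Set.range (macdonaldP q t)) := by
  have hfin : ∀ (I : Type) (f : I → Fock K) (S : Submodule K (Fock K)), (∀ i, f i ∈ S) →
      ∑ᶠ i, f i ∈ S := by
    intro I f S hf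
    by_cases h : (Function.support f).Finite
    · rw [finsum_eq_sum f h]
      exact S.sum_mem fun i _ => hf i
    · rw [finsum_of_infinite_support h]
      exact S.zero_mem
  have hmain : ∀ n lam, dominanceRank lam < n → macdonaldP q t lam - monomialSymm K lam ∈
      Submodule.span K (monomialSymm K '' {mu | dominanceRank mu < dominanceRank lam}) := by
    intro n
    induction n with
    | zero => intro lam h; omega
    | succ n ih =>
      intro lam hlam
      rw [macdonaldP, sub_sub_cancel_left]
      refine Submodule.neg_mem _ (hfin _ _ _ fun mu => Submodule.smul_mem _ _ ?_)
      have hlt := dominanceRank_lt mu.2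
      have h1 := ih mu.1 (by omega)
      have h2 : monomialSymm K mu.1 ∈
          Submodule.span K (monomialSymm K '' {mu | dominanceRank mu < dominanceRank lam}) :=
        Submodule.subset_span ⟨mu.1, hlt, rfl⟩
      have h3 := Submodule.span_mono (R := K) (Set.image_mono (f := monomialSymm K)
        (fun nu (hnu : dominanceRank nu < dominanceRank mu.1) =>
          (hnu.trans hlt : dominanceRank nu < dominanceRank lam))) h1
      have := Submodule.add_mem _ h3 h2
      rwa [sub_add_cancel] at this
  refine triangular_basis K (monomialSymmBasis K) dominanceRank _ (fun _ => 1)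
    (fun _ => one_ne_zero) fun lam => ?_
  have hcoe : ⇑(monomialSymmBasis K) = monomialSymm K := Module.Basis.coe_mk _ _
  rw [hcoe, one_smul]
  exact hmain _ lam (Nat.lt_succ_self _)

/-- The basis `(P_lam)` of the Fock space. -/
noncomputable def macdonaldBasis [CharZero K] (q t : K) : Module.Basis YoungDiagram K (Fock K) :=
  Module.Basis.mk (macdonaldP_triangular q t).1 (macdonaldP_triangular q t).2

end Fock

/-! ### The algebra `U` -/

section Algebra

/-- The generators of `U`: the modes `x^±_n` (`n ∈ ℤ`) of `x^±(z) = ∑ x^±_n z^(-n)`, the modes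
`ψ^+_n` and `ψ^-_(-n)` (`n ≥ 0`) of `ψ^+(z) = ∑ ψ^+_n z^(-n)` and `ψ^-(z) = ∑ ψ^-_(-n) z^n`, and
`γ^(1/2)`, `γ^(-1/2)`. -/
inductive Gen : Type
  | xPlus (n : ℤ)
  | xMinus (n : ℤ)
  | psiPlus (n : ℕ)
  | psiMinus (n : ℕ)
  | gammaHalf
  | gammaHalfInv

/-- Given the images of the generators in an algebra `A`, the image of `γ^(r/2)`. -/
def gammaPow {A : Type*} [Monoid A] (act : Gen → A) (r : ℤ) : A :=
  if 0 ≤ r then act .gammaHalf ^ r.toNat else act .gammaHalfInv ^ (-r).toNat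

variable {K : Type*} [Field K]

/-- `G^+(z) = (1 - q z) (1 - t⁻¹ z) (1 - q⁻¹ t z)`. -/
noncomputable def GPlus (q t : K) : PowerSeries K :=
  (1 - PowerSeries.C q * PowerSeries.X) * (1 - PowerSeries.C t⁻¹ * PowerSeries.X) *
    (1 - PowerSeries.C (q⁻¹ * t) * PowerSeries.X)

/-- `G^-(z) = (1 - q⁻¹ z) (1 - t z) (1 - q t⁻¹ z)`. -/
noncomputable def GMinus (q t : K) : PowerSeries K :=
  (1 - PowerSeries.C q⁻¹ * PowerSeries.X) * (1 - PowerSeries.C t * PowerSeries.X) *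
    (1 - PowerSeries.C (q * t⁻¹) * PowerSeries.X)

/-- The coefficient of `z^r` in `g(z) = G^+(z) / G^-(z)`. -/
noncomputable def gCoeff (q t : K) (r : ℕ) : K :=
  PowerSeries.coeff r (GPlus q t * (GMinus q t)⁻¹)

/-- The coefficient of `z^r` in `g(z)⁻¹`. -/
noncomputable def gInvCoeff (q t : K) (r : ℕ) : K :=
  PowerSeries.coeff r (GMinus q t * (GPlus q t)⁻¹)

open FreeAlgebra in
/-- The defining relations of `U`, written for the modes of the currents. -/
inductive URel (q t : K) : FreeAlgebra K Gen → FreeAlgebra K Gen → Prop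
  | gamma_mul_inv : URel q t (ι K Gen.gammaHalf * ι K Gen.gammaHalfInv) 1
  | gamma_inv_mul : URel q t (ι K Gen.gammaHalfInv * ι K Gen.gammaHalf) 1
  | gamma_central (x : Gen) :
      URel q t (ι K Gen.gammaHalf * ι K x) (ι K x * ι K Gen.gammaHalf)
  /-- `ψ^+(z) ψ^+(w) = ψ^+(w) ψ^+(z)` -/
  | psiPlus_psiPlus (m n : ℕ) :
      URel q t (ι K (.psiPlus m) * ι K (.psiPlus n)) (ι K (.psiPlus n) * ι K (.psiPlus m))
  /-- `ψ^-(z) ψ^-(w) = ψ^-(w) ψ^-(z)` -/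
  | psiMinus_psiMinus (m n : ℕ) :
      URel q t (ι K (.psiMinus m) * ι K (.psiMinus n)) (ι K (.psiMinus n) * ι K (.psiMinus m))
  /-- `ψ^+(z) ψ^-(w) = g(γ w / z) g(γ⁻¹ w / z)⁻¹ ψ^-(w) ψ^+(z)` -/
  | psiPlus_psiMinus (m n : ℕ) :
      URel q t (ι K (.psiPlus m) * ι K (.psiMinus n))
        (∑ r ∈ Finset.range (min m n + 1), (∑ ab ∈ Finset.HasAntidiagonal.antidiagonal r,
          (gCoeff q t ab.1 * gInvCoeff q t ab.2) • gammaPow (ι K) (2 * ((ab.1 : ℤ) - ab.2))) *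
            ι K (.psiMinus (n - r)) * ι K (.psiPlus (m - r)))
  /-- `ψ^+(z) x^+(w) = g(γ^(-1/2) w / z)⁻¹ x^+(w) ψ^+(z)` -/
  | psiPlus_xPlus (m : ℕ) (n : ℤ) :
      URel q t (ι K (.psiPlus m) * ι K (.xPlus n))
        (∑ r ∈ Finset.range (m + 1), gInvCoeff q t r •
          (gammaPow (ι K) (-(r : ℤ)) * ι K (.xPlus (n + r)) * ι K (.psiPlus (m - r))))
  /-- `ψ^+(z) x^-(w) = g(γ^(1/2) w / z) x^-(w) ψ^+(z)` -/
  | psiPlus_xMinus (m : ℕ) (n : ℤ) :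
      URel q t (ι K (.psiPlus m) * ι K (.xMinus n))
        (∑ r ∈ Finset.range (m + 1), gCoeff q t r •
          (gammaPow (ι K) (r : ℤ) * ι K (.xMinus (n + r)) * ι K (.psiPlus (m - r))))
  /-- `ψ^-(z) x^+(w) = g(γ^(-1/2) z / w) x^+(w) ψ^-(z)` -/
  | psiMinus_xPlus (m : ℕ) (n : ℤ) :
      URel q t (ι K (.psiMinus m) * ι K (.xPlus n))
        (∑ r ∈ Finset.range (m + 1), gCoeff q t r •
          (gammaPow (ι K) (-(r : ℤ)) * ι K (.xPlus (n - r)) * ι K (.psiMinus (m - r))))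
  /-- `ψ^-(z) x^-(w) = g(γ^(1/2) z / w)⁻¹ x^-(w) ψ^-(z)` -/
  | psiMinus_xMinus (m : ℕ) (n : ℤ) :
      URel q t (ι K (.psiMinus m) * ι K (.xMinus n))
        (∑ r ∈ Finset.range (m + 1), gInvCoeff q t r •
          (gammaPow (ι K) (r : ℤ) * ι K (.xMinus (n - r)) * ι K (.psiMinus (m - r))))
  /-- `[x^+(z), x^-(w)] = (1 - q) (1 - 1/t) / (1 - q/t) *
  (δ(γ⁻¹ z / w) ψ^+(γ^(1/2) w) - δ(γ z / w) ψ^-(γ^(-1/2) w))` -/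
  | xPlus_xMinus (m n : ℤ) :
      URel q t (ι K (.xPlus m) * ι K (.xMinus n) - ι K (.xMinus n) * ι K (.xPlus m))
        (((1 - q) * (1 - t⁻¹) / (1 - q / t)) •
          ((if 0 ≤ m + n then gammaPow (ι K) (m - n) * ι K (.psiPlus (m + n).toNat) else 0) -
            (if m + n ≤ 0 then gammaPow (ι K) (n - m) * ι K (.psiMinus (-(m + n)).toNat) else 0)))
  /-- `G^-(z / w) x^+(z) x^+(w) = G^+(z / w) x^+(w) x^+(z)` -/
  | xPlus_xPlus (m n : ℤ) :
      URel q t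
        (∑ r ∈ Finset.range 4, PowerSeries.coeff r (GMinus q t) •
          (ι K (.xPlus (m + r)) * ι K (.xPlus (n - r))))
        (∑ r ∈ Finset.range 4, PowerSeries.coeff r (GPlus q t) •
          (ι K (.xPlus (n - r)) * ι K (.xPlus (m + r))))
  /-- `G^+(z / w) x^-(z) x^-(w) = G^-(z / w) x^-(w) x^-(z)` -/
  | xMinus_xMinus (m n : ℤ) :
      URel q t
        (∑ r ∈ Finset.range 4, PowerSeries.coeff r (GPlus q t) •
          (ι K (.xMinus (m + r)) * ι K (.xMinus (n - r))))
        (∑ r ∈ Finset.range 4, PowerSeries.coeff r (GMinus q t) •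
          (ι K (.xMinus (n - r)) * ι K (.xMinus (m + r))))

/-- The algebra `U`, with scalars extended to `K`. -/
abbrev U (q t : K) : Type _ := RingQuot (URel q t)

end Algebra

/-! ### The vertical module `F^(0,1)_u` -/

section Vertical

variable {K : Type*} [Field K]

/-- The coefficient `A^+_(lam, i)`, `i ≥ 1`. -/
noncomputable def APlus (q t : K) (lam : YoungDiagram) (i : ℕ) : K :=
  (1 - t) * ∏ j ∈ Finset.Icc 1 (i - 1),
    ((1 - q ^ ((part lam i : ℤ) - part lam j) * t ^ (-(i : ℤ) + j + 1)) *
      (1 - q ^ ((part lam i : ℤ) - part lam j + 1) * t ^ (-(i : ℤ) + j - 1))) /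
    ((1 - q ^ ((part lam i : ℤ) - part lam j) * t ^ (-(i : ℤ) + j)) *
      (1 - q ^ ((part lam i : ℤ) - part lam j + 1) * t ^ (-(i : ℤ) + j)))

/-- The coefficient `A^-_(lam, i)`, `i ≥ 1`. The factors of the infinite product over `j > i` with
`j > l(lam)` are equal to `1`. -/
noncomputable def AMinus (q t : K) (lam : YoungDiagram) (i : ℕ) : K :=
  (1 - t⁻¹) * ((1 - q ^ ((part lam (i + 1) : ℤ) - part lam i)) /
      (1 - q ^ ((part lam (i + 1) : ℤ) - part lam i + 1) * t⁻¹)) *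
    ∏ j ∈ Finset.Icc (i + 1) (len lam),
      ((1 - q ^ ((part lam j : ℤ) - part lam i + 1) * t ^ (-(j : ℤ) + i - 1)) *
        (1 - q ^ ((part lam (j + 1) : ℤ) - part lam i) * t ^ (-(j : ℤ) + i))) /
      ((1 - q ^ ((part lam (j + 1) : ℤ) - part lam i + 1) * t ^ (-(j : ℤ) + i - 1)) *
        (1 - q ^ ((part lam j : ℤ) - part lam i) * t ^ (-(j : ℤ) + i)))

/-- The power series `1 - a z`. -/
noncomputable def oneSub (a : K) : PowerSeries K := 1 - PowerSeries.C a * PowerSeries.X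

/-- The power series `B^+_lam(z)`. The factors of the infinite product with `i > l(lam)` are equal
to `1`. -/
noncomputable def BPlus (q t : K) (lam : YoungDiagram) : PowerSeries K :=
  oneSub (q ^ ((part lam 1 : ℤ) - 1) * t) * (oneSub (q ^ (part lam 1 : ℤ)))⁻¹ *
    ∏ i ∈ Finset.Icc 1 (len lam),
      (oneSub (q ^ (part lam i : ℤ) * t ^ (-(i : ℤ))) *
        oneSub (q ^ ((part lam (i + 1) : ℤ) - 1) * t ^ (-(i : ℤ) + 1)) *
      (oneSub (q ^ (part lam (i + 1) : ℤ) * t ^ (-(i : ℤ))) *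
        oneSub (q ^ ((part lam i : ℤ) - 1) * t ^ (-(i : ℤ) + 1)))⁻¹)

/-- The power series `B^-_lam(z)`. The factors of the infinite product with `i > l(lam)` are equal
to `1`. -/
noncomputable def BMinus (q t : K) (lam : YoungDiagram) : PowerSeries K :=
  oneSub (q ^ (-(part lam 1 : ℤ) + 1) * t⁻¹) * (oneSub (q ^ (-(part lam 1 : ℤ))))⁻¹ *
    ∏ i ∈ Finset.Icc 1 (len lam),
      (oneSub (q ^ (-(part lam i : ℤ)) * t ^ (i : ℤ)) *
        oneSub (q ^ (-(part lam (i + 1) : ℤ) + 1) * t ^ ((i : ℤ) - 1)) *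
      (oneSub (q ^ (-(part lam (i + 1) : ℤ)) * t ^ (i : ℤ)) *
        oneSub (q ^ (-(part lam i : ℤ) + 1) * t ^ ((i : ℤ) - 1)))⁻¹)

/-- The action of the generators on `F^(0,1)_u`, given on the basis `(P_lam)`. Here `s = q^(1/4)`
and `r = t^(1/4)`, and `δ(a / z) = ∑ a^n z^(-n)`. -/
noncomputable def verticalAct [CharZero K] (s r u : K) : Gen → Module.End K (Fock K)
  | .xPlus n => (macdonaldBasis (s ^ 4) (r ^ 4)).constr K fun lam =>
      ∑ i ∈ Finset.Icc 1 (len lam + 1),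
        (APlus (s ^ 4) (r ^ 4) lam i *
            ((s ^ 4) ^ (part lam i : ℤ) * (r ^ 4) ^ (-(i : ℤ) + 1) * u) ^ n) •
          macdonaldP (s ^ 4) (r ^ 4) (addBox lam i)
  | .xMinus n => (macdonaldBasis (s ^ 4) (r ^ 4)).constr K fun lam =>
      (s ^ 2 * (r ^ 2)⁻¹) • ∑ i ∈ Finset.Icc 1 (len lam),
        (AMinus (s ^ 4) (r ^ 4) lam i *
            ((s ^ 4) ^ ((part lam i : ℤ) - 1) * (r ^ 4) ^ (-(i : ℤ) + 1) * u) ^ n) •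
          macdonaldP (s ^ 4) (r ^ 4) (removeBox lam i)
  | .psiPlus n => (macdonaldBasis (s ^ 4) (r ^ 4)).constr K fun lam =>
      (s ^ 2 * (r ^ 2)⁻¹ * PowerSeries.coeff n (BPlus (s ^ 4) (r ^ 4) lam) * u ^ n) •
        macdonaldP (s ^ 4) (r ^ 4) lam
  | .psiMinus n => (macdonaldBasis (s ^ 4) (r ^ 4)).constr K fun lam =>
      ((s ^ 2)⁻¹ * r ^ 2 * PowerSeries.coeff n (BMinus (s ^ 4) (r ^ 4) lam) * (u ^ n)⁻¹) •
        macdonaldP (s ^ 4) (r ^ 4) lam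
  | .gammaHalf => 1
  | .gammaHalfInv => 1

end Vertical

/-! ### Vertex operators and the horizontal modules `F^(1,N)_u` -/

section Horizontal

variable {K : Type*} [Field K]

/-- The coefficient of `z^k` in `exp(∑_(n ≥ 1) c_n z^n)`, for pairwise commuting `c_n`. -/
noncomputable def expCoeff (K : Type*) [Field K] {A : Type*} [Ring A] [Algebra K A]
    (c : ℕ → A) (k : ℕ) : A :=
  ∑ r ∈ Finset.range (k + 1), ((r.factorial : K)⁻¹) •
    PowerSeries.coeff k ((PowerSeries.mk fun n => if n = 0 then 0 else c n) ^ r)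

/-- The Heisenberg generator `a_(-n)`, `n ≥ 1`: multiplication by `p_n`. -/
noncomputable def aNeg (K : Type*) [Field K] (n : ℕ) : Module.End K (Fock K) :=
  LinearMap.mulLeft K (powerSum K n)

/-- The Heisenberg generator `a_n = n (1 - q^n) / (1 - t^n) ∂/∂p_n`, `n ≥ 1`. -/
noncomputable def aPos (q t : K) (n : ℕ) : Module.End K (Fock K) :=
  ((n : K) * ((1 - q ^ n) / (1 - t ^ n))) • (MvPolynomial.pderiv (R := K) (n - 1)).toLinearMap

/-- The generator `a_(-n)`, `n ≥ 1`, on the completed Fock space. -/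
noncomputable def aNegHat (K : Type*) [Field K] (n : ℕ) : Module.End K (FockHat K) :=
  LinearMap.mulLeft K (MvPowerSeries.X (n - 1))

/-- The generator `a_n`, `n ≥ 1`, on the completed Fock space. -/
noncomputable def aPosHat (q t : K) (n : ℕ) : Module.End K (FockHat K) :=
  ((n : K) * ((1 - q ^ n) / (1 - t ^ n))) • (MvPowerSeries.pderiv K (n - 1)).toLinearMap

/-- The pair `(b, d)` stands for the normal ordered exponential
`exp(∑_(n ≥ 1) b_n a_(-n)) exp(∑_(n ≥ 1) d_n a_n)`. The normal ordering of a product of such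
exponentials moves all `a_(-n)` to the left of all `a_n`, and so corresponds to the sum of the
pairs. -/
abbrev VertexExponent (K : Type*) : Type _ := (ℕ → K) × (ℕ → K)

/-- The insertion of a spectral parameter: `a_(-n)` is replaced by `z^n a_(-n)`, and `a_n` by
`z^(-n) a_n`. -/
def VertexExponent.at (E : VertexExponent K) (z : K) : VertexExponent K :=
  (fun n => E.1 n * z ^ n, fun n => E.2 n * (z ^ n)⁻¹)

/-- The coefficient of `z^k` in
`V(z) = exp(∑ b_n a_(-n) z^n) exp(∑ d_n a_n z^(-n))`, where `(b, d) = E`, as an operator on the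
Fock space. On a vector of degree `D` the coefficient of `z^(-l)` in the second factor vanishes for
`l > D`. -/
noncomputable def mode (q t : K) (E : VertexExponent K) (k : ℤ) : Module.End K (Fock K) :=
  (MvPolynomial.basisMonomials ℕ K).constr K fun m =>
    ∑ l ∈ Finset.range (weight m + 1),
      if 0 ≤ k + l then
        expCoeff K (fun n => E.1 n • aNeg K n) (k + l).toNat
          (expCoeff K (fun n => E.2 n • aPos q t n) l (MvPolynomial.monomial m 1))
      else 0

/-- The component on the monomial `m` of the coefficient of `z^k` in `V(z)` on the completed Fock
space. The image of the coefficient of `z^j` in the first factor has no components of degree smaller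
than `j`, so that only the terms with `j ≤ weight m` contribute. -/
noncomputable def modeHatCoeff (q t : K) (E : VertexExponent K) (k : ℤ) (m : ℕ →₀ ℕ) :
    FockHat K →ₗ[K] K :=
  ∑ j ∈ Finset.range (weight m + 1),
    if k ≤ j then
      MvPowerSeries.coeff m ∘ₗ expCoeff K (fun n => E.1 n • aNegHat K n) j ∘ₗ
        expCoeff K (fun n => E.2 n • aPosHat q t n) ((j : ℤ) - k).toNat
    else 0

/-- The coefficient of `z^k` in `V(z)`, as an operator on the completed Fock space. -/
noncomputable def modeHat (q t : K) (E : VertexExponent K) (k : ℤ) :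
    Module.End K (FockHat K) where
  toFun f := fun m => modeHatCoeff q t E k m f
  map_add' f g := funext fun m => map_add (modeHatCoeff q t E k m) f g
  map_smul' a f := funext fun m => map_smul (modeHatCoeff q t E k m) a f

/-- The operator `exp(∑ b_n a_(-n)) exp(∑ d_n a_n)`, where `(b, d) = E`, from the Fock space to its
completion. -/
noncomputable def vertexOperator (q t : K) (E : VertexExponent K) : Fock K →ₗ[K] FockHat K :=
  (MvPolynomial.basisMonomials ℕ K).constr K fun m => fun m' =>
    ∑ j ∈ Finset.range (weight m' + 1), ∑ l ∈ Finset.range (weight m + 1),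
      MvPolynomial.coeff m' (expCoeff K (fun n => E.1 n • aNeg K n) j
        (expCoeff K (fun n => E.2 n • aPos q t n) l (MvPolynomial.monomial m 1)))

/-- The current `η(z)` (with `z = 1`). -/
noncomputable def eta (t : K) : VertexExponent K :=
  (fun n => (1 - (t ^ n)⁻¹) / n, fun n => -((1 - t ^ n) / n))

/-- The current `ξ(z)` (with `z = 1`). Here `s = q^(1/4)` and `r = t^(1/4)`. -/
noncomputable def xi (s r : K) : VertexExponent K :=
  (fun n => -((1 - ((r ^ 4) ^ n)⁻¹) / n * ((s ^ 2) ^ n)⁻¹ * (r ^ 2) ^ n),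
    fun n => (1 - (r ^ 4) ^ n) / n * ((s ^ 2) ^ n)⁻¹ * (r ^ 2) ^ n)

/-- The current `φ^+(z)` (with `z = 1`). -/
noncomputable def phiPlus (s r : K) : VertexExponent K :=
  (0, fun n => -((1 - (r ^ 4) ^ n) / n * (1 - (r ^ 4) ^ n * ((s ^ 4) ^ n)⁻¹) * s ^ n * (r ^ n)⁻¹))

/-- The current `φ^-(z)` (with `z = 1`). -/
noncomputable def phiMinus (s r : K) : VertexExponent K :=
  (fun n => (1 - ((r ^ 4) ^ n)⁻¹) / n * (1 - (r ^ 4) ^ n * ((s ^ 4) ^ n)⁻¹) * s ^ n * (r ^ n)⁻¹, 0)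

/-- The action of the generators on `F^(1,N)_u`, or on its completion, in terms of the
coefficients `M E k` of `z^k` in the currents `E(z)`:
`γ^(1/2) = (t/q)^(1/4)`, `x^+(z) = u z^(-N) q^(-N/2) t^(N/2) η(z)`,
`x^-(z) = u⁻¹ z^N q^(N/2) t^(-N/2) ξ(z)`, `ψ^±(z) = q^(±N/2) t^(∓N/2) φ^±(z)`. -/
noncomputable def horizontalActOf {V : Type*} [AddCommGroup V] [Module K V]
    (M : VertexExponent K → ℤ → Module.End K V) (s r : K) (N : ℤ) (u : K) : Gen → Module.End K V
  | .xPlus n => (u * (s ^ 2) ^ (-N) * (r ^ 2) ^ N) • M (eta (r ^ 4)) (N - n)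
  | .xMinus n => (u⁻¹ * (s ^ 2) ^ N * (r ^ 2) ^ (-N)) • M (xi s r) (-N - n)
  | .psiPlus n => ((s ^ 2) ^ N * (r ^ 2) ^ (-N)) • M (phiPlus s r) (-(n : ℤ))
  | .psiMinus n => ((s ^ 2) ^ (-N) * (r ^ 2) ^ N) • M (phiMinus s r) n
  | .gammaHalf => (r / s) • 1
  | .gammaHalfInv => (s / r) • 1

/-- The action of the generators on `F^(1,N)_u`. -/
noncomputable def horizontalAct (s r : K) (N : ℤ) (u : K) : Gen → Module.End K (Fock K) :=
  horizontalActOf (mode (s ^ 4) (r ^ 4)) s r N u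

/-- The action of the generators on the completion of `F^(1,N)_u`. -/
noncomputable def horizontalActHat (s r : K) (N : ℤ) (u : K) : Gen → Module.End K (FockHat K) :=
  horizontalActOf (modeHat (s ^ 4) (r ^ 4)) s r N u

end Horizontal

/-! ### The coproduct and the intertwining operators -/

section Intertwiner

open scoped TensorProduct

variable {K : Type*} [Field K]

/-- The operator `∑_k A_k ⊗ B_k` on `V ⊗ F`, for a family with the property that each vector of `F`
is annihilated by all but finitely many `B_k`. -/
noncomputable def tensorSum {V : Type*} [AddCommGroup V] [Module K V]
    (A : ℕ → Module.End K V) (B : ℕ → Module.End K (Fock K)) : Module.End K (V ⊗[K] Fock K) :=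
  TensorProduct.lift (((MvPolynomial.basisMonomials ℕ K).constr K fun m =>
    ∑ᶠ k, ((TensorProduct.mk K V (Fock K)).flip (B k (MvPolynomial.monomial m 1))) ∘ₗ A k).flip)

/-- The action of the generators on `V ⊗ F` through the coproduct
`Δ(γ^(±1/2)) = γ^(±1/2) ⊗ γ^(±1/2)`,
`Δ(x^+(z)) = x^+(z) ⊗ 1 + ψ^-(γ_1^(1/2) z) ⊗ x^+(γ_1 z)`,
`Δ(x^-(z)) = x^-(γ_2 z) ⊗ ψ^+(γ_2^(1/2) z) + 1 ⊗ x^-(z)`,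
`Δ(ψ^±(z)) = ψ^±(γ_2^(±1/2) z) ⊗ ψ^±(γ_1^(∓1/2) z)`,
with `γ_1 = γ ⊗ 1` and `γ_2 = 1 ⊗ γ`; the coefficients of the powers of `z` are taken. -/
noncomputable def coproductAct {V : Type*} [AddCommGroup V] [Module K V]
    (a : Gen → Module.End K V) (b : Gen → Module.End K (Fock K)) :
    Gen → Module.End K (V ⊗[K] Fock K)
  | .xPlus n => TensorProduct.map (a (.xPlus n)) 1 +
      tensorSum (fun k => gammaPow a (-2 * n - k) * a (.psiMinus k)) (fun k => b (.xPlus (n + k)))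
  | .xMinus n =>
      tensorSum (fun k => a (.xMinus (n - k))) (fun k => gammaPow b (k - 2 * n) * b (.psiPlus k)) +
        TensorProduct.map 1 (b (.xMinus n))
  | .psiPlus n => ∑ ij ∈ Finset.HasAntidiagonal.antidiagonal n,
      TensorProduct.map (gammaPow a ij.2 * a (.psiPlus ij.1))
        (gammaPow b (-(ij.1 : ℤ)) * b (.psiPlus ij.2))
  | .psiMinus n => ∑ ij ∈ Finset.HasAntidiagonal.antidiagonal n,
      TensorProduct.map (gammaPow a ij.2 * a (.psiMinus ij.1))
        (gammaPow b (-(ij.1 : ℤ)) * b (.psiMinus ij.2))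
  | .gammaHalf => TensorProduct.map (a .gammaHalf) (b .gammaHalf)
  | .gammaHalfInv => TensorProduct.map (a .gammaHalfInv) (b .gammaHalfInv)

/-- `Φ : F^(0,1)_v ⊗ F^(1,N)_u → F^(1,N+1)_w` (with values in the completion) is an intertwining
operator: `a Φ = Φ Δ(a)` for all `a ∈ U`. The element `a` acts through any expression `x` of it in
the generators. -/
def IsIntertwiner [CharZero K] (s r : K) (N : ℤ) (u v w : K)
    (Phi : Fock K ⊗[K] Fock K →ₗ[K] FockHat K) : Prop :=
  ∀ a : U (s ^ 4) (r ^ 4), ∀ x : FreeAlgebra K Gen,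
    RingQuot.mkAlgHom K (URel (s ^ 4) (r ^ 4)) x = a →
      FreeAlgebra.lift K (horizontalActHat s r (N + 1) w) x ∘ₗ Phi =
        Phi ∘ₗ FreeAlgebra.lift K (coproductAct (verticalAct s r v) (horizontalAct s r N u)) x

/-- The component `Φ_lam`, `Φ_lam(α) = Φ(P_lam ⊗ α)`. -/
noncomputable def component (s r : K) (Phi : Fock K ⊗[K] Fock K →ₗ[K] FockHat K)
    (lam : YoungDiagram) : Fock K →ₗ[K] FockHat K :=
  Phi ∘ₗ TensorProduct.mk K (Fock K) (Fock K) (macdonaldP (s ^ 4) (r ^ 4) lam)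

/-- The intertwining operators with the normalization `Φ_∅(1) = 1 + ⋯`, where the dots are terms of
positive degree. -/
def IsNormalizedIntertwiner [CharZero K] (s r : K) (N : ℤ) (u v w : K)
    (Phi : Fock K ⊗[K] Fock K →ₗ[K] FockHat K) : Prop :=
  IsIntertwiner s r N u v w Phi ∧
    MvPowerSeries.constantCoeff (component s r Phi ⊥ 1) = 1

end Intertwiner

/-! ### The explicit components -/

section Components

variable {K : Type*} [Field K]

/-- `c_lam = ∏ (1 - q^(arm) t^(leg + 1))`. -/
noncomputable def cStat (q t : K) (lam : YoungDiagram) : K :=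
  ∏ c ∈ lam.cells,
    (1 - q ^ (lam.rowLen c.1 - (c.2 + 1)) * t ^ (lam.colLen c.2 - (c.1 + 1) + 1))

/-- Taki's framing factor
`f_lam = (-1)^|lam| q^(n(lam') + |lam|/2) t^(-n(lam) - |lam|/2)`. -/
noncomputable def framing (s r : K) (lam : YoungDiagram) : K :=
  (-1) ^ lam.card * ((s ^ 4) ^ nStat lam.transpose * (s ^ 2) ^ lam.card) *
    ((r ^ 4) ^ nStat lam * (r ^ 2) ^ lam.card)⁻¹

/-- `t(lam, u, v, N) = (-v u)^|lam| (-v)^(-(N+1)|lam|) f_lam^(-N-1)`. -/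
noncomputable def tFactor (s r u v : K) (N : ℤ) (lam : YoungDiagram) : K :=
  (-(v * u)) ^ lam.card * (-v) ^ (-(N + 1) * (lam.card : ℤ)) * framing s r lam ^ (-N - 1)

/-- The vertex operator `Φ̃_∅(v)`. -/
noncomputable def phiEmpty (q v : K) : VertexExponent K :=
  (fun n => -(1 / (n : K) * (1 / (1 - q ^ n)) * v ^ n),
    fun n => -(1 / (n : K) * (q ^ n / (1 - q ^ n)) * (v ^ n)⁻¹))

/-- `η_lam(v) = :∏_i ∏_j η(q^(j-1) t^(-i+1) v):`, the product over the boxes `(i, j)` of `lam`. -/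
noncomputable def etaLam (q t v : K) (lam : YoungDiagram) : VertexExponent K :=
  ∑ c ∈ lam.cells, (eta t).at (q ^ c.2 * (t ^ c.1)⁻¹ * v)

/-- The operator `Φ̃_lam(v) = q^(n(lam')) / c_lam :Φ̃_∅(v) η_lam(v):`. -/
noncomputable def phiTilde (q t v : K) (lam : YoungDiagram) : Fock K →ₗ[K] FockHat K :=
  (q ^ nStat lam.transpose / cStat q t lam) •
    vertexOperator q t (phiEmpty q v + etaLam q t v lam)

end Components

end FockVertex

namespace FockVertex

/-! ### Exponential series with commuting coefficients -/

section ExpCoeff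

open PowerSeries Finset

/-- The operator `z d/dz` on power series. -/
noncomputable def eulerDeriv {A : Type*} [Ring A] (f : PowerSeries A) : PowerSeries A :=
  PowerSeries.mk fun n => n • PowerSeries.coeff n f

theorem eulerDeriv_mul {A : Type*} [Ring A] (f g : PowerSeries A) :
    eulerDeriv (f * g) = eulerDeriv f * g + f * eulerDeriv g := by
  ext n
  simp only [eulerDeriv, coeff_mk, map_add, coeff_mul]
  rw [← sum_add_distrib, smul_sum]
  refine sum_congr rfl fun p hp => ?_
  rw [← mem_antidiagonal.1 hp, add_smul, smul_mul_assoc, mul_smul_comm]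

theorem eulerDeriv_pow {A : Type*} [Ring A] {f : PowerSeries A} (h : Commute f (eulerDeriv f))
    (r : ℕ) : eulerDeriv (f ^ (r + 1)) = (r + 1) • (eulerDeriv f * f ^ r) := by
  induction r with
  | zero => simp
  | succ r ih =>
    rw [pow_succ, eulerDeriv_mul, ih, smul_mul_assoc, mul_assoc, ← pow_succ,
      (h.pow_left (r + 1)).eq, succ_nsmul (eulerDeriv f * f ^ (r + 1)) (r + 1)]

theorem coeff_pow_eq_zero_of_lt {A : Type*} [Ring A] {f : PowerSeries A}
    (hf : PowerSeries.coeff 0 f = 0) : ∀ {r k : ℕ}, k < r → PowerSeries.coeff k (f ^ r) = 0 := by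
  intro r
  induction r with
  | zero => intro k hk; omega
  | succ r ih =>
    intro k hk
    rw [pow_succ', coeff_mul]
    refine sum_eq_zero fun p hp => ?_
    have hp := mem_antidiagonal.1 hp
    rcases Nat.eq_zero_or_pos p.1 with h0 | h0
    · rw [h0, hf, zero_mul]
    · rw [ih (by omega), mul_zero]

variable {K : Type*} [Field K] {A : Type*} [Ring A] [Algebra K A]

theorem expCoeff_zero (c : ℕ → A) : expCoeff K c 0 = 1 := by
  simp [expCoeff]

theorem expCoeff_eq_sum (c : ℕ → A) {k R : ℕ} (h : k < R) :
    expCoeff K c k = ∑ r ∈ range R, ((r.factorial : K)⁻¹) •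
      PowerSeries.coeff k ((PowerSeries.mk fun n => if n = 0 then 0 else c n) ^ r) := by
  refine sum_subset (range_subset_range.2 h) fun r _ hr => ?_
  rw [coeff_pow_eq_zero_of_lt (by simp) (by simpa using hr), smul_zero]

theorem natCast_smul_expCoeff [CharZero K] {c : ℕ → A}
    (hc : ∀ i j, 0 < i → 0 < j → Commute (c i) (c j)) (k : ℕ) :
    (k : K) • expCoeff K c k =
      ∑ p ∈ antidiagonal k, (p.1 : K) • (c p.1 * expCoeff K c p.2) := by
  set f : PowerSeries A := PowerSeries.mk fun n => if n = 0 then 0 else c n with hf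
  have hcomm : Commute f (eulerDeriv f) := by
    ext n
    rw [coeff_mul, coeff_mul, ← Nat.sum_antidiagonal_swap]
    refine sum_congr rfl fun p _ => ?_
    simp only [hf, eulerDeriv, coeff_mk, Prod.fst_swap, Prod.snd_swap]
    split_ifs with h1 h2 h2
    · simp
    · simp
    · simp
    · rw [mul_smul_comm, smul_mul_assoc, (hc p.1 p.2 (by omega) (by omega)).eq]
  have h1 : ∀ r, (k : K) • PowerSeries.coeff k (f ^ r) = PowerSeries.coeff k (eulerDeriv (f ^ r)) := by
    intro r
    rw [eulerDeriv, coeff_mk, Nat.cast_smul_eq_nsmul]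
  rw [expCoeff_eq_sum c (show k < k + 1 + 1 by omega), smul_sum, sum_range_succ']
  simp only [← hf]
  have h0 : (k : K) • (((0 : ℕ).factorial : K)⁻¹ • PowerSeries.coeff k (f ^ 0)) = 0 := by
    rcases Nat.eq_zero_or_pos k with h | h
    · simp [h]
    · simp [coeff_one, h.ne']
  rw [h0, add_zero]
  have h2 : ∀ r ∈ range (k + 1), (k : K) • (((r + 1).factorial : K)⁻¹ •
      PowerSeries.coeff k (f ^ (r + 1))) = ∑ p ∈ antidiagonal k, (p.1 : K) •
        (c p.1 * ((r.factorial : K)⁻¹ • PowerSeries.coeff p.2 (f ^ r))) := by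
    intro r _
    rw [smul_comm, h1, eulerDeriv_pow hcomm, map_nsmul, ← Nat.cast_smul_eq_nsmul K, smul_smul,
      Nat.factorial_succ, Nat.cast_mul, mul_inv_rev, mul_assoc, inv_mul_cancel₀
        (Nat.cast_ne_zero.2 r.succ_ne_zero), mul_one, coeff_mul, smul_sum]
    refine sum_congr rfl fun p _ => ?_
    rw [mul_smul_comm, smul_comm]
    congr 1
    simp only [eulerDeriv, hf, coeff_mk]
    rcases Nat.eq_zero_or_pos p.1 with h | h
    · simp [h]
    · rw [if_neg h.ne', Nat.cast_smul_eq_nsmul, smul_mul_assoc]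
  rw [sum_congr rfl h2, sum_comm]
  refine sum_congr rfl fun p hp => ?_
  have := mem_antidiagonal.1 hp
  rw [expCoeff_eq_sum c (show p.2 < k + 1 by omega), mul_sum, smul_sum]

variable (K) in
/-- The coefficients of the exponential series, extended by zero to negative indices. -/
noncomputable def expZ (c : ℕ → A) (k : ℤ) : A := if 0 ≤ k then expCoeff K c k.toNat else 0

theorem expZ_natCast (c : ℕ → A) (k : ℕ) : expZ K c k = expCoeff K c k := by
  simp [expZ]

theorem expZ_zero (c : ℕ → A) : expZ K c 0 = 1 := by
  simp [expZ, expCoeff_zero]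

theorem expZ_of_neg (c : ℕ → A) {k : ℤ} (h : k < 0) : expZ K c k = 0 := by
  rw [expZ, if_neg (by omega)]

theorem intCast_smul_expZ [CharZero K] {c : ℕ → A}
    (hc : ∀ i j, 0 < i → 0 < j → Commute (c i) (c j)) {k : ℤ} {M : ℕ} (hM : k ≤ M) :
    (k : K) • expZ K c k =
      ∑ j ∈ range M, ((j + 1 : ℕ) : K) • (c (j + 1) * expZ K c (k - (j + 1 : ℕ))) := by
  rcases lt_or_ge k 0 with h | h
  · rw [expZ_of_neg c h, smul_zero]
    exact (sum_eq_zero fun j _ => by rw [expZ_of_neg c (by omega), mul_zero, smul_zero]).symm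
  · lift k to ℕ using h
    rw [expZ_natCast, Int.cast_natCast, natCast_smul_expCoeff hc,
      Nat.sum_antidiagonal_eq_sum_range_succ_mk, sum_range_succ']
    simp only [Nat.cast_zero, zero_smul, add_zero]
    refine (sum_congr rfl fun j hj => ?_).trans (sum_subset (range_subset_range.2
      (show k ≤ M by omega)) fun j _ hj => ?_)
    · have := mem_range.1 hj
      rw [← expZ_natCast, Nat.cast_sub (by omega)]
    · rw [mem_range, not_lt] at hj
      rw [expZ_of_neg c (by omega), mul_zero, smul_zero]

/-- Induction for statements about the coefficients of exponential series. -/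
theorem int_strong_induction {P : ℤ → Prop} (hneg : ∀ k < 0, P k) (h0 : P 0)
    (hpos : ∀ k : ℤ, 0 < k → (∀ j < k, P j) → P k) (k : ℤ) : P k := by
  have : ∀ n : ℕ, ∀ j : ℤ, j < n → P j := by
    intro n
    induction n with
    | zero => intro j hj; exact hneg j (by simpa using hj)
    | succ n ih =>
      intro j hj
      rcases lt_trichotomy j 0 with h | h | h
      · exact hneg j h
      · exact h ▸ h0
      · exact hpos j h fun i hi => ih i (by push_cast at hj; omega)
  exact this (k + 1).toNat k (by omega)

theorem mul_expZ [CharZero K] {c : ℕ → A} (hc : ∀ i j, 0 < i → 0 < j → Commute (c i) (c j))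
    {x : A} {m : ℕ} (hm : 0 < m) {σ : K}
    (hx : ∀ n, 0 < n → x * c n = c n * x + (if n = m then σ else 0) • 1) (k : ℤ) :
    x * expZ K c k = expZ K c k * x + σ • expZ K c (k - m) := by
  induction k using int_strong_induction with
  | hneg k hk => simp [expZ_of_neg c hk, expZ_of_neg c (show k - m < 0 by omega)]
  | h0 => simp [expZ_zero, expZ_of_neg c (show -(m : ℤ) < 0 by omega)]
  | hpos k hk ih =>
    have hk0 : (k : K) ≠ 0 := by exact_mod_cast hk.ne'
    apply smul_right_injective A hk0
    set M : ℕ := k.toNat + m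
    have hM : k ≤ M := by omega
    have hterm : ∀ j ∈ range M, x * (((j + 1 : ℕ) : K) • (c (j + 1) * expZ K c (k - (j + 1 : ℕ)))) =
        (((j + 1 : ℕ) : K) • (c (j + 1) * expZ K c (k - (j + 1 : ℕ)))) * x +
          σ • (((j + 1 : ℕ) : K) • (c (j + 1) * expZ K c (k - m - (j + 1 : ℕ)))) +
          if j = m - 1 then ((m : K) * σ) • expZ K c (k - m) else 0 := by
      intro j _
      rw [mul_smul_comm, ← mul_assoc, hx (j + 1) j.succ_pos, add_mul, mul_assoc,
        ih _ (by omega), mul_add, smul_add, smul_add, smul_mul_assoc, smul_mul_assoc, ← mul_assoc]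
      congr 1
      · congr 1
        rw [mul_smul_comm, smul_comm, show k - (j + 1 : ℕ) - m = k - m - (j + 1 : ℕ) by ring]
      · by_cases h : j = m - 1
        · subst h
          have : m - 1 + 1 = m := by omega
          simp [this, smul_smul]
        · rw [if_neg (by omega), if_neg h]; simp
    simp only [smul_add]
    rw [← mul_smul_comm, ← smul_mul_assoc, intCast_smul_expZ hc hM, mul_sum, sum_congr rfl hterm,
      sum_add_distrib, sum_add_distrib, ← sum_mul, ← smul_sum,
      ← intCast_smul_expZ hc (show k - m ≤ M by omega), sum_ite_eq', if_pos
        (by rw [mem_range]; omega), add_assoc]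
    congr 1
    rw [smul_smul, smul_smul, ← add_smul]
    congr 1
    push_cast
    ring

theorem expZ_apply_of_eigenvector [CharZero K] {V : Type*} [AddCommGroup V] [Module K V]
    {c : ℕ → Module.End K V} (hc : ∀ i j, 0 < i → 0 < j → Commute (c i) (c j)) {σ : ℕ → K} {g : V}
    (hg : ∀ n, 0 < n → c n g = σ n • g) (k : ℤ) : expZ K c k g = expZ K σ k • g := by
  induction k using int_strong_induction with
  | hneg k hk => simp [expZ_of_neg _ hk]
  | h0 => simp [expZ_zero]
  | hpos k hk ih =>
    have hk0 : (k : K) ≠ 0 := by exact_mod_cast hk.ne'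
    apply smul_right_injective V hk0
    have hM : k ≤ k.toNat := by omega
    simp only
    rw [← LinearMap.smul_apply, intCast_smul_expZ hc hM, smul_smul, ← smul_eq_mul,
      intCast_smul_expZ (fun _ _ _ _ => Commute.all _ _) hM, LinearMap.sum_apply, sum_smul]
    refine sum_congr rfl fun j _ => ?_
    rw [LinearMap.smul_apply, Module.End.mul_apply, ih _ (by omega), map_smul, hg _ j.succ_pos]
    simp only [smul_smul, smul_eq_mul]
    congr 1; ring

theorem apply_expZ_of_functional [CharZero K] {V : Type*} [AddCommGroup V] [Module K V]
    {c : ℕ → Module.End K V} (hc : ∀ i j, 0 < i → 0 < j → Commute (c i) (c j)) {σ : ℕ → K}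
    {φ : V →ₗ[K] K} (hφ : ∀ n, 0 < n → ∀ f, φ (c n f) = σ n * φ f) (k : ℤ) (f : V) :
    φ (expZ K c k f) = expZ K σ k * φ f := by
  induction k using int_strong_induction with
  | hneg k hk => simp [expZ_of_neg _ hk]
  | h0 => simp [expZ_zero]
  | hpos k hk ih =>
    have hk0 : (k : K) ≠ 0 := by exact_mod_cast hk.ne'
    apply mul_left_cancel₀ hk0
    have hM : k ≤ k.toNat := by omega
    rw [← smul_eq_mul, ← map_smul, ← LinearMap.smul_apply, intCast_smul_expZ hc hM, ← mul_assoc,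
      ← smul_eq_mul (k : K) (expZ K σ k), intCast_smul_expZ (fun _ _ _ _ => Commute.all _ _) hM,
      LinearMap.sum_apply, map_sum, sum_mul]
    refine sum_congr rfl fun j _ => ?_
    rw [LinearMap.smul_apply, Module.End.mul_apply, map_smul, hφ _ j.succ_pos, ih _ (by omega)]
    simp only [smul_eq_mul]
    ring

end ExpCoeff

/-! ### Scalar exponential series -/

section ScalarExp

open PowerSeries Finset

variable {K : Type*} [Field K]

/-- `F = exp(∑_(n ≥ 1) c_n z^n)`, expressed by a differential equation. -/
def IsExp (c : ℕ → K) (F : PowerSeries K) : Prop :=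
  constantCoeff F = 1 ∧ eulerDeriv F = (PowerSeries.mk fun n => (n : K) * c n) * F

theorem IsExp.mul {c d : ℕ → K} {F G : PowerSeries K} (hF : IsExp c F) (hG : IsExp d G) :
    IsExp (fun n => c n + d n) (F * G) := by
  refine ⟨by rw [map_mul, hF.1, hG.1, one_mul], ?_⟩
  rw [eulerDeriv_mul, hF.2, hG.2]
  have : (PowerSeries.mk fun n => (n : K) * (c n + d n)) =
      (PowerSeries.mk fun n => (n : K) * c n) + PowerSeries.mk fun n => (n : K) * d n := by
    ext n; simp [mul_add]
  rw [this]; ring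

theorem eulerDeriv_one {A : Type*} [Ring A] : eulerDeriv (1 : PowerSeries A) = 0 := by
  ext n
  rw [eulerDeriv, coeff_mk, coeff_one]
  split_ifs with h <;> simp [h]

theorem IsExp.one : IsExp (fun _ => (0 : K)) 1 := by
  refine ⟨map_one _, ?_⟩
  rw [eulerDeriv_one]
  ext n; simp

theorem IsExp.inv {c : ℕ → K} {F : PowerSeries K} (hF : IsExp c F) :
    IsExp (fun n => -c n) F⁻¹ := by
  have h0 : constantCoeff F ≠ 0 := by rw [hF.1]; exact one_ne_zero
  refine ⟨by rw [constantCoeff_inv, hF.1, inv_one], ?_⟩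
  have h1 : F * F⁻¹ = 1 := PowerSeries.mul_inv_cancel F h0
  have h2 := eulerDeriv_mul F F⁻¹
  rw [h1, eulerDeriv_one, hF.2] at h2
  have h3 : (PowerSeries.mk fun n => (n : K) * -c n) = -(PowerSeries.mk fun n => (n : K) * c n) := by
    ext n; simp
  rw [h3]
  linear_combination (-F⁻¹) * h2 -
    (eulerDeriv F⁻¹ + (PowerSeries.mk fun n => (n : K) * c n) * F⁻¹) * h1

theorem IsExp.congr {c d : ℕ → K} {F : PowerSeries K} (hF : IsExp c F)
    (h : ∀ n, 0 < n → c n = d n) : IsExp d F := by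
  refine ⟨hF.1, hF.2.trans ?_⟩
  congr 1
  ext n
  rcases Nat.eq_zero_or_pos n with hn | hn
  · simp [hn]
  · simp [h n hn]

theorem IsExp.rescale {c : ℕ → K} {F : PowerSeries K} (hF : IsExp c F) (a : K) :
    IsExp (fun n => c n * a ^ n) (PowerSeries.rescale a F) := by
  refine ⟨by rw [← coeff_zero_eq_constantCoeff_apply, coeff_rescale]; simpa using hF.1, ?_⟩
  have h1 : eulerDeriv (PowerSeries.rescale a F) = PowerSeries.rescale a (eulerDeriv F) := by
    ext n; simp [eulerDeriv, coeff_rescale]; ring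
  rw [h1, hF.2, map_mul]
  congr 1
  ext n; simp [coeff_rescale]; ring

theorem isExp_oneSub [CharZero K] (a : K) : IsExp (fun n => -(a ^ n / n)) (oneSub a) := by
  refine ⟨by simp [oneSub], ?_⟩
  ext n
  rcases n with _ | _ | n
  · simp [eulerDeriv, oneSub]
  · simp [eulerDeriv, oneSub, coeff_one, mul_sub, coeff_succ_mul_X, ← mul_assoc]
  · have h1 : ((n : K) + 1) ≠ 0 := by exact_mod_cast n.succ_ne_zero
    have h2 : ((n : K) + 1 + 1) ≠ 0 := by exact_mod_cast (n + 1).succ_ne_zero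
    simp only [eulerDeriv, oneSub, coeff_mk, mul_sub, mul_one, map_sub, ← mul_assoc,
      coeff_succ_mul_X, coeff_mul_C, coeff_one, coeff_C]
    push_cast
    field_simp
    simp
    ring

theorem IsExp.prod {ι : Type*} (s : Finset ι) {c : ι → ℕ → K} {F : ι → PowerSeries K}
    (h : ∀ i ∈ s, IsExp (c i) (F i)) : IsExp (fun n => ∑ i ∈ s, c i n) (∏ i ∈ s, F i) := by
  classical
  induction s using Finset.induction_on with
  | empty => simpa using IsExp.one
  | insert a s ha ih =>
    rw [prod_insert ha]
    refine ((h a (mem_insert_self a s)).mul (ih fun i hi => h i (mem_insert_of_mem hi))).congr ?_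
    intro n _
    rw [sum_insert ha]

theorem IsExp.coeff_eq [CharZero K] {c : ℕ → K} {F : PowerSeries K} (hF : IsExp c F) (k : ℕ) :
    PowerSeries.coeff k F = expCoeff K c k := by
  induction k using Nat.strong_induction_on with
  | _ k ih =>
    rcases Nat.eq_zero_or_pos k with h | h
    · subst h; rw [expCoeff_zero, coeff_zero_eq_constantCoeff_apply, hF.1]
    · have hk0 : (k : K) ≠ 0 := by exact_mod_cast h.ne'
      apply mul_left_cancel₀ hk0
      have h1 := natCast_smul_expCoeff (K := K) (c := c) (fun _ _ _ _ => Commute.all _ _) k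
      have h2 := congrArg (PowerSeries.coeff k) hF.2
      rw [smul_eq_mul] at h1
      rw [h1]
      rw [eulerDeriv, coeff_mk, nsmul_eq_mul, coeff_mul] at h2
      rw [h2]
      refine sum_congr rfl fun p hp => ?_
      have := mem_antidiagonal.1 hp
      rw [coeff_mk, smul_eq_mul]
      rcases Nat.eq_zero_or_pos p.1 with h0 | h0
      · simp [h0]
      · rw [ih p.2 (by omega), mul_assoc]

end ScalarExp

/-! ### Heisenberg operators -/

section Heisenberg

open Finset

variable {K : Type*} [Field K]

/-- The central term `[a_n, a_(-n)]`. -/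
noncomputable def kappa (q t : K) (n : ℕ) : K := (n : K) * ((1 - q ^ n) / (1 - t ^ n))

/-- The Heisenberg relations `[a_n, a_(-m)] = δ_(n, m) κ_n` for operators on a vector space. -/
structure IsHeisenberg {V : Type*} [AddCommGroup V] [Module K V] (κ : ℕ → K)
    (aN aP : ℕ → Module.End K V) : Prop where
  neg_comm : ∀ i j, 0 < i → 0 < j → Commute (aN i) (aN j)
  pos_comm : ∀ i j, 0 < i → 0 < j → Commute (aP i) (aP j)
  pos_mul_neg : ∀ i j, 0 < i → 0 < j →
    aP i * aN j = aN j * aP i + (if j = i then κ i else 0) • 1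

theorem eq_of_pred_eq {i j : ℕ} (hi : 0 < i) (hj : 0 < j) (h : i - 1 = j - 1) : i = j := by omega

theorem isHeisenberg_fock (q t : K) : IsHeisenberg (kappa q t) (aNeg K) (aPos q t) where
  neg_comm i j _ _ := by
    refine LinearMap.ext fun f => ?_
    simp [aNeg, powerSum]; ring
  pos_comm i j _ _ := by
    refine LinearMap.ext fun f => ?_
    simp only [aPos, Module.End.mul_apply, LinearMap.smul_apply, map_smul]
    rw [smul_comm]
    congr 2
    exact MvPolynomial.ext _ _ fun m => by
      simp only [Derivation.coeFn_coe, MvPolynomial.coeff_pderiv]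
      rw [add_right_comm]
      by_cases h : i - 1 = j - 1
      · rw [h]
      · simp [h, Ne.symm h]; ring
  pos_mul_neg i j hi hj := by
    refine LinearMap.ext fun f => ?_
    simp only [aPos, aNeg, powerSum, Module.End.mul_apply, LinearMap.smul_apply, LinearMap.add_apply,
      LinearMap.mulLeft_apply, Derivation.coeFn_coe, Derivation.leibniz, MvPolynomial.pderiv_X,
      kappa, Module.End.one_apply, smul_eq_mul]
    by_cases h : j = i
    · subst h; simp [smul_add, add_comm]
    · have : i - 1 ≠ j - 1 := fun e => h (eq_of_pred_eq hi hj e).symm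
      simp [h, Ne.symm this]

theorem isHeisenberg_fockHat (q t : K) : IsHeisenberg (kappa q t) (aNegHat K) (aPosHat q t) where
  neg_comm i j _ _ := by
    refine LinearMap.ext fun f => ?_
    simp [aNegHat]; ring
  pos_comm i j _ _ := by
    refine LinearMap.ext fun f => ?_
    simp only [aPosHat, Module.End.mul_apply, LinearMap.smul_apply, map_smul]
    rw [smul_comm]
    congr 2
    exact MvPowerSeries.ext fun m => by
      simp only [Derivation.coeFn_coe, MvPowerSeries.coeff_pderiv]
      rw [add_right_comm]
      by_cases h : i - 1 = j - 1
      · rw [h]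
      · simp [h, Ne.symm h]; ring
  pos_mul_neg i j hi hj := by
    refine LinearMap.ext fun f => ?_
    simp only [aPosHat, aNegHat, Module.End.mul_apply, LinearMap.smul_apply, LinearMap.add_apply,
      LinearMap.mulLeft_apply, Derivation.coeFn_coe, Derivation.leibniz, MvPowerSeries.pderiv_X,
      kappa, Module.End.one_apply, smul_eq_mul]
    by_cases h : j = i
    · subst h; simp [smul_add, add_comm]
    · have : i - 1 ≠ j - 1 := fun e => h (eq_of_pred_eq hi hj e).symm
      simp [h, Ne.symm this]

namespace IsHeisenberg

variable {V : Type*} [AddCommGroup V] [Module K V] {κ : ℕ → K} {aN aP : ℕ → Module.End K V}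

theorem commute_smul_neg (h : IsHeisenberg κ aN aP) (b : ℕ → K) (i j : ℕ) (hi : 0 < i)
    (hj : 0 < j) : Commute (b i • aN i) (b j • aN j) :=
  ((h.neg_comm i j hi hj).smul_left _).smul_right _

theorem commute_smul_pos (h : IsHeisenberg κ aN aP) (b : ℕ → K) (i j : ℕ) (hi : 0 < i)
    (hj : 0 < j) : Commute (b i • aP i) (b j • aP j) :=
  ((h.pos_comm i j hi hj).smul_left _).smul_right _

variable [CharZero K]

theorem pos_mul_expZ_neg (h : IsHeisenberg κ aN aP) (b : ℕ → K) {m : ℕ} (hm : 0 < m) (k : ℤ) :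
    aP m * expZ K (fun n => b n • aN n) k = expZ K (fun n => b n • aN n) k * aP m +
      (κ m * b m) • expZ K (fun n => b n • aN n) (k - m) := by
  refine mul_expZ (h.commute_smul_neg b) hm (fun n hn => ?_) k
  rw [mul_smul_comm, h.pos_mul_neg m n hm hn, smul_add, smul_mul_assoc, smul_smul]
  congr 2
  split_ifs with e
  · rw [e, mul_comm]
  · simp

theorem neg_mul_expZ_neg (h : IsHeisenberg κ aN aP) (b : ℕ → K) {m : ℕ} (hm : 0 < m) (k : ℤ) :
    aN m * expZ K (fun n => b n • aN n) k = expZ K (fun n => b n • aN n) k * aN m := by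
  refine (mul_expZ (σ := 0) (h.commute_smul_neg b) hm (fun n hn => ?_) k).trans (by simp)
  rw [mul_smul_comm, (h.neg_comm m n hm hn).eq, smul_mul_assoc]
  simp

theorem pos_mul_expZ_pos (h : IsHeisenberg κ aN aP) (d : ℕ → K) {m : ℕ} (hm : 0 < m) (k : ℤ) :
    aP m * expZ K (fun n => d n • aP n) k = expZ K (fun n => d n • aP n) k * aP m := by
  refine (mul_expZ (σ := 0) (h.commute_smul_pos d) hm (fun n hn => ?_) k).trans (by simp)
  rw [mul_smul_comm, (h.pos_comm m n hm hn).eq, smul_mul_assoc]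
  simp

theorem expZ_pos_mul_neg (h : IsHeisenberg κ aN aP) (d : ℕ → K) {m : ℕ} (hm : 0 < m) (k : ℤ) :
    expZ K (fun n => d n • aP n) k * aN m = aN m * expZ K (fun n => d n • aP n) k +
      (κ m * d m) • expZ K (fun n => d n • aP n) (k - m) := by
  have := mul_expZ (σ := -(κ m * d m)) (x := aN m) (h.commute_smul_pos d) hm (fun n hn => ?_) k
  · rw [this, neg_smul, neg_add_cancel_right]
  · rw [mul_smul_comm, smul_mul_assoc, h.pos_mul_neg n m hn hm, smul_add, add_assoc, smul_smul,
      ← add_smul]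
    rcases eq_or_ne n m with e | e
    · subst e; simp [mul_comm]
    · simp [e, e.symm]

end IsHeisenberg

end Heisenberg

/-! ### Gradings -/

section Grading

open Finset

variable {K : Type*} [Field K]

theorem expZ_mem_of_filtration [CharZero K] {V : Type*} [AddCommGroup V] [Module K V]
    {c : ℕ → Module.End K V} (hc : ∀ i j, 0 < i → 0 < j → Commute (c i) (c j))
    {W : ℤ → Submodule K V} (hW : ∀ n : ℕ, 0 < n → ∀ j : ℤ, ∀ f ∈ W j, c n f ∈ W (j + n))
    (k j : ℤ) {f : V} (hf : f ∈ W j) : expZ K c k f ∈ W (j + k) := by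
  induction k using int_strong_induction with
  | hneg k hk => simp [expZ_of_neg _ hk]
  | h0 => simpa [expZ_zero] using hf
  | hpos k hk ih =>
    have hk0 : (k : K) ≠ 0 := by exact_mod_cast hk.ne'
    rw [← Submodule.smul_mem_iff _ hk0, ← LinearMap.smul_apply,
      intCast_smul_expZ hc (show k ≤ k.toNat by omega), LinearMap.sum_apply]
    refine Submodule.sum_mem _ fun i _ => ?_
    rw [LinearMap.smul_apply]
    refine Submodule.smul_mem _ _ ?_
    have := hW (i + 1) i.succ_pos _ _ (ih (k - (i + 1 : ℕ)) (by omega))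
    rwa [show j + (k - (i + 1 : ℕ)) + (i + 1 : ℕ) = j + k by ring] at this

theorem weight_zero : weight 0 = 0 := by simp [weight]

theorem weight_add_single (m : ℕ →₀ ℕ) (i : ℕ) :
    weight (m + Finsupp.single i 1) = weight m + (i + 1) := by
  rw [weight, Finsupp.sum_add_index' (by simp) (fun _ _ _ => by ring), weight]
  simp

variable (K) in
/-- The elements of the Fock space of degree at most `-j`. -/
def fockFiltration (j : ℤ) : Submodule K (Fock K) where
  carrier := {f | ∀ m, -j < weight m → MvPolynomial.coeff m f = 0}
  add_mem' hf hg m hm := by rw [MvPolynomial.coeff_add, hf m hm, hg m hm, add_zero]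
  zero_mem' m _ := MvPolynomial.coeff_zero m
  smul_mem' c f hf m hm := by rw [MvPolynomial.coeff_smul, hf m hm, smul_zero]

variable (K) in
/-- The elements of the completed Fock space without components of degree less than `j`. -/
def fockHatFiltration (j : ℤ) : Submodule K (FockHat K) where
  carrier := {f | ∀ m, weight m < j → MvPowerSeries.coeff m f = 0}
  add_mem' hf hg m hm := by rw [map_add, hf m hm, hg m hm, add_zero]
  zero_mem' m _ := map_zero _
  smul_mem' c f hf m hm := by rw [map_smul, hf m hm, smul_zero]

theorem coeff_aPos (q t : K) (n : ℕ) (f : Fock K) (m : ℕ →₀ ℕ) :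
    MvPolynomial.coeff m (aPos q t n f) =
      kappa q t n * ((m (n - 1) + 1 : K)) * MvPolynomial.coeff (m + Finsupp.single (n - 1) 1) f := by
  simp only [aPos, LinearMap.smul_apply, MvPolynomial.coeff_smul, Derivation.coeFn_coe,
    MvPolynomial.coeff_pderiv, smul_eq_mul, kappa]
  ring

theorem coeff_aPosHat (q t : K) (n : ℕ) (f : FockHat K) (m : ℕ →₀ ℕ) :
    MvPowerSeries.coeff m (aPosHat q t n f) =
      kappa q t n * ((m (n - 1) + 1 : K)) * MvPowerSeries.coeff (m + Finsupp.single (n - 1) 1) f := by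
  simp only [aPosHat, LinearMap.smul_apply, map_smul, Derivation.coeFn_coe,
    MvPowerSeries.coeff_pderiv, smul_eq_mul, kappa]
  ring

theorem coeff_aNegHat (n : ℕ) (f : FockHat K) (m : ℕ →₀ ℕ) :
    MvPowerSeries.coeff m (aNegHat K n f) =
      if Finsupp.single (n - 1) 1 ≤ m then
        MvPowerSeries.coeff (m - Finsupp.single (n - 1) 1) f else 0 := by
  simp [aNegHat, MvPowerSeries.X, MvPowerSeries.coeff_monomial_mul]

theorem coeff_aNeg (n : ℕ) (f : Fock K) (m : ℕ →₀ ℕ) :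
    MvPolynomial.coeff m (aNeg K n f) =
      if Finsupp.single (n - 1) 1 ≤ m then
        MvPolynomial.coeff (m - Finsupp.single (n - 1) 1) f else 0 := by
  simp [aNeg, powerSum, MvPolynomial.X, MvPolynomial.coeff_monomial_mul']

theorem aPos_mem_filtration (q t : K) {n : ℕ} (hn : 0 < n) (j : ℤ) {f : Fock K}
    (hf : f ∈ fockFiltration K j) : aPos q t n f ∈ fockFiltration K (j + n) := by
  intro m hm
  rw [coeff_aPos, hf, mul_zero]
  rw [weight_add_single]
  push_cast
  omega

theorem weight_sub_single {m : ℕ →₀ ℕ} {n : ℕ} (hn : 0 < n) (h : Finsupp.single (n - 1) 1 ≤ m) :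
    weight (m - Finsupp.single (n - 1) 1) + n = weight m := by
  have := weight_add_single (m - Finsupp.single (n - 1) 1) (n - 1)
  rw [tsub_add_cancel_of_le h] at this
  omega

theorem aNeg_mem_filtration {n : ℕ} (hn : 0 < n) (j : ℤ) {f : Fock K}
    (hf : f ∈ fockFiltration K j) : aNeg K n f ∈ fockFiltration K (j - n) := by
  intro m hm
  rw [coeff_aNeg]
  split_ifs with h
  · refine hf _ ?_
    have := weight_sub_single hn h
    omega
  · rfl

theorem aNegHat_mem_filtration {n : ℕ} (hn : 0 < n) (j : ℤ) {f : FockHat K}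
    (hf : f ∈ fockHatFiltration K j) : aNegHat K n f ∈ fockHatFiltration K (j + n) := by
  intro m hm
  rw [coeff_aNegHat]
  split_ifs with h
  · refine hf _ ?_
    have := weight_sub_single hn h
    omega
  · rfl

theorem fockFiltration_antitone {i j : ℤ} (h : i ≤ j) : fockFiltration K j ≤ fockFiltration K i :=
  fun _ hf m hm => hf m (by omega)

theorem exists_mem_fockFiltration (f : Fock K) : ∃ D : ℕ, f ∈ fockFiltration K (-(D : ℤ)) := by
  refine ⟨f.support.sup weight, fun m hm => ?_⟩
  by_contra hne
  have := Finset.le_sup (f := weight) (MvPolynomial.mem_support_iff.2 hne)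
  omega

theorem eq_zero_of_mem_fockFiltration {j : ℤ} (hj : 0 < j) {f : Fock K}
    (hf : f ∈ fockFiltration K j) : f = 0 :=
  MvPolynomial.ext _ _ fun m => by rw [hf m (by omega), MvPolynomial.coeff_zero]

theorem monomial_mem_fockFiltration (m : ℕ →₀ ℕ) :
    MvPolynomial.monomial m (1 : K) ∈ fockFiltration K (-(weight m : ℤ)) := by
  intro m' hm'
  classical
  rw [MvPolynomial.coeff_monomial, if_neg]
  rintro rfl
  omega

variable (K) in
/-- The inclusion of the Fock space in its completion. -/
noncomputable def toHat : Fock K →ₗ[K] FockHat K :=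
  (MvPolynomial.coeToMvPowerSeries.algHom (σ := ℕ) (R := K) K).toLinearMap

theorem coeff_toHat (f : Fock K) (m : ℕ →₀ ℕ) :
    MvPowerSeries.coeff m (toHat K f) = MvPolynomial.coeff m f := by
  simp [toHat]

theorem toHat_aPos (q t : K) (n : ℕ) (f : Fock K) :
    toHat K (aPos q t n f) = aPosHat q t n (toHat K f) := by
  ext m
  rw [coeff_toHat, coeff_aPos, coeff_aPosHat, coeff_toHat]

theorem toHat_aNeg (n : ℕ) (f : Fock K) : toHat K (aNeg K n f) = aNegHat K n (toHat K f) := by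
  ext m
  rw [coeff_toHat, coeff_aNeg, coeff_aNegHat, coeff_toHat]

variable [CharZero K]

theorem expZ_aPos_eq_zero (q t : K) (d : ℕ → K) {D : ℕ} {f : Fock K}
    (hf : f ∈ fockFiltration K (-(D : ℤ))) {l : ℤ} (hl : D < l) :
    expZ K (fun n => d n • aPos q t n) l f = 0 := by
  have := expZ_mem_of_filtration ((isHeisenberg_fock q t).commute_smul_pos d)
    (W := fockFiltration K) (fun n hn j f hf => Submodule.smul_mem _ _
      (aPos_mem_filtration q t hn j hf)) l _ hf
  exact eq_zero_of_mem_fockFiltration (by omega) this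

theorem coeff_expZ_aNegHat_eq_zero (b : ℕ → K) (f : FockHat K) {m : ℕ →₀ ℕ} {k : ℤ}
    (hk : weight m < k) :
    MvPowerSeries.coeff m (expZ K (fun n => b n • aNegHat K n) k f) = 0 := by
  have := expZ_mem_of_filtration ((isHeisenberg_fockHat (0 : K) 0).commute_smul_neg b)
    (W := fockHatFiltration K) (fun n hn j f hf => Submodule.smul_mem _ _
      (aNegHat_mem_filtration hn j hf)) k 0 (f := f) (fun m hm => by omega)
  exact this m (by omega)

theorem toHat_expZ_aNeg (b : ℕ → K) (k : ℤ) (f : Fock K) :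
    toHat K (expZ K (fun n => b n • aNeg K n) k f) =
      expZ K (fun n => b n • aNegHat K n) k (toHat K f) := by
  induction k using int_strong_induction with
  | hneg k hk => simp [expZ_of_neg _ hk]
  | h0 => simp [expZ_zero]
  | hpos k hk ih =>
    have hk0 : (k : K) ≠ 0 := by exact_mod_cast hk.ne'
    apply smul_right_injective (FockHat K) hk0
    have hM : k ≤ k.toNat := by omega
    simp only
    rw [← map_smul, ← LinearMap.smul_apply, ← LinearMap.smul_apply,
      intCast_smul_expZ ((isHeisenberg_fock (0 : K) 0).commute_smul_neg b) hM,
      intCast_smul_expZ ((isHeisenberg_fockHat (0 : K) 0).commute_smul_neg b) hM,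
      LinearMap.sum_apply, LinearMap.sum_apply, map_sum]
    refine sum_congr rfl fun j _ => ?_
    simp only [LinearMap.smul_apply, Module.End.mul_apply, map_smul, toHat_aNeg]
    rw [ih _ (by omega)]

end Grading

/-! ### Vertex operators and Heisenberg operators -/

section Modes

open Finset

variable {K : Type*} [Field K]

/-- The coefficient of `z^k` in `exp(∑ b_n a_(-n) z^n)` on the Fock space. -/
noncomputable abbrev expNeg (b : ℕ → K) (k : ℤ) : Module.End K (Fock K) :=
  expZ K (fun n => b n • aNeg K n) k

/-- The coefficient of `z^(-k)` in `exp(∑ d_n a_n z^(-n))` on the Fock space. -/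
noncomputable abbrev expPos (q t : K) (d : ℕ → K) (k : ℤ) : Module.End K (Fock K) :=
  expZ K (fun n => d n • aPos q t n) k

/-- The coefficient of `z^k` in `exp(∑ b_n a_(-n) z^n)` on the completed Fock space. -/
noncomputable abbrev expNegHat (b : ℕ → K) (k : ℤ) : Module.End K (FockHat K) :=
  expZ K (fun n => b n • aNegHat K n) k

/-- The coefficient of `z^(-k)` in `exp(∑ d_n a_n z^(-n))` on the completed Fock space. -/
noncomputable abbrev expPosHat (q t : K) (d : ℕ → K) (k : ℤ) : Module.End K (FockHat K) :=
  expZ K (fun n => d n • aPosHat q t n) k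

theorem eq_of_eq_on_filtration {V : Type*} [AddCommGroup V] [Module K V] {S T : Fock K →ₗ[K] V}
    {D : ℕ} (h : ∀ m, weight m ≤ D → S (MvPolynomial.monomial m 1) = T (MvPolynomial.monomial m 1))
    {f : Fock K} (hf : f ∈ fockFiltration K (-(D : ℤ))) : S f = T f := by
  rw [MvPolynomial.as_sum f, map_sum, map_sum]
  refine sum_congr rfl fun m hm => ?_
  have hw : weight m ≤ D := by
    by_contra hlt
    exact MvPolynomial.mem_support_iff.1 hm (hf m (by omega))
  rw [← mul_one (MvPolynomial.coeff m f), ← smul_eq_mul, ← MvPolynomial.smul_monomial, map_smul,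
    map_smul, h m hw]

theorem coeff_aNegHat_congr {n : ℕ} (m : ℕ →₀ ℕ) {ι : Type*} (s : Finset ι) {g : FockHat K}
    {F : ι → FockHat K} (h : ∀ m', weight m' ≤ weight m →
      MvPowerSeries.coeff m' g = ∑ i ∈ s, MvPowerSeries.coeff m' (F i)) (hn : 0 < n) :
    MvPowerSeries.coeff m (aNegHat K n g) = ∑ i ∈ s, MvPowerSeries.coeff m (aNegHat K n (F i)) := by
  simp only [coeff_aNegHat]
  split_ifs with hm
  · exact h _ (by have := weight_sub_single hn hm; omega)
  · simp

variable [CharZero K]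

theorem mode_apply (q t : K) (E : VertexExponent K) (k : ℤ) {D L : ℕ} {f : Fock K}
    (hf : f ∈ fockFiltration K (-(D : ℤ))) (hL : D < L) :
    mode q t E k f = ∑ l ∈ range L, expNeg E.1 (k + l) (expPos q t E.2 l f) := by
  have key : mode q t E k f =
      (∑ l ∈ range L, expNeg E.1 (k + l) ∘ₗ expPos q t E.2 l : Module.End K (Fock K)) f := by
    refine eq_of_eq_on_filtration (D := D) (fun m hm => ?_) hf
    have hb : MvPolynomial.monomial m (1 : K) = MvPolynomial.basisMonomials ℕ K m := by simp
    rw [mode, hb, Module.Basis.constr_basis, LinearMap.sum_apply, ← hb]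
    refine (sum_congr rfl fun l _ => ?_).trans (sum_subset (range_subset_range.2
      (show weight m + 1 ≤ L by omega)) fun l _ hl => ?_)
    · rw [LinearMap.comp_apply, expPos, expZ_natCast, expNeg, expZ]
      split_ifs <;> rfl
    · rw [mem_range, not_lt] at hl
      rw [LinearMap.comp_apply, expPos, expZ_aPos_eq_zero q t E.2 (monomial_mem_fockFiltration m)
        (by omega), map_zero]
  rw [key, LinearMap.sum_apply]
  rfl

theorem coeff_modeHat (q t : K) (E : VertexExponent K) (k : ℤ) (g : FockHat K) {m : ℕ →₀ ℕ} {J : ℕ}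
    (hJ : weight m < J) :
    MvPowerSeries.coeff m (modeHat q t E k g) =
      ∑ j ∈ range J, MvPowerSeries.coeff m (expNegHat E.1 j (expPosHat q t E.2 (j - k) g)) := by
  have h1 : MvPowerSeries.coeff m (modeHat q t E k g) = modeHatCoeff q t E k m g := rfl
  rw [h1, modeHatCoeff, LinearMap.sum_apply]
  refine (sum_congr rfl fun j _ => ?_).trans (sum_subset (range_subset_range.2
      (show weight m + 1 ≤ J by omega)) fun j _ hj => ?_)
  · rw [expNegHat, expZ_natCast, expPosHat, expZ]
    by_cases h : k ≤ j
    · rw [if_pos h, if_pos (by omega)]; rfl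
    · rw [if_neg h, if_neg (by omega)]; simp
  · rw [mem_range, not_lt] at hj
    exact coeff_expZ_aNegHat_eq_zero _ _ (by omega)

theorem coeff_vertexOperator (q t : K) (E : VertexExponent K) {D L : ℕ} {f : Fock K}
    (hf : f ∈ fockFiltration K (-(D : ℤ))) (hL : D < L) {m : ℕ →₀ ℕ} {J : ℕ} (hJ : weight m < J) :
    MvPowerSeries.coeff m (vertexOperator q t E f) =
      ∑ j ∈ range J, MvPowerSeries.coeff m (toHat K (expNeg E.1 j
        (∑ l ∈ range L, expPos q t E.2 l f))) := by
  have key : (MvPowerSeries.coeff m ∘ₗ vertexOperator q t E) f =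
      (∑ j ∈ range J, MvPowerSeries.coeff m ∘ₗ toHat K ∘ₗ expNeg E.1 j ∘ₗ
        (∑ l ∈ range L, expPos q t E.2 l) : Fock K →ₗ[K] K) f := by
    refine eq_of_eq_on_filtration (D := D) (fun m' hm' => ?_) hf
    have hb : MvPolynomial.monomial m' (1 : K) = MvPolynomial.basisMonomials ℕ K m' := by simp
    have h1 : MvPowerSeries.coeff m (vertexOperator q t E (MvPolynomial.monomial m' 1)) =
        ∑ j ∈ range (weight m + 1), ∑ l ∈ range (weight m' + 1),
          MvPolynomial.coeff m (expCoeff K (fun n => E.1 n • aNeg K n) j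
            (expCoeff K (fun n => E.2 n • aPos q t n) l (MvPolynomial.monomial m' 1))) := by
      rw [hb]
      refine (congrArg (MvPowerSeries.coeff m)
        (Module.Basis.constr_basis (MvPolynomial.basisMonomials ℕ K) K _ m')).trans ?_
      rw [← hb]
      rfl
    rw [LinearMap.comp_apply, h1, LinearMap.sum_apply]
    refine (sum_congr rfl fun j _ => ?_).trans (sum_subset (range_subset_range.2
      (show weight m + 1 ≤ J by omega)) fun j _ hj => ?_)
    · simp only [LinearMap.comp_apply, LinearMap.sum_apply, map_sum, coeff_toHat]
      refine (sum_congr rfl fun l _ => ?_).trans (sum_subset (range_subset_range.2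
        (show weight m' + 1 ≤ L by omega)) fun l _ hl => ?_)
      · rw [expNeg, expPos, expZ_natCast, expZ_natCast]
      · rw [mem_range, not_lt] at hl
        rw [expPos, expZ_aPos_eq_zero q t E.2 (monomial_mem_fockFiltration m')
          (by omega), map_zero, MvPolynomial.coeff_zero]
    · rw [mem_range, not_lt] at hj
      simp only [LinearMap.comp_apply, toHat_expZ_aNeg, expNeg]
      exact coeff_expZ_aNegHat_eq_zero _ _ (by omega)
  rw [LinearMap.comp_apply] at key
  rw [key, LinearMap.sum_apply]
  simp only [LinearMap.comp_apply, LinearMap.sum_apply]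

theorem sum_range_add_of_eq_zero {M : Type*} [AddCommMonoid M] (F : ℕ → M) (n L : ℕ)
    (h : ∀ l < n, F l = 0) : ∑ l ∈ range (n + L), F l = ∑ l ∈ range L, F (n + l) := by
  rw [sum_range_add, sum_eq_zero (fun l hl => h l (mem_range.1 hl)), zero_add]

theorem aPos_mode (q t : K) (E : VertexExponent K) (k : ℤ) {n : ℕ} (hn : 0 < n) (f : Fock K) :
    aPos q t n (mode q t E k f) =
      mode q t E k (aPos q t n f) + (kappa q t n * E.1 n) • mode q t E (k - n) f := by
  obtain ⟨D, hD⟩ := exists_mem_fockFiltration f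
  have hD' := fockFiltration_antitone (by omega) (aPos_mem_filtration q t hn _ hD) (i := -(D : ℤ))
  have hL := Nat.lt_succ_self D
  rw [mode_apply q t E _ hD hL, mode_apply q t E _ hD hL, mode_apply q t E _ hD' hL, map_sum,
    smul_sum, ← sum_add_distrib]
  refine sum_congr rfl fun l _ => ?_
  have h1 := (isHeisenberg_fock q t).pos_mul_expZ_neg E.1 hn (k + l)
  have h2 := (isHeisenberg_fock q t).pos_mul_expZ_pos E.2 hn l
  rw [← Module.End.mul_apply (aPos q t n), h1, LinearMap.add_apply, Module.End.mul_apply,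
    ← Module.End.mul_apply (aPos q t n), h2, LinearMap.smul_apply, Module.End.mul_apply,
    show k + (l : ℤ) - n = k - n + l by ring]

theorem mode_aNeg (q t : K) (E : VertexExponent K) (k : ℤ) {n : ℕ} (hn : 0 < n) (f : Fock K) :
    mode q t E k (aNeg K n f) =
      aNeg K n (mode q t E k f) + (kappa q t n * E.2 n) • mode q t E (k + n) f := by
  obtain ⟨D, hD⟩ := exists_mem_fockFiltration f
  have hD' : aNeg K n f ∈ fockFiltration K (-((n + D : ℕ) : ℤ)) :=
    fockFiltration_antitone (by push_cast; omega) (aNeg_mem_filtration hn _ hD)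
  have hL : n + D < n + (D + 1) := by omega
  rw [mode_apply q t E _ hD' hL, mode_apply q t E _ hD (show D < n + (D + 1) by omega),
    mode_apply q t E _ hD (Nat.lt_succ_self D), map_sum]
  have h3 : ∑ l ∈ range (n + (D + 1)), expNeg E.1 (k + l) (expPos q t E.2 (l - n) f) =
      ∑ l ∈ range (D + 1), expNeg E.1 (k + n + l) (expPos q t E.2 l f) := by
    rw [sum_range_add_of_eq_zero]
    · refine sum_congr rfl fun l _ => ?_
      push_cast
      rw [← add_assoc, add_sub_cancel_left]
    · intro l hl
      rw [expPos, expZ_of_neg _ (by omega)]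
      simp
  rw [← h3, smul_sum, ← sum_add_distrib]
  refine sum_congr rfl fun l _ => ?_
  have h1 := (isHeisenberg_fock q t).neg_mul_expZ_neg E.1 hn (k + l)
  have h2 := (isHeisenberg_fock q t).expZ_pos_mul_neg E.2 hn l
  rw [← Module.End.mul_apply _ (aNeg K n), h2, ← Module.End.mul_apply (aNeg K n), h1,
    LinearMap.add_apply, map_add, Module.End.mul_apply, LinearMap.smul_apply, map_smul,
    Module.End.mul_apply]

theorem aPosHat_modeHat (q t : K) (E : VertexExponent K) (k : ℤ) {n : ℕ} (hn : 0 < n)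
    (g : FockHat K) :
    aPosHat q t n (modeHat q t E k g) =
      modeHat q t E k (aPosHat q t n g) + (kappa q t n * E.1 n) • modeHat q t E (k - n) g := by
  ext m
  set J := weight (m + Finsupp.single (n - 1) 1) + 1
  have hJ : weight m < J := by
    have := weight_add_single m (n - 1)
    omega
  rw [coeff_aPosHat, coeff_modeHat q t E k g (show _ < n + J by omega), map_add, map_smul,
    coeff_modeHat q t E k _ (show _ < n + J by omega), coeff_modeHat q t E _ _ hJ, mul_sum]
  have h3 : ∑ j ∈ range (n + J),
      MvPowerSeries.coeff m (expNegHat E.1 (j - n) (expPosHat q t E.2 (j - k) g)) =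
      ∑ j ∈ range J, MvPowerSeries.coeff m
        (expNegHat E.1 j (expPosHat q t E.2 (j - (k - n)) g)) := by
    rw [sum_range_add_of_eq_zero]
    · refine sum_congr rfl fun l _ => ?_
      push_cast
      rw [add_sub_cancel_left, show (n : ℤ) + l - k = l - (k - n) by ring]
    · intro l hl
      rw [expNegHat, expZ_of_neg _ (by omega)]
      simp
  rw [← h3, smul_sum, ← sum_add_distrib]
  refine sum_congr rfl fun j _ => ?_
  rw [← coeff_aPosHat]
  have h1 := (isHeisenberg_fockHat q t).pos_mul_expZ_neg E.1 hn j
  have h2 := (isHeisenberg_fockHat q t).pos_mul_expZ_pos E.2 hn (j - k)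
  rw [← Module.End.mul_apply (aPosHat q t n), h1, LinearMap.add_apply, Module.End.mul_apply,
    ← Module.End.mul_apply (aPosHat q t n), h2, LinearMap.smul_apply, Module.End.mul_apply,
    map_add, map_smul]

theorem modeHat_aNegHat (q t : K) (E : VertexExponent K) (k : ℤ) {n : ℕ} (hn : 0 < n)
    (g : FockHat K) :
    modeHat q t E k (aNegHat K n g) =
      aNegHat K n (modeHat q t E k g) + (kappa q t n * E.2 n) • modeHat q t E (k + n) g := by
  ext m
  set J := weight m + 1
  have hJ : weight m < J := Nat.lt_succ_self _
  rw [map_add, map_smul, coeff_modeHat q t E k _ hJ, coeff_modeHat q t E _ _ hJ,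
    coeff_aNegHat_congr m (range J) (fun m' hm' => coeff_modeHat q t E k g
      (lt_of_le_of_lt hm' hJ)) hn, smul_sum, ← sum_add_distrib]
  refine sum_congr rfl fun j _ => ?_
  have h1 := (isHeisenberg_fockHat q t).neg_mul_expZ_neg E.1 hn j
  have h2 := (isHeisenberg_fockHat q t).expZ_pos_mul_neg E.2 hn (j - k)
  rw [← Module.End.mul_apply _ (aNegHat K n), h2, ← Module.End.mul_apply (aNegHat K n), h1,
    LinearMap.add_apply, map_add, Module.End.mul_apply, LinearMap.smul_apply, map_smul,
    Module.End.mul_apply, map_add, map_smul, show (j : ℤ) - k - n = j - (k + n) by ring]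

theorem aPosHat_vertexOperator (q t : K) (E : VertexExponent K) {n : ℕ} (hn : 0 < n)
    (f : Fock K) :
    aPosHat q t n (vertexOperator q t E f) =
      vertexOperator q t E (aPos q t n f) + (kappa q t n * E.1 n) • vertexOperator q t E f := by
  ext m
  obtain ⟨D, hD⟩ := exists_mem_fockFiltration f
  have hD' := fockFiltration_antitone (by omega) (aPos_mem_filtration q t hn _ hD) (i := -(D : ℤ))
  have hL := Nat.lt_succ_self D
  set J := weight (m + Finsupp.single (n - 1) 1) + 1
  have hJ : weight m < J := by
    have := weight_add_single m (n - 1)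
    omega
  rw [coeff_aPosHat, coeff_vertexOperator q t E hD hL (show _ < n + J by omega), map_add, map_smul,
    coeff_vertexOperator q t E hD' hL (show _ < n + J by omega),
    coeff_vertexOperator q t E hD hL hJ, mul_sum]
  set g := ∑ l ∈ range (D + 1), expPos q t E.2 l f with hg
  have hg' : ∑ l ∈ range (D + 1), expPos q t E.2 l (aPos q t n f) = aPos q t n g := by
    rw [hg, map_sum]
    refine sum_congr rfl fun l _ => ?_
    have h2 := (isHeisenberg_fock q t).pos_mul_expZ_pos E.2 hn l
    rw [← Module.End.mul_apply, ← Module.End.mul_apply, h2]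
  have h3 : ∑ j ∈ range (n + J), MvPowerSeries.coeff m (toHat K (expNeg E.1 (j - n) g)) =
      ∑ j ∈ range J, MvPowerSeries.coeff m (toHat K (expNeg E.1 j g)) := by
    rw [sum_range_add_of_eq_zero]
    · refine sum_congr rfl fun l _ => ?_
      push_cast
      rw [add_sub_cancel_left]
    · intro l hl
      rw [expNeg, expZ_of_neg _ (by omega)]
      simp
  rw [hg', ← h3, smul_sum, ← sum_add_distrib]
  refine sum_congr rfl fun j _ => ?_
  rw [← coeff_aPosHat, ← toHat_aPos]
  have h1 := (isHeisenberg_fock q t).pos_mul_expZ_neg E.1 hn j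
  rw [← Module.End.mul_apply (aPos q t n), h1, LinearMap.add_apply, Module.End.mul_apply,
    LinearMap.smul_apply, map_add, map_smul, map_add, map_smul]

theorem vertexOperator_aNeg (q t : K) (E : VertexExponent K) {n : ℕ} (hn : 0 < n)
    (f : Fock K) :
    vertexOperator q t E (aNeg K n f) =
      aNegHat K n (vertexOperator q t E f) + (kappa q t n * E.2 n) • vertexOperator q t E f := by
  ext m
  obtain ⟨D, hD⟩ := exists_mem_fockFiltration f
  have hD' : aNeg K n f ∈ fockFiltration K (-((n + D : ℕ) : ℤ)) :=
    fockFiltration_antitone (by push_cast; omega) (aNeg_mem_filtration hn _ hD)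
  have hL : n + D < n + (D + 1) := by omega
  set J := weight m + 1
  have hJ : weight m < J := Nat.lt_succ_self _
  rw [coeff_vertexOperator q t E hD' hL hJ, map_add, map_smul,
    coeff_vertexOperator q t E hD (Nat.lt_succ_self D) hJ,
    coeff_aNegHat_congr m (range J) (fun m' hm' => coeff_vertexOperator q t E hD
      (show D < n + (D + 1) by omega) (lt_of_le_of_lt hm' hJ)) hn, smul_sum, ← sum_add_distrib]
  have h3 : ∑ l ∈ range (n + (D + 1)), expPos q t E.2 (l - n) f =
      ∑ l ∈ range (D + 1), expPos q t E.2 l f := by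
    rw [sum_range_add_of_eq_zero]
    · refine sum_congr rfl fun l _ => ?_
      push_cast
      rw [add_sub_cancel_left]
    · intro l hl
      rw [expPos, expZ_of_neg _ (by omega)]
      simp
  have h4 : ∑ l ∈ range (n + (D + 1)), expPos q t E.2 l (aNeg K n f) =
      aNeg K n (∑ l ∈ range (n + (D + 1)), expPos q t E.2 l f) +
        (kappa q t n * E.2 n) • ∑ l ∈ range (D + 1), expPos q t E.2 l f := by
    rw [← h3, map_sum, smul_sum, ← sum_add_distrib]
    refine sum_congr rfl fun l _ => ?_
    have h2 := (isHeisenberg_fock q t).expZ_pos_mul_neg E.2 hn l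
    rw [← Module.End.mul_apply _ (aNeg K n), h2, LinearMap.add_apply, Module.End.mul_apply,
      LinearMap.smul_apply]
  refine sum_congr rfl fun j _ => ?_
  have h1 := (isHeisenberg_fock q t).neg_mul_expZ_neg E.1 hn j
  rw [h4, ← toHat_aNeg, ← Module.End.mul_apply (aNeg K n), h1, map_add, map_add, map_add, map_smul,
    map_smul, map_smul, Module.End.mul_apply]

theorem constantCoeff_vertexOperator_one (q t : K) (E : VertexExponent K) :
    MvPowerSeries.constantCoeff (vertexOperator q t E 1) = 1 := by
  have h1 : (1 : Fock K) ∈ fockFiltration K (-((0 : ℕ) : ℤ)) := by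
    have := monomial_mem_fockFiltration (K := K) 0
    rw [weight_zero] at this
    exact this
  rw [← MvPowerSeries.coeff_zero_eq_constantCoeff_apply,
    coeff_vertexOperator q t E h1 Nat.zero_lt_one (J := 1) (by rw [weight_zero]; exact one_pos)]
  simp [expZ_zero, coeff_toHat]

theorem constantCoeff_modeHat (q t : K) (E : VertexExponent K) (k : ℤ) {β : ℕ → K} {g : FockHat K}
    (hg : ∀ n, 0 < n → aPosHat q t n g = β n • g) :
    MvPowerSeries.constantCoeff (modeHat q t E k g) =
      expZ K (fun n => E.2 n * β n) (-k) * MvPowerSeries.constantCoeff g := by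
  rw [← MvPowerSeries.coeff_zero_eq_constantCoeff_apply,
    coeff_modeHat q t E k g (J := 1) (by rw [weight_zero]; exact one_pos), sum_range_one,
    Nat.cast_zero, expNegHat, expZ_zero, Module.End.one_apply, zero_sub, expPosHat,
    expZ_apply_of_eigenvector ((isHeisenberg_fockHat q t).commute_smul_pos E.2)
      (σ := fun n => E.2 n * β n), map_smul, smul_eq_mul,
    MvPowerSeries.coeff_zero_eq_constantCoeff_apply]
  intro n hn
  rw [LinearMap.smul_apply, hg n hn, smul_smul]

theorem mode_one (q t : K) (E : VertexExponent K) (k : ℤ) :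
    mode q t E k 1 = expNeg E.1 k 1 := by
  have h1 : (1 : Fock K) ∈ fockFiltration K (-((0 : ℕ) : ℤ)) := by
    have := monomial_mem_fockFiltration (K := K) 0
    rw [weight_zero] at this
    exact this
  rw [mode_apply q t E k h1 Nat.zero_lt_one, sum_range_one]
  simp [expZ_zero]

theorem functional_mode_one (q t : K) (E : VertexExponent K) (k : ℤ) {β : ℕ → K}
    {φ : Fock K →ₗ[K] K} (hφ : ∀ n, 0 < n → ∀ f, φ (aNeg K n f) = β n * φ f) :
    φ (mode q t E k 1) = expZ K (fun n => E.1 n * β n) k * φ 1 := by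
  rw [mode_one, expNeg, apply_expZ_of_functional ((isHeisenberg_fock q t).commute_smul_neg E.1)
    (σ := fun n => E.1 n * β n)]
  intro n hn f
  rw [LinearMap.smul_apply, map_smul, hφ n hn, smul_eq_mul, mul_assoc]

theorem mode_eq_zero (q t : K) (E : VertexExponent K) {k : ℤ} {D : ℕ} {f : Fock K}
    (hf : f ∈ fockFiltration K (-(D : ℤ))) (hk : k + D < 0) : mode q t E k f = 0 := by
  rw [mode_apply q t E k hf (Nat.lt_succ_self D)]
  refine sum_eq_zero fun l hl => ?_
  have := mem_range.1 hl
  rw [expNeg, expZ_of_neg _ (by omega), LinearMap.zero_apply]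

end Modes

/-! ### Families of operators with prescribed Heisenberg commutators -/

section Families

open Finset

variable {K : Type*} [Field K]

/-- The family `T n` of coefficients of `z^(-n)` in a current `T(z)` satisfies
`[a_m, T(z)] = (β_m + γ_m z^m) T(z)` and `[T(z), a_(-m)] = (β'_m + γ'_m z^(-m)) T(z)`. -/
structure HeisFamily (q t : K) (β β' γ γ' : ℕ → K) (T : ℤ → Fock K →ₗ[K] FockHat K) : Prop where
  pos : ∀ m, 0 < m → ∀ n f, aPosHat q t m (T n f) =
    T n (aPos q t m f) + β m • T n f + γ m • T (n + m) f
  neg : ∀ m, 0 < m → ∀ n f, T n (aNeg K m f) =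
    aNegHat K m (T n f) + β' m • T n f + γ' m • T (n - m) f

/-- The operator `T` satisfies `[a_m, T] = β_m T` and `[T, a_(-m)] = β'_m T`. -/
def IsHeis (q t : K) (β β' : ℕ → K) (T : Fock K →ₗ[K] FockHat K) : Prop :=
  HeisFamily q t β β' 0 0 fun _ => T

variable {q t : K} {β β' γ γ' : ℕ → K}

theorem IsHeis.pos {T : Fock K →ₗ[K] FockHat K} (h : IsHeis q t β β' T) {m : ℕ} (hm : 0 < m)
    (f : Fock K) : aPosHat q t m (T f) = T (aPos q t m f) + β m • T f := by
  simpa using HeisFamily.pos h m hm 0 f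

theorem IsHeis.neg {T : Fock K →ₗ[K] FockHat K} (h : IsHeis q t β β' T) {m : ℕ} (hm : 0 < m)
    (f : Fock K) : T (aNeg K m f) = aNegHat K m (T f) + β' m • T f := by
  simpa using HeisFamily.neg h m hm 0 f

theorem IsHeis.mk {T : Fock K →ₗ[K] FockHat K}
    (h1 : ∀ m, 0 < m → ∀ f, aPosHat q t m (T f) = T (aPos q t m f) + β m • T f)
    (h2 : ∀ m, 0 < m → ∀ f, T (aNeg K m f) = aNegHat K m (T f) + β' m • T f) :
    IsHeis q t β β' T :=
  ⟨fun m hm _ f => by simpa using h1 m hm f, fun m hm _ f => by simpa using h2 m hm f⟩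

theorem aPos_one (q t : K) (n : ℕ) : aPos q t n 1 = 0 := by
  simp [aPos]

theorem HeisFamily.eq_zero [CharZero K] (hκ : ∀ m, 0 < m → kappa q t m ≠ 0)
    {T : ℤ → Fock K →ₗ[K] FockHat K} (h : HeisFamily q t β β' γ γ' T)
    (h0 : ∀ n, MvPowerSeries.constantCoeff (T n 1) = 0) (n : ℤ) : T n = 0 := by
  have h1 : ∀ d : ℕ, ∀ m, weight m = d → ∀ n, MvPowerSeries.coeff m (T n 1) = 0 := by
    intro d
    induction d using Nat.strong_induction_on with
    | _ d ih =>
      intro m hm n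
      by_cases hm0 : m = 0
      · rw [hm0, MvPowerSeries.coeff_zero_eq_constantCoeff_apply, h0]
      · obtain ⟨i, hi⟩ := Finsupp.ne_iff.1 hm0
        have hle : Finsupp.single i 1 ≤ m := by
          rw [Finsupp.single_le_iff]; exact Nat.one_le_iff_ne_zero.2 hi
        obtain ⟨m', rfl⟩ := exists_add_of_le hle
        rw [add_comm, weight_add_single] at hm
        have h2 := congrArg (MvPowerSeries.coeff m') (h.pos (i + 1) i.succ_pos n 1)
        rw [coeff_aPosHat, aPos_one, map_zero, zero_add, map_add, map_smul, map_smul,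
          ih (weight m') (by omega) m' rfl, ih (weight m') (by omega) m' rfl, smul_zero, smul_zero,
          add_zero, Nat.add_sub_cancel] at h2
        have h3 : (m' i + 1 : K) ≠ 0 := by exact_mod_cast (m' i).succ_ne_zero
        rw [add_comm]
        exact (mul_eq_zero.1 h2).resolve_left (mul_ne_zero (hκ _ i.succ_pos) h3)
  have h2 : ∀ n, T n 1 = 0 := fun n => MvPowerSeries.ext fun m => by
    rw [h1 _ m rfl, map_zero]
  have h3 : ∀ f : Fock K, ∀ n, T n f = 0 := by
    intro f
    induction f using MvPolynomial.induction_on with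
    | C a => intro n; rw [← mul_one (MvPolynomial.C a), ← MvPolynomial.smul_eq_C_mul, map_smul, h2,
        smul_zero]
    | add f g hf hg => intro n; rw [map_add, hf, hg, add_zero]
    | mul_X f i hf =>
      intro n
      have : f * MvPolynomial.X i = aNeg K (i + 1) f := by
        simp [aNeg, powerSum, mul_comm]
      rw [this, h.neg _ i.succ_pos, hf, hf]
      simp
  exact LinearMap.ext fun f => h3 f n

theorem HeisFamily.smul {T : ℤ → Fock K →ₗ[K] FockHat K} (h : HeisFamily q t β β' γ γ' T) (c : K) :
    HeisFamily q t β β' γ γ' fun n => c • T n := by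
  refine ⟨fun m hm n f => ?_, fun m hm n f => ?_⟩
  · simp only [LinearMap.smul_apply, map_smul, h.pos m hm n f, smul_add]
    rw [smul_comm c (β m), smul_comm c (γ m)]
  · simp only [LinearMap.smul_apply, map_smul, h.neg m hm n f, smul_add]
    rw [smul_comm c (β' m), smul_comm c (γ' m)]

theorem HeisFamily.sub {S T : ℤ → Fock K →ₗ[K] FockHat K} (hS : HeisFamily q t β β' γ γ' S)
    (hT : HeisFamily q t β β' γ γ' T) : HeisFamily q t β β' γ γ' fun n => S n - T n := by
  refine ⟨fun m hm n f => ?_, fun m hm n f => ?_⟩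
  · simp only [LinearMap.sub_apply, map_sub, hT.pos m hm n f, hS.pos m hm n f, smul_sub]
    abel
  · simp only [LinearMap.sub_apply, map_sub, hT.neg m hm n f, hS.neg m hm n f, smul_sub]
    abel

theorem HeisFamily.sum {ι : Type*} (s : Finset ι) {T : ι → ℤ → Fock K →ₗ[K] FockHat K}
    (h : ∀ i ∈ s, HeisFamily q t β β' γ γ' (T i)) :
    HeisFamily q t β β' γ γ' fun n => ∑ i ∈ s, T i n := by
  refine ⟨fun m hm n f => ?_, fun m hm n f => ?_⟩
  · simp only [LinearMap.sum_apply, map_sum, smul_sum, ← sum_add_distrib]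
    exact sum_congr rfl fun i hi => (h i hi).pos m hm n f
  · simp only [LinearMap.sum_apply, map_sum, smul_sum, ← sum_add_distrib]
    exact sum_congr rfl fun i hi => (h i hi).neg m hm n f

theorem IsHeis.eq_smul_vertexOperator [CharZero K] (hκ : ∀ m, 0 < m → kappa q t m ≠ 0)
    {E : VertexExponent K} {T : Fock K →ₗ[K] FockHat K}
    (hT : IsHeis q t (fun n => kappa q t n * E.1 n) (fun n => kappa q t n * E.2 n) T) :
    T = MvPowerSeries.constantCoeff (T 1) • vertexOperator q t E := by
  have hV : IsHeis q t (fun n => kappa q t n * E.1 n) (fun n => kappa q t n * E.2 n)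
      (vertexOperator q t E) :=
    IsHeis.mk (fun m hm f => aPosHat_vertexOperator q t E hm f)
      (fun m hm f => vertexOperator_aNeg q t E hm f)
  have := HeisFamily.eq_zero hκ (HeisFamily.sub hT
    (HeisFamily.smul hV (MvPowerSeries.constantCoeff (T 1)))) (fun n => ?_) 0
  · exact sub_eq_zero.1 this
  · have h1 : MvPowerSeries.constantCoeff (MvPowerSeries.constantCoeff (T 1) •
        vertexOperator q t E 1) = MvPowerSeries.constantCoeff (T 1) *
          MvPowerSeries.constantCoeff (vertexOperator q t E 1) := by
      rw [← MvPowerSeries.coeff_zero_eq_constantCoeff_apply, map_smul]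
      simp
    rw [LinearMap.sub_apply, LinearMap.smul_apply, map_sub, h1, constantCoeff_vertexOperator_one,
      mul_one, sub_self]

end Families

/-! ### Expansions of rational functions -/

section PartialFractions

open PowerSeries Finset

variable {K : Type*} [Field K]

/-- The coefficients of a power series, extended by zero to negative indices. -/
noncomputable def coeffZ (F : PowerSeries K) (k : ℤ) : K :=
  if 0 ≤ k then PowerSeries.coeff k.toNat F else 0

theorem coeffZ_natCast (F : PowerSeries K) (k : ℕ) : coeffZ F k = PowerSeries.coeff k F := by
  simp [coeffZ]

theorem coeffZ_of_neg (F : PowerSeries K) {k : ℤ} (h : k < 0) : coeffZ F k = 0 := by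
  rw [coeffZ, if_neg (by omega)]

theorem coeffZ_oneSub_mul (b : K) (F : PowerSeries K) (k : ℤ) :
    coeffZ (oneSub b * F) k = coeffZ F k - b * coeffZ F (k - 1) := by
  rcases lt_trichotomy k 0 with h | h | h
  · simp [coeffZ_of_neg _ h, coeffZ_of_neg _ (show k - 1 < 0 by omega)]
  · subst h
    simp [coeffZ, oneSub, sub_mul, mul_assoc]
  · obtain ⟨n, rfl⟩ : ∃ n : ℕ, k = (n + 1 : ℕ) := ⟨(k - 1).toNat, by omega⟩
    rw [show ((n + 1 : ℕ) : ℤ) - 1 = n by push_cast; ring, coeffZ_natCast, coeffZ_natCast,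
      coeffZ_natCast, oneSub, sub_mul, one_mul, map_sub, mul_assoc, coeff_C_mul, coeff_succ_X_mul]

/-- The power series `∏ (1 - b_j z) / ∏ (1 - a_i z)`. -/
noncomputable def ratioSeries (J I : Finset ℕ) (b a : ℕ → K) : PowerSeries K :=
  (∏ j ∈ J, oneSub (b j)) * (∏ i ∈ I, oneSub (a i))⁻¹

theorem constantCoeff_oneSub (a : K) : constantCoeff (oneSub a) = 1 := by
  simp [oneSub]

theorem constantCoeff_prod_oneSub (I : Finset ℕ) (a : ℕ → K) :
    constantCoeff (∏ i ∈ I, oneSub (a i)) = 1 := by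
  rw [map_prod]
  exact prod_eq_one fun i _ => constantCoeff_oneSub _

theorem isExp_ratioSeries [CharZero K] (J I : Finset ℕ) (b a : ℕ → K) :
    IsExp (fun n => (∑ i ∈ I, a i ^ n - ∑ j ∈ J, b j ^ n) / n) (ratioSeries J I b a) := by
  refine ((IsExp.prod J fun j _ => isExp_oneSub (b j)).mul
    (IsExp.prod I fun i _ => isExp_oneSub (a i)).inv).congr fun n _ => ?_
  rw [sum_neg_distrib, sum_neg_distrib, neg_neg, ← sum_div, ← sum_div]
  ring

theorem coeff_inv_oneSub (a : K) (n : ℕ) : PowerSeries.coeff n (oneSub a)⁻¹ = a ^ n := by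
  have h : (oneSub a)⁻¹ = PowerSeries.mk fun n => a ^ n := by
    rw [PowerSeries.inv_eq_iff_mul_eq_one (by rw [constantCoeff_oneSub]; exact one_ne_zero)]
    ext n
    rcases n with _ | n
    · simp [oneSub, mul_sub, ← mul_assoc]
    · simp [oneSub, mul_sub, ← mul_assoc, coeff_succ_mul_X, coeff_one, pow_succ]
  rw [h, coeff_mk]

/-- The residue coefficients of `1 / ∏ (1 - a_i z)`. -/
noncomputable def residue (I : Finset ℕ) (a : ℕ → K) (i : ℕ) : K :=
  (∏ j ∈ I.erase i, (1 - a j / a i))⁻¹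

theorem coe_basis {I : Finset ℕ} {a : ℕ → K} (ha : ∀ i ∈ I, a i ≠ 0) {i : ℕ} (hi : i ∈ I) :
    ((Lagrange.basis I (fun j => (a j)⁻¹) i : Polynomial K) : PowerSeries K) =
      residue I a i • ∏ j ∈ I.erase i, oneSub (a j) := by
  rw [Lagrange.basis, ← Polynomial.coeToPowerSeries.ringHom_apply, map_prod, residue,
    ← prod_inv_distrib, ← prod_smul]
  refine prod_congr rfl fun j hj => ?_
  have hj0 := ha j (mem_of_mem_erase hj)
  have hi0 := ha i hi
  rw [Lagrange.basisDivisor, map_mul, map_sub]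
  simp only [Polynomial.coeToPowerSeries.ringHom_apply, Polynomial.coe_C, Polynomial.coe_X, oneSub]
  have h1 : (1 - a j / a i)⁻¹ = -((a i)⁻¹ - (a j)⁻¹)⁻¹ * (a j)⁻¹ := by
    rw [← inv_neg, ← mul_inv]
    congr 1
    field_simp
    ring
  rw [h1, smul_eq_C_mul, map_mul, map_neg]
  have h2 : (PowerSeries.C (a j)⁻¹ * PowerSeries.C (a j) : PowerSeries K) = 1 := by
    rw [← map_mul, inv_mul_cancel₀ hj0, map_one]
  linear_combination (-PowerSeries.C ((a i)⁻¹ - (a j)⁻¹)⁻¹ * PowerSeries.X) * h2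

theorem injOn_inv {I : Finset ℕ} {a : ℕ → K} (hinj : Set.InjOn a I) :
    Set.InjOn (fun j => (a j)⁻¹) (I : Set ℕ) :=
  fun _ hi _ hj h => hinj hi hj (inv_injective h)

theorem coeff_inv_prod_oneSub {I : Finset ℕ} (hI : I.Nonempty) {a : ℕ → K}
    (ha : ∀ i ∈ I, a i ≠ 0) (hinj : Set.InjOn a I) (n : ℕ) :
    PowerSeries.coeff n (∏ i ∈ I, oneSub (a i))⁻¹ = ∑ i ∈ I, residue I a i * a i ^ n := by
  have h : (∏ i ∈ I, oneSub (a i))⁻¹ = ∑ i ∈ I, residue I a i • (oneSub (a i))⁻¹ := by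
    rw [PowerSeries.inv_eq_iff_mul_eq_one
      (by rw [constantCoeff_prod_oneSub]; exact one_ne_zero), sum_mul]
    have h1 := congrArg (Polynomial.coeToPowerSeries.ringHom)
      (Lagrange.sum_basis (injOn_inv hinj) hI)
    rw [map_sum, map_one] at h1
    rw [← h1]
    refine sum_congr rfl fun i hi => ?_
    rw [Polynomial.coeToPowerSeries.ringHom_apply, coe_basis ha hi, ← mul_prod_erase I _ hi,
      smul_mul_assoc, ← mul_assoc, PowerSeries.inv_mul_cancel _
        (by rw [constantCoeff_oneSub]; exact one_ne_zero), one_mul]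
  rw [h, map_sum]
  refine sum_congr rfl fun i _ => ?_
  rw [map_smul, coeff_inv_oneSub, smul_eq_mul]

theorem sum_residue_mul_inv_pow {I : Finset ℕ} {a : ℕ → K} (ha : ∀ i ∈ I, a i ≠ 0)
    (hinj : Set.InjOn a I) {k : ℕ} (hk : 0 < k) (hkI : k < I.card) :
    ∑ i ∈ I, residue I a i * ((a i)⁻¹) ^ k = 0 := by
  have h := Lagrange.eq_interpolate (f := (Polynomial.X ^ k : Polynomial K)) (injOn_inv hinj)
    (by rw [Polynomial.degree_X_pow]; exact_mod_cast hkI)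
  rw [Lagrange.interpolate_apply] at h
  have h1 := congrArg (fun p => PowerSeries.coeff 0 (Polynomial.coeToPowerSeries.ringHom p)) h
  simp only [map_sum, map_mul, Polynomial.coeToPowerSeries.ringHom_apply, Polynomial.coe_C,
    Polynomial.eval_pow, Polynomial.eval_X, coeff_C_mul, Polynomial.coeff_coe,
    Polynomial.coeff_X_pow, hk.ne, if_false] at h1
  rw [h1]
  refine sum_congr rfl fun i hi => ?_
  rw [← Polynomial.coeff_coe, coe_basis ha hi, map_smul, coeff_zero_eq_constantCoeff_apply,
    constantCoeff_prod_oneSub, smul_eq_mul, mul_one, mul_comm]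

theorem residue_inv {I : Finset ℕ} {a : ℕ → K} (ha : ∀ i ∈ I, a i ≠ 0) {i : ℕ} (hi : i ∈ I) :
    (∏ j ∈ I, -a j)⁻¹ * residue I (fun j => (a j)⁻¹) i * a i ^ I.card = -residue I a i := by
  have h : ∀ j ∈ I.erase i, 1 - (a j)⁻¹ / (a i)⁻¹ = (-a j)⁻¹ * a i * (1 - a j / a i) := by
    intro j hj
    have hj0 := ha j (mem_of_mem_erase hj)
    have hi0 := ha i hi
    field_simp
    ring
  rw [residue, prod_congr rfl h, prod_mul_distrib, prod_mul_distrib, prod_const, prod_inv_distrib,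
    ← mul_prod_erase I _ hi, residue, card_erase_of_mem hi]
  have hi0 := ha i hi
  have hp : ∏ j ∈ I.erase i, -a j ≠ 0 :=
    prod_ne_zero_iff.2 fun j hj => neg_ne_zero.2 (ha j (mem_of_mem_erase hj))
  have hc : a i ^ I.card = a i ^ (I.card - 1) * a i := by
    rw [← pow_succ, Nat.sub_add_cancel (card_pos.2 ⟨i, hi⟩)]
  rw [hc, mul_inv, mul_inv, mul_inv, inv_inv]
  field_simp

/-- The expansions of `∏_J (1 - b_j z) / ∏_I (1 - a_i z)` at `0` and at `∞` differ by a sum of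
delta functions. -/
theorem coeffZ_ratioSeries_sub {I : Finset ℕ} {a : ℕ → K} (ha : ∀ i ∈ I, a i ≠ 0)
    (hinj : Set.InjOn a I) (J : Finset ℕ) {b : ℕ → K} (hb : ∀ j ∈ J, b j ≠ 0) (n : ℤ) :
    coeffZ (ratioSeries J I b a) n - (∏ j ∈ J, -b j) * (∏ i ∈ I, -a i)⁻¹ *
        coeffZ (ratioSeries J I (fun j => (b j)⁻¹) (fun i => (a i)⁻¹)) (J.card - I.card - n) =
      ∑ i ∈ I, (∏ j ∈ J, (1 - b j / a i)) * residue I a i * a i ^ n := by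
  induction J using Finset.induction_on generalizing n with
  | empty =>
    simp only [ratioSeries, prod_empty, one_mul, card_empty]
    rcases I.eq_empty_or_nonempty with rfl | hI
    · simp only [prod_empty, card_empty, inv_one, sum_empty, coeffZ]
      rcases lt_trichotomy n 0 with h | h | h
      · have : (-n).toNat ≠ 0 := by omega
        simp [h.not_ge, coeff_one, this]
      · simp [h]
      · have : n.toNat ≠ 0 := by omega
        simp [h.not_ge, coeff_one, this]
    rcases le_or_gt 0 n with h | h
    · lift n to ℕ using h
      have := card_pos.2 hI
      rw [coeffZ_natCast, coeffZ_of_neg _ (by push_cast; omega), coeff_inv_prod_oneSub hI ha hinj]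
      simp
    · rw [coeffZ_of_neg _ h, zero_sub]
      rcases le_or_gt 0 ((0 : ℕ) - I.card - n : ℤ) with h1 | h1
      · obtain ⟨m, hm⟩ := Int.eq_ofNat_of_zero_le h1
        rw [hm, coeffZ_natCast, coeff_inv_prod_oneSub hI (fun i hi => inv_ne_zero (ha i hi))
          (injOn_inv hinj), mul_sum, ← sum_neg_distrib]
        refine sum_congr rfl fun i hi => ?_
        have h2 : n = -((m : ℤ) + I.card) := by push_cast at hm; omega
        have hi0 := ha i hi
        rw [← neg_eq_iff_eq_neg.2 (residue_inv ha hi), h2, zpow_neg, zpow_add₀ hi0, zpow_natCast,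
          zpow_natCast, inv_pow]
        field_simp
      · rw [coeffZ_of_neg _ h1, mul_zero, neg_zero]
        obtain ⟨m, hm⟩ := Int.eq_ofNat_of_zero_le (show 0 ≤ -n by omega)
        rw [← sum_residue_mul_inv_pow ha hinj (k := m) (by omega) (by push_cast at h1; omega)]
        refine sum_congr rfl fun i _ => ?_
        rw [show n = -(m : ℤ) by omega, zpow_neg, zpow_natCast, inv_pow]
  | insert c J hc ih =>
    have hbJ : ∀ j ∈ J, b j ≠ 0 := fun j hj => hb j (mem_insert_of_mem hj)
    have hbc : b c ≠ 0 := hb c (mem_insert_self c J)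
    have h1 : ∀ b' a' : ℕ → K, ratioSeries (insert c J) I b' a' =
        oneSub (b' c) * ratioSeries J I b' a' := by
      intro b' a'
      rw [ratioSeries, ratioSeries, prod_insert hc, mul_assoc]
    have e1 := ih hbJ n
    have e2 := ih hbJ (n - 1)
    rw [h1, h1, coeffZ_oneSub_mul, coeffZ_oneSub_mul, prod_insert hc, card_insert_of_notMem hc]
    have h2 : ∑ i ∈ I, (∏ j ∈ insert c J, (1 - b j / a i)) * residue I a i * a i ^ n =
        ∑ i ∈ I, (∏ j ∈ J, (1 - b j / a i)) * residue I a i * a i ^ n -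
          b c * ∑ i ∈ I, (∏ j ∈ J, (1 - b j / a i)) * residue I a i * a i ^ (n - 1) := by
      rw [mul_sum, ← sum_sub_distrib]
      refine sum_congr rfl fun i hi => ?_
      rw [prod_insert hc, zpow_sub_one₀ (ha i hi)]
      ring
    rw [h2, ← e1, ← e2]
    push_cast
    rw [show (J.card : ℤ) + 1 - I.card - n = J.card - I.card - (n - 1) by ring,
      show (J.card : ℤ) - I.card - (n - 1) - 1 = J.card - I.card - n by ring]
    field_simp
    ring

end PartialFractions

/-! ### Exponential sequences -/

section ExpSequences

open Finset

variable {K : Type*} [Field K]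

theorem expZ_congr {c d : ℕ → K} (h : ∀ n, 0 < n → c n = d n) (k : ℤ) : expZ K c k = expZ K d k := by
  have : (fun n => if n = 0 then 0 else c n) = fun n => if n = 0 then 0 else d n := by
    funext n
    split_ifs with hn
    · rfl
    · exact h n (Nat.pos_of_ne_zero hn)
  rw [expZ, expZ, expCoeff, expCoeff, this]

variable [CharZero K]

theorem IsExp.expZ_eq {c : ℕ → K} {F : PowerSeries K} (hF : IsExp c F) (k : ℤ) :
    expZ K c k = coeffZ F k := by
  rw [expZ, coeffZ]
  split_ifs
  · rw [hF.coeff_eq]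
  · rfl

theorem expZ_mul_pow (c : ℕ → K) {a : K} (ha : a ≠ 0) (k : ℤ) :
    expZ K (fun n => c n * a ^ n) k = a ^ k * expZ K c k := by
  induction k using int_strong_induction with
  | hneg k hk => simp [expZ_of_neg _ hk]
  | h0 => simp [expZ_zero]
  | hpos k hk ih =>
    have hk0 : (k : K) ≠ 0 := by exact_mod_cast hk.ne'
    apply mul_left_cancel₀ hk0
    have hM : k ≤ k.toNat := by omega
    rw [mul_left_comm, ← smul_eq_mul (k : K), ← smul_eq_mul (k : K),
      intCast_smul_expZ (fun _ _ _ _ => Commute.all _ _) hM,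
      intCast_smul_expZ (fun _ _ _ _ => Commute.all _ _) hM, mul_sum]
    refine sum_congr rfl fun j _ => ?_
    rw [ih _ (by omega)]
    have : a ^ k = a ^ (j + 1) * a ^ (k - (j + 1 : ℕ)) := by
      rw [← zpow_natCast, ← zpow_add₀ ha]; congr 1; ring
    rw [this]
    simp only [smul_eq_mul]
    ring

/-- The exponential of a sum is the convolution of the exponentials. -/
theorem expZ_add (c d : ℕ → K) {F : PowerSeries K} (hF : IsExp c F) {k : ℤ} {L : ℕ} (hL : k < L) :
    expZ K (fun n => c n + d n) k =
      ∑ j ∈ range L, PowerSeries.coeff j F * expZ K d (k - j) := by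
  have hd : IsExp d (PowerSeries.mk fun n => expCoeff K d n) := by
    refine ⟨by simp [← PowerSeries.coeff_zero_eq_constantCoeff_apply, expCoeff_zero], ?_⟩
    ext n
    have h1 := natCast_smul_expCoeff (K := K) (c := d) (fun _ _ _ _ => Commute.all _ _) n
    rw [eulerDeriv, PowerSeries.coeff_mk, PowerSeries.coeff_mk, ← Nat.cast_smul_eq_nsmul K, h1,
      PowerSeries.coeff_mul]
    refine sum_congr rfl fun p _ => ?_
    simp [mul_assoc]
  rw [(hF.mul hd).expZ_eq]
  rcases lt_or_ge k 0 with h | h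
  · rw [coeffZ_of_neg _ h]
    refine (sum_eq_zero fun j _ => ?_).symm
    rw [expZ_of_neg _ (by omega), mul_zero]
  · lift k to ℕ using h
    rw [coeffZ_natCast, PowerSeries.coeff_mul, Nat.sum_antidiagonal_eq_sum_range_succ_mk]
    refine (sum_congr rfl fun j hj => ?_).trans (sum_subset (range_subset_range.2
      (show k + 1 ≤ L by omega)) fun j _ hj => ?_)
    · have := mem_range.1 hj
      rw [PowerSeries.coeff_mk, ← expZ_natCast, Nat.cast_sub (by omega)]
    · rw [mem_range, not_lt] at hj
      rw [expZ_of_neg _ (by omega), mul_zero]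

end ExpSequences

/-! ### Row products -/

section Rows

open Finset

variable {K : Type*} [Field K]

/-- The parameters `q`, `t` are nonzero and multiplicatively independent. -/
structure Generic (q t : K) : Prop where
  q_ne_zero : q ≠ 0
  t_ne_zero : t ≠ 0
  indep : ∀ a b : ℤ, q ^ a * t ^ b = 1 → a = 0 ∧ b = 0

theorem Generic.one_sub_ne_zero {q t : K} (h : Generic q t) {a b : ℤ} (hab : a ≠ 0 ∨ b ≠ 0) :
    1 - q ^ a * t ^ b ≠ 0 := by
  intro h0
  have := h.indep a b (sub_eq_zero.1 h0).symm
  omega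

theorem Generic.one_sub_q_pow_ne_zero {q t : K} (h : Generic q t) {n : ℕ} (hn : 0 < n) :
    1 - q ^ n ≠ 0 := by
  have := h.one_sub_ne_zero (a := n) (b := 0) (Or.inl (by omega))
  simpa using this

theorem Generic.one_sub_t_pow_ne_zero {q t : K} (h : Generic q t) {n : ℕ} (hn : 0 < n) :
    1 - t ^ n ≠ 0 := by
  have := h.one_sub_ne_zero (a := 0) (b := n) (Or.inr (by omega))
  simpa using this

theorem rowLen_eq_zero_of_len_le {lam : YoungDiagram} {i : ℕ} (h : len lam ≤ i) :
    lam.rowLen i = 0 := by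
  by_contra hne
  have h1 := YoungDiagram.mem_iff_lt_rowLen.2 (Nat.pos_of_ne_zero hne)
  have h2 := YoungDiagram.mem_iff_lt_colLen.1 h1
  rw [len] at h
  omega

theorem rowLen_pos_of_lt_len {lam : YoungDiagram} {i : ℕ} (h : i < len lam) :
    0 < lam.rowLen i :=
  YoungDiagram.mem_iff_lt_rowLen.1 (YoungDiagram.mem_iff_lt_colLen.2 h)

@[to_additive]
theorem prod_cells_eq {M : Type*} [CommMonoid M] (lam : YoungDiagram) {L : ℕ}
    (hL : ∀ i, L ≤ i → lam.rowLen i = 0) (f : ℕ × ℕ → M) :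
    ∏ c ∈ lam.cells, f c = ∏ i ∈ range L, ∏ j ∈ range (lam.rowLen i), f (i, j) := by
  rw [prod_sigma']
  refine prod_bij' (fun c _ => ⟨c.1, c.2⟩) (fun p _ => (p.1, p.2)) ?_ ?_ ?_ ?_ ?_
  · rintro ⟨i, j⟩ hc
    have h1 : j < lam.rowLen i := YoungDiagram.mem_iff_lt_rowLen.1 hc
    simp only [mem_sigma, mem_range]
    refine ⟨?_, h1⟩
    by_contra h2
    have := hL i (by omega)
    omega
  · rintro ⟨i, j⟩ hp
    simp only [mem_sigma, mem_range] at hp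
    exact YoungDiagram.mem_iff_lt_rowLen.2 hp.2
  · intro c _; rfl
  · intro p _; rfl
  · intro c _; rfl

/-- `q^(lam_i) t^(1 - i)`, the row being numbered from `0`. -/
noncomputable def rowX (q t : K) (lam : YoungDiagram) (i : ℕ) : K :=
  q ^ (lam.rowLen i : ℤ) * t ^ (-(i : ℤ))

theorem rowX_inv (q t : K) (lam : YoungDiagram) (i : ℕ) :
    rowX q⁻¹ t⁻¹ lam i = (rowX q t lam i)⁻¹ := by
  simp [rowX, mul_comm]

theorem Generic.rowX_ne_zero {q t : K} (h : Generic q t) (lam : YoungDiagram) (i : ℕ) :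
    rowX q t lam i ≠ 0 :=
  mul_ne_zero (zpow_ne_zero _ h.q_ne_zero) (zpow_ne_zero _ h.t_ne_zero)

theorem Generic.rowX_div {q t : K} (h : Generic q t) (lam : YoungDiagram) (i j : ℕ) :
    rowX q t lam j / rowX q t lam i =
      q ^ ((lam.rowLen j : ℤ) - lam.rowLen i) * t ^ ((i : ℤ) - j) := by
  rw [div_eq_iff (h.rowX_ne_zero lam i), rowX, rowX, mul_mul_mul_comm, ← zpow_add₀ h.q_ne_zero,
    ← zpow_add₀ h.t_ne_zero]
  congr 2 <;> ring

theorem Generic.rowX_injective {q t : K} (h : Generic q t) (lam : YoungDiagram) :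
    Function.Injective (rowX q t lam) := by
  intro i j hij
  have h1 : rowX q t lam j / rowX q t lam i = 1 := by
    rw [hij, div_self (h.rowX_ne_zero lam j)]
  rw [h.rowX_div] at h1
  have := (h.indep _ _ h1).2
  omega

/-- The logarithm of `∏_i (1 - t^(-1) x_i z) / ∏_i (1 - x_i z)`, where `x_i = q^(lam_i) t^(1 - i)`,
the products over `i ≤ l(lam)` and `i ≤ l(lam) + 1`. -/
noncomputable def rowLog (q t : K) (lam : YoungDiagram) (n : ℕ) : K :=
  (∑ i ∈ range (len lam + 1), rowX q t lam i ^ n -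
    ∑ i ∈ range (len lam), (t⁻¹ * rowX q t lam i) ^ n) / n

theorem one_sub_sum_cells (lam : YoungDiagram) (Q T : K) :
    1 - (1 - T⁻¹) * (1 - Q) * ∑ c ∈ lam.cells, Q ^ c.2 * (T ^ c.1)⁻¹ =
      ∑ i ∈ range (len lam + 1), Q ^ lam.rowLen i * (T ^ i)⁻¹ -
        T⁻¹ * ∑ i ∈ range (len lam), Q ^ lam.rowLen i * (T ^ i)⁻¹ := by
  have h1 : (1 - Q) * ∑ c ∈ lam.cells, Q ^ c.2 * (T ^ c.1)⁻¹ =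
      ∑ i ∈ range (len lam), (T ^ i)⁻¹ -
        ∑ i ∈ range (len lam), Q ^ lam.rowLen i * (T ^ i)⁻¹ := by
    rw [sum_cells_eq lam (fun i hi => rowLen_eq_zero_of_len_le hi), mul_sum, ← sum_sub_distrib]
    refine sum_congr rfl fun i _ => ?_
    dsimp only
    rw [← sum_mul, ← mul_assoc, mul_neg_geom_sum, sub_mul, one_mul]
  have h2 : (1 - T⁻¹) * ∑ i ∈ range (len lam), (T ^ i)⁻¹ = 1 - (T ^ len lam)⁻¹ := by
    simp_rw [← inv_pow]
    rw [mul_neg_geom_sum]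
  rw [mul_assoc, h1, mul_sub, h2, sum_range_succ, rowLen_eq_zero_of_len_le le_rfl]
  ring

theorem rowLog_eq (q t : K) (lam : YoungDiagram) (n : ℕ) :
    rowLog q t lam n = (1 - (1 - (t ^ n)⁻¹) * (1 - q ^ n) *
      ∑ c ∈ lam.cells, (q ^ c.2 * (t ^ c.1)⁻¹) ^ n) / n := by
  have h1 := one_sub_sum_cells lam (q ^ n) (t ^ n)
  have h2 : ∀ a b : ℕ, (q ^ n) ^ a * ((t ^ n) ^ b)⁻¹ = (q ^ a * (t ^ b)⁻¹) ^ n := by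
    intro a b
    rw [mul_pow, inv_pow, ← pow_mul, ← pow_mul, ← pow_mul, ← pow_mul, mul_comm n, mul_comm n]
  simp only [h2] at h1
  rw [h1, rowLog, mul_sum]
  congr 2
  · refine sum_congr rfl fun i _ => ?_
    rw [rowX, zpow_neg, zpow_natCast, zpow_natCast]
  · refine sum_congr rfl fun i _ => ?_
    rw [rowX, zpow_neg, zpow_natCast, zpow_natCast, mul_pow, inv_pow]

theorem Generic.inv {q t : K} (h : Generic q t) : Generic q⁻¹ t⁻¹ where
  q_ne_zero := inv_ne_zero h.q_ne_zero
  t_ne_zero := inv_ne_zero h.t_ne_zero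
  indep a b hab := by
    rw [inv_zpow', inv_zpow'] at hab
    have := h.indep _ _ hab
    omega

theorem phiEmpty_add_etaLam_fst [CharZero K] {q t v : K} (h : Generic q t) (lam : YoungDiagram)
    {n : ℕ} (hn : 0 < n) : (phiEmpty q v + etaLam q t v lam).1 n =
      -(rowLog q t lam n * v ^ n / (1 - q ^ n)) := by
  have hq := h.one_sub_q_pow_ne_zero hn
  have hn0 : (n : K) ≠ 0 := by exact_mod_cast hn.ne'
  have h1 : (etaLam q t v lam).1 n =
      (1 - (t ^ n)⁻¹) / n * (∑ c ∈ lam.cells, (q ^ c.2 * (t ^ c.1)⁻¹) ^ n) * v ^ n := by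
    rw [etaLam, Prod.fst_sum, Finset.sum_apply, mul_sum, sum_mul]
    refine sum_congr rfl fun c _ => ?_
    simp only [VertexExponent.at, eta, mul_pow]
    ring
  rw [Prod.fst_add, Pi.add_apply, h1, rowLog_eq, phiEmpty]
  field_simp
  ring

theorem phiEmpty_add_etaLam_snd [CharZero K] {q t v : K} (h : Generic q t) (lam : YoungDiagram)
    {n : ℕ} (hn : 0 < n) : (phiEmpty q v + etaLam q t v lam).2 n =
      -(q ^ n / (1 - q ^ n) * rowLog q⁻¹ t⁻¹ lam n * (v ^ n)⁻¹) := by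
  have hq := h.one_sub_q_pow_ne_zero hn
  have hq0 := h.q_ne_zero
  have hn0 : (n : K) ≠ 0 := by exact_mod_cast hn.ne'
  have h1 : (etaLam q t v lam).2 n =
      -((1 - t ^ n) / n * (∑ c ∈ lam.cells, (q⁻¹ ^ c.2 * (t⁻¹ ^ c.1)⁻¹) ^ n) * (v ^ n)⁻¹) := by
    rw [etaLam, Prod.snd_sum, Finset.sum_apply, mul_sum, sum_mul, ← sum_neg_distrib]
    refine sum_congr rfl fun c _ => ?_
    simp only [VertexExponent.at, eta, mul_pow, inv_pow, mul_inv, inv_inv]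
    ring
  rw [Prod.snd_add, Pi.add_apply, h1, rowLog_eq, phiEmpty]
  have h2 : (1 : K) - q⁻¹ ^ n = -((1 - q ^ n) / q ^ n) := by
    rw [inv_pow]; field_simp; ring
  rw [h2]
  simp only [inv_pow, inv_inv]
  field_simp
  ring

theorem prod_Icc_one_eq {M : Type*} [CommMonoid M] (L : ℕ) (f : ℕ → M) :
    ∏ i ∈ Icc 1 L, f i = ∏ i ∈ range L, f (i + 1) := by
  induction L with
  | zero => simp
  | succ L ih => rw [prod_Icc_succ_top (by omega), prod_range_succ, ih]

theorem isExp_BPlus [CharZero K] {q t : K} (h : Generic q t) (lam : YoungDiagram) :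
    IsExp (fun n => rowLog q t lam n * (1 - (t / q) ^ n)) (BPlus q t lam) := by
  have hq := h.q_ne_zero
  have ht := h.t_ne_zero
  rw [BPlus, prod_Icc_one_eq]
  refine (((isExp_oneSub _).mul (isExp_oneSub _).inv).mul (IsExp.prod (range (len lam)) fun i _ =>
    ((isExp_oneSub _).mul (isExp_oneSub _)).mul
      ((isExp_oneSub _).mul (isExp_oneSub _)).inv)).congr fun n hn => ?_
  have hn0 : (n : K) ≠ 0 := by exact_mod_cast hn.ne'
  have e1 : ∀ i, q ^ (part lam (i + 1) : ℤ) * t ^ (-((i + 1 : ℕ) : ℤ)) =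
      t⁻¹ * rowX q t lam i := by
    intro i
    rw [rowX, part, Nat.add_sub_cancel, Nat.cast_succ, neg_add, zpow_add₀ ht, zpow_neg_one]
    ring
  have e2 : ∀ i, q ^ ((part lam (i + 1) : ℤ) - 1) * t ^ (-((i : ℕ) : ℤ) + 1) =
      t / q * rowX q t lam i := by
    intro i
    rw [rowX, part, Nat.add_sub_cancel, zpow_add₀ ht, zpow_one, zpow_sub_one₀ hq]
    ring
  have e3 : ∀ i, q ^ (part lam (i + 1) : ℤ) * t ^ (-((i : ℕ) : ℤ)) = rowX q t lam i := by
    intro i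
    rw [rowX, part, Nat.add_sub_cancel]
  have e4 : ∀ i, q ^ ((part lam (i + 1) : ℤ) - 1) * t ^ (-((i + 1 : ℕ) : ℤ) + 1) =
      q⁻¹ * rowX q t lam i := by
    intro i
    rw [rowX, part, Nat.add_sub_cancel, Nat.cast_succ, neg_add, neg_add_cancel_right,
      zpow_sub_one₀ hq]
    ring
  have e5 : q ^ ((part lam 1 : ℤ) - 1) * t = t / q * rowX q t lam 0 := by
    have := e2 0; simpa using this
  have e6 : q ^ (part lam 1 : ℤ) = rowX q t lam 0 := by
    have := e3 0; simpa using this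
  simp only [e1, e2, e3, e4, e5, e6]
  rw [rowLog]
  have s1 := sum_range_succ' (fun i => rowX q t lam i ^ n) (len lam)
  have s2 : ∑ i ∈ range (len lam), (t⁻¹ * rowX q t lam i) ^ n =
      t⁻¹ ^ n * ∑ i ∈ range (len lam), rowX q t lam i ^ n := by
    rw [mul_sum]; exact sum_congr rfl fun i _ => mul_pow _ _ _
  rw [s1, s2]
  simp only [mul_pow, neg_add, neg_neg, sum_add_distrib, sum_neg_distrib, ← sum_div, ← mul_sum,
    div_pow, inv_pow]
  field_simp
  ring

theorem BMinus_eq (q t : K) (lam : YoungDiagram) : BMinus q t lam = BPlus q⁻¹ t⁻¹ lam := by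
  simp only [BMinus, BPlus, inv_zpow', neg_sub, neg_add, neg_neg]
  congr 1
  · rw [show 1 - (part lam 1 : ℤ) = -(part lam 1 : ℤ) + 1 by ring]
  · refine prod_congr rfl fun i _ => ?_
    rw [show 1 - (part lam (i + 1) : ℤ) = -(part lam (i + 1) : ℤ) + 1 by ring,
      show 1 - (part lam i : ℤ) = -(part lam i : ℤ) + 1 by ring]
    rfl

/-- The coefficient of the delta function at `z = x_i` in the difference of the expansions of
`∏_j (1 - t^(-1) x_j z) / ∏_j (1 - x_j z)` at `0` and at `∞`; the products are over `L` and
`L + 1` rows. -/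
noncomputable def rhoCoeff (q t : K) (lam : YoungDiagram) (L i : ℕ) : K :=
  (∏ j ∈ range L, (1 - t⁻¹ * rowX q t lam j / rowX q t lam i)) *
    residue (range (L + 1)) (rowX q t lam) i

/-- The coefficient of a delta function in the difference of the expansions of
`∏_j (1 - x_j z) / ∏_j (1 - t^(-1) x_j z)` at `0` and at `∞`; the products are over `L + 1` and
`L` rows. -/
noncomputable def sigmaCoeff (q t : K) (lam : YoungDiagram) (L i : ℕ) : K :=
  (∏ j ∈ range (L + 1), (1 - rowX q t lam j / (t⁻¹ * rowX q t lam i))) *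
    residue (range L) (fun j => t⁻¹ * rowX q t lam j) i

theorem isExp_rowLog [CharZero K] (q t : K) (lam : YoungDiagram) :
    IsExp (rowLog q t lam) (ratioSeries (range (len lam)) (range (len lam + 1))
      (fun i => t⁻¹ * rowX q t lam i) (rowX q t lam)) :=
  isExp_ratioSeries _ _ _ _

theorem isExp_neg_rowLog [CharZero K] (q t : K) (lam : YoungDiagram) :
    IsExp (fun n => -rowLog q t lam n) (ratioSeries (range (len lam + 1)) (range (len lam))
      (rowX q t lam) (fun i => t⁻¹ * rowX q t lam i)) :=
  (isExp_ratioSeries _ _ _ _).congr fun n _ => by rw [rowLog]; ring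

theorem prod_rowX_ratio {q t : K} (h : Generic q t) (lam : YoungDiagram) :
    (∏ j ∈ range (len lam), -(t⁻¹ * rowX q t lam j)) *
      (∏ i ∈ range (len lam + 1), -rowX q t lam i)⁻¹ = -1 := by
  have hx := h.rowX_ne_zero lam
  have ht := h.t_ne_zero
  have h1 : ∏ j ∈ range (len lam), -(t⁻¹ * rowX q t lam j) =
      t⁻¹ ^ len lam * ∏ j ∈ range (len lam), -rowX q t lam j := by
    rw [prod_congr rfl fun j _ => (mul_neg t⁻¹ (rowX q t lam j)).symm, prod_mul_distrib,
      prod_const, card_range]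
  have h2 : rowX q t lam (len lam) = t⁻¹ ^ len lam := by
    rw [rowX, rowLen_eq_zero_of_len_le le_rfl]; simp
  have h3 : ∏ j ∈ range (len lam), -rowX q t lam j ≠ 0 :=
    prod_ne_zero_iff.2 fun j _ => neg_ne_zero.2 (hx j)
  rw [h1, prod_range_succ, h2]
  have : t⁻¹ ^ len lam ≠ 0 := pow_ne_zero _ (inv_ne_zero ht)
  field_simp

theorem expZ_rowLog_add [CharZero K] {q t : K} (h : Generic q t) (lam : YoungDiagram) (n : ℤ) :
    expZ K (rowLog q t lam) n + expZ K (rowLog q⁻¹ t⁻¹ lam) (-1 - n) =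
      ∑ i ∈ range (len lam + 1), rhoCoeff q t lam (len lam) i * rowX q t lam i ^ n := by
  have hx := h.rowX_ne_zero lam
  have key := coeffZ_ratioSeries_sub (I := range (len lam + 1)) (a := rowX q t lam)
    (fun i _ => hx i) (fun i _ j _ e => h.rowX_injective lam e) (range (len lam))
    (b := fun i => t⁻¹ * rowX q t lam i) (fun j _ => mul_ne_zero (inv_ne_zero h.t_ne_zero) (hx j)) n
  rw [prod_rowX_ratio h, neg_one_mul, sub_neg_eq_add, card_range, card_range] at key
  rw [(isExp_rowLog q t lam).expZ_eq, (isExp_rowLog q⁻¹ t⁻¹ lam).expZ_eq]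
  refine Eq.trans ?_ key
  congr 2
  · congr 1
    · funext i; rw [rowX_inv, mul_inv]
    · funext i; rw [rowX_inv]
  · push_cast; ring

theorem expZ_neg_rowLog_add [CharZero K] {q t : K} (h : Generic q t) (lam : YoungDiagram) (n : ℤ) :
    expZ K (fun n => -rowLog q t lam n) n + expZ K (fun n => -rowLog q⁻¹ t⁻¹ lam n) (1 - n) =
      ∑ i ∈ range (len lam), sigmaCoeff q t lam (len lam) i * (t⁻¹ * rowX q t lam i) ^ n := by
  have hx := h.rowX_ne_zero lam
  have ht := inv_ne_zero h.t_ne_zero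
  have key := coeffZ_ratioSeries_sub (I := range (len lam)) (a := fun i => t⁻¹ * rowX q t lam i)
    (fun i _ => mul_ne_zero ht (hx i))
    (fun i _ j _ e => h.rowX_injective lam (mul_left_cancel₀ ht e)) (range (len lam + 1))
    (b := rowX q t lam) (fun j _ => hx j) n
  have h1 : (∏ j ∈ range (len lam + 1), -rowX q t lam j) *
      (∏ i ∈ range (len lam), -(t⁻¹ * rowX q t lam i))⁻¹ = -1 := by
    rw [← inv_inv (∏ j ∈ range (len lam + 1), -rowX q t lam j), ← mul_inv, mul_comm,
      prod_rowX_ratio h]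
    norm_num
  rw [h1, neg_one_mul, sub_neg_eq_add, card_range, card_range] at key
  rw [(isExp_neg_rowLog q t lam).expZ_eq, (isExp_neg_rowLog q⁻¹ t⁻¹ lam).expZ_eq]
  refine Eq.trans ?_ key
  congr 2
  · congr 1
    · funext i; rw [rowX_inv]
    · funext i; rw [rowX_inv, mul_inv]
  · push_cast; ring

end Rows

/-! ### Adding and removing boxes -/

section Boxes

open Finset

/-- The diagram `lam` is obtained from `mu` by adding a box to the row with index `i`. -/
def BoxAdded (mu lam : YoungDiagram) (i : ℕ) : Prop :=
  ∀ j, lam.rowLen j = mu.rowLen j + if j = i then 1 else 0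

theorem rowLen_eq_of_mem_iff {lam : YoungDiagram} {f : ℕ → ℕ}
    (h : ∀ i j, (i, j) ∈ lam ↔ j < f i) (i : ℕ) : lam.rowLen i = f i := by
  have h1 := fun j => YoungDiagram.mem_iff_lt_rowLen.symm.trans (h i j)
  refine le_antisymm (not_lt.1 fun hlt => ?_) (not_lt.1 fun hlt => ?_)
  · exact lt_irrefl _ ((h1 _).1 hlt)
  · exact lt_irrefl _ ((h1 _).2 hlt)

theorem boxAdded_addBox (lam : YoungDiagram) {i : ℕ}
    (h : i = 0 ∨ lam.rowLen i < lam.rowLen (i - 1)) : BoxAdded lam (addBox lam (i + 1)) i := by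
  have hmem : ∀ a b, (a, b) ∈ insert (i, lam.rowLen i) lam.cells ↔
      b < lam.rowLen a + if a = i then 1 else 0 := by
    intro a b
    rw [mem_insert, YoungDiagram.mem_cells, YoungDiagram.mem_iff_lt_rowLen, Prod.mk.injEq]
    split_ifs with hi
    · subst hi; omega
    · simp [hi]
  have hlow : IsLowerSet ((insert (i, lam.rowLen i) lam.cells : Finset (ℕ × ℕ)) :
      Set (ℕ × ℕ)) := by
    rintro ⟨a, b⟩ ⟨a', b'⟩ hle hab
    obtain ⟨h1 : a' ≤ a, h2 : b' ≤ b⟩ := hle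
    rw [mem_coe, hmem] at hab ⊢
    have h3 := lam.rowLen_anti a' a h1
    by_cases e1 : a = i
    · by_cases e2 : a' = i
      · rw [if_pos e1] at hab
        rw [if_pos e2]
        omega
      · have h4 := lam.rowLen_anti a' (i - 1) (by omega)
        rw [if_pos e1] at hab
        subst e1
        rcases h with h | h <;> omega
    · rw [if_neg e1] at hab
      omega
  have heq : addBox lam (i + 1) = ⟨insert (i, lam.rowLen i) lam.cells, hlow⟩ := by
    unfold addBox
    exact dif_pos hlow
  intro j
  refine rowLen_eq_of_mem_iff (f := fun j => lam.rowLen j + if j = i then 1 else 0)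
    (fun a b => ?_) j
  rw [heq, YoungDiagram.mem_mk]
  exact hmem a b

theorem boxAdded_removeBox (lam : YoungDiagram) {i : ℕ} (h : lam.rowLen (i + 1) < lam.rowLen i) :
    BoxAdded (removeBox lam (i + 1)) lam i := by
  have hmem : ∀ a b, (a, b) ∈ lam.cells.erase (i, lam.rowLen i - 1) ↔
      b < lam.rowLen a - if a = i then 1 else 0 := by
    intro a b
    rw [mem_erase, YoungDiagram.mem_cells, YoungDiagram.mem_iff_lt_rowLen, Ne, Prod.mk.injEq]
    split_ifs with hi
    · subst hi; omega
    · simp [hi]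
  have hlow : IsLowerSet ((lam.cells.erase (i, lam.rowLen i - 1) : Finset (ℕ × ℕ)) :
      Set (ℕ × ℕ)) := by
    rintro ⟨a, b⟩ ⟨a', b'⟩ hle hab
    obtain ⟨h1 : a' ≤ a, h2 : b' ≤ b⟩ := hle
    rw [mem_coe, hmem] at hab ⊢
    have h3 := lam.rowLen_anti a' a h1
    by_cases e2 : a' = i
    · rw [if_pos e2]
      by_cases e1 : a = i
      · rw [if_pos e1] at hab
        omega
      · have h4 := lam.rowLen_anti (i + 1) a (by omega)
        subst e2
        omega
    · rw [if_neg e2]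
      omega
  have heq : removeBox lam (i + 1) = ⟨lam.cells.erase (i, lam.rowLen i - 1), hlow⟩ := by
    unfold removeBox
    exact dif_pos hlow
  have hrow : ∀ j, (removeBox lam (i + 1)).rowLen j = lam.rowLen j - if j = i then 1 else 0 := by
    refine rowLen_eq_of_mem_iff (f := fun j => lam.rowLen j - if j = i then 1 else 0)
      fun a b => ?_
    rw [heq, YoungDiagram.mem_mk]
    exact hmem a b
  intro j
  rw [hrow]
  split_ifs with hj
  · subst hj; omega
  · omega

namespace BoxAdded

variable {mu lam : YoungDiagram} {i : ℕ}

theorem cells_eq (h : BoxAdded mu lam i) : lam.cells = insert (i, mu.rowLen i) mu.cells := by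
  ext ⟨a, b⟩
  rw [mem_insert, YoungDiagram.mem_cells, YoungDiagram.mem_cells, YoungDiagram.mem_iff_lt_rowLen,
    YoungDiagram.mem_iff_lt_rowLen, h a, Prod.mk.injEq]
  split_ifs with hi
  · subst hi; omega
  · simp [hi]

theorem notMem (_ : BoxAdded mu lam i) : (i, mu.rowLen i) ∉ mu.cells := by
  rw [YoungDiagram.mem_cells, YoungDiagram.mem_iff_lt_rowLen]
  exact lt_irrefl _

theorem card_eq (h : BoxAdded mu lam i) : lam.card = mu.card + 1 := by
  rw [YoungDiagram.card, h.cells_eq, card_insert_of_notMem h.notMem]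

theorem nStat_eq (h : BoxAdded mu lam i) : nStat lam = nStat mu + i := by
  rw [nStat, h.cells_eq, sum_insert h.notMem, nStat, add_comm]

theorem lt_rowLen (h : BoxAdded mu lam i) {a : ℕ} (ha : a < i) : mu.rowLen i < mu.rowLen a := by
  have h1 := lam.rowLen_anti a i ha.le
  rw [h i, h a, if_pos rfl, if_neg ha.ne] at h1
  omega

theorem lt_colLen_iff (mu : YoungDiagram) (a b : ℕ) : a < mu.colLen b ↔ b < mu.rowLen a :=
  YoungDiagram.mem_iff_lt_colLen.symm.trans YoungDiagram.mem_iff_lt_rowLen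

theorem colLen_mu (h : BoxAdded mu lam i) : mu.colLen (mu.rowLen i) = i := by
  refine le_antisymm (not_lt.1 fun hlt => ?_) (not_lt.1 fun hlt => ?_)
  · exact lt_irrefl _ ((lt_colLen_iff mu _ _).1 hlt)
  · exact lt_irrefl _ ((lt_colLen_iff mu _ _).2 (h.lt_rowLen hlt))

theorem colLen_lam (h : BoxAdded mu lam i) : lam.colLen (mu.rowLen i) = i + 1 := by
  have h1 : ∀ a, a < lam.colLen (mu.rowLen i) ↔ a < i + 1 := by
    intro a
    rw [lt_colLen_iff, h a]
    have h2 := fun ha => h.lt_rowLen (a := a) ha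
    have h3 := fun ha => mu.rowLen_anti i a ha
    split_ifs with e
    · subst e; omega
    · constructor
      · intro hlt
        by_contra hge
        have := h3 (by omega)
        omega
      · intro hlt
        have := h2 (by omega)
        omega
  have h2 := h1 i
  have h3 := h1 (i + 1)
  omega

theorem colLen_of_ne (h : BoxAdded mu lam i) {b : ℕ} (hb : b ≠ mu.rowLen i) :
    lam.colLen b = mu.colLen b := by
  have h1 : ∀ a, a < lam.colLen b ↔ a < mu.colLen b := by
    intro a
    rw [lt_colLen_iff, lt_colLen_iff, h a]
    split_ifs with e
    · subst e; omega
    · omega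
  have h2 := h1 (lam.colLen b)
  have h3 := h1 (mu.colLen b)
  omega

theorem nStat_transpose_eq (h : BoxAdded mu lam i) :
    nStat lam.transpose = nStat mu.transpose + mu.rowLen i := by
  have key : ∀ nu : YoungDiagram, nStat nu.transpose = ∑ c ∈ nu.cells, c.2 := by
    intro nu
    rw [nStat]
    refine sum_bij' (fun c _ => c.swap) (fun c _ => c.swap) ?_ ?_ (fun _ _ => rfl) (fun _ _ => rfl)
      (fun _ _ => rfl)
    · intro c hc
      exact YoungDiagram.mem_transpose.1 hc
    · intro c hc
      exact YoungDiagram.mem_transpose.2 hc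
  rw [key, key, h.cells_eq, sum_insert h.notMem, add_comm]

theorem etaLam_eq {K : Type*} [Field K] (q t v : K) (h : BoxAdded mu lam i) :
    etaLam q t v lam = etaLam q t v mu + (eta t).at (rowX q t mu i * v) := by
  rw [etaLam, h.cells_eq, sum_insert h.notMem, etaLam, add_comm, rowX, zpow_natCast, zpow_neg,
    zpow_natCast]

theorem rowX_self {K : Type*} [Field K] {q t : K} (hq : q ≠ 0) (h : BoxAdded mu lam i) :
    rowX q t lam i = q * rowX q t mu i := by
  rw [rowX, h i, if_pos rfl, rowX, Nat.cast_succ, zpow_add_one₀ hq]; ring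

theorem rowX_of_ne {K : Type*} [Field K] (q t : K) (h : BoxAdded mu lam i) {j : ℕ} (hj : j ≠ i) :
    rowX q t lam j = rowX q t mu j := by
  rw [rowX, h j, if_neg hj, rowX, Nat.add_zero]

end BoxAdded

variable {K : Type*} [Field K]

/-- The factor of `c_lam` which belongs to the box `c`. -/
noncomputable def cFactor (q t : K) (lam : YoungDiagram) (c : ℕ × ℕ) : K :=
  1 - q ^ (lam.rowLen c.1 - (c.2 + 1)) * t ^ (lam.colLen c.2 - (c.1 + 1) + 1)

theorem Generic.cFactor_ne_zero {q t : K} (hg : Generic q t) (lam : YoungDiagram) (c : ℕ × ℕ) :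
    cFactor q t lam c ≠ 0 := by
  have := hg.one_sub_ne_zero (a := (lam.rowLen c.1 - (c.2 + 1) : ℕ))
    (b := (lam.colLen c.2 - (c.1 + 1) + 1 : ℕ)) (Or.inr (by omega))
  rwa [zpow_natCast, zpow_natCast] at this

theorem Generic.cStat_ne_zero {q t : K} (hg : Generic q t) (lam : YoungDiagram) :
    cStat q t lam ≠ 0 :=
  prod_ne_zero_iff.2 fun c _ => hg.cFactor_ne_zero lam c

/-- The ratio `x_a / x_i` of row parameters. -/
noncomputable def rowRatio (q t : K) (mu : YoungDiagram) (i a : ℕ) : K :=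
  q ^ ((mu.rowLen a : ℤ) - mu.rowLen i) * t ^ ((i : ℤ) - a)

theorem Generic.rowRatio_ne_zero {q t : K} (hg : Generic q t) (mu : YoungDiagram) (i a : ℕ) :
    rowRatio q t mu i a ≠ 0 :=
  mul_ne_zero (zpow_ne_zero _ hg.q_ne_zero) (zpow_ne_zero _ hg.t_ne_zero)

theorem Generic.one_sub_mul_rowRatio_ne_zero {q t : K} (hg : Generic q t) (mu : YoungDiagram)
    {i a : ℕ} {m n : ℤ} (h : n + ((i : ℤ) - a) ≠ 0) :
    1 - q ^ m * t ^ n * rowRatio q t mu i a ≠ 0 := by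
  have := hg.one_sub_ne_zero (a := m + ((mu.rowLen a : ℤ) - mu.rowLen i))
    (b := n + ((i : ℤ) - a)) (Or.inr h)
  rwa [zpow_add₀ hg.q_ne_zero, zpow_add₀ hg.t_ne_zero, mul_mul_mul_comm] at this

theorem Generic.one_sub_mul_rowRatio_inv_ne_zero {q t : K} (hg : Generic q t) (mu : YoungDiagram)
    {i a : ℕ} {m n : ℤ} (h : n - ((i : ℤ) - a) ≠ 0) :
    1 - q ^ m * t ^ n * (rowRatio q t mu i a)⁻¹ ≠ 0 := by
  have := hg.one_sub_ne_zero (a := m - ((mu.rowLen a : ℤ) - mu.rowLen i))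
    (b := n - ((i : ℤ) - a)) (Or.inr h)
  rwa [zpow_sub₀ hg.q_ne_zero, zpow_sub₀ hg.t_ne_zero, div_mul_div_comm, div_eq_mul_inv] at this

theorem prod_Ico_div_succ {φ : ℕ → K} (hφ : ∀ b, φ b ≠ 0) {m n : ℕ} (h : m ≤ n) :
    ∏ b ∈ Ico m n, φ b / φ (b + 1) = φ m / φ n := by
  induction n, h using Nat.le_induction with
  | base => simp [div_self (hφ m)]
  | succ n hn ih =>
    rw [prod_Ico_succ_top hn, ih]
    have := hφ n
    field_simp

theorem colLen_eq_of_mem_Ico {mu : YoungDiagram} {k b : ℕ}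
    (hb : b ∈ Ico (mu.rowLen (k + 1)) (mu.rowLen k)) : mu.colLen b = k + 1 := by
  rw [mem_Ico] at hb
  have h1 := BoxAdded.lt_colLen_iff mu k b
  have h2 := BoxAdded.lt_colLen_iff mu (k + 1) b
  omega

theorem prod_row_cFactor {q t : K} (hg : Generic q t) {mu lam : YoungDiagram} {i L : ℕ}
    (h : BoxAdded mu lam i) (hL : ∀ j, L ≤ j → mu.rowLen j = 0) {k : ℕ} (hik : i ≤ k)
    (hkL : k ≤ L) :
    ∏ b ∈ range (mu.rowLen k), cFactor q t lam (i, b) / cFactor q t mu (i, b) =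
      ∏ k ∈ Ico k L, (1 - (rowRatio q t mu i (k + 1))⁻¹) / (1 - t * (rowRatio q t mu i k)⁻¹) := by
  induction hkL using Nat.decreasingInduction with
  | self => rw [hL L le_rfl]; simp
  | of_succ k hk ih =>
    rw [← prod_range_mul_prod_Ico _ (mu.rowLen_anti k (k + 1) (by omega)), ih (by omega),
      prod_eq_prod_Ico_succ_bot hk, mul_comm]
    congr 1
    set φ : ℕ → K := fun b => 1 - q ^ ((mu.rowLen i : ℤ) - b) * t ^ ((k : ℤ) + 1 - i) with hφ
    have hφ0 : ∀ b, φ b ≠ 0 := fun b => hg.one_sub_ne_zero (Or.inr (by omega))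
    have h1 : ∀ b ∈ Ico (mu.rowLen (k + 1)) (mu.rowLen k),
        cFactor q t lam (i, b) / cFactor q t mu (i, b) = φ b / φ (b + 1) := by
      intro b hb
      have hc := colLen_eq_of_mem_Ico hb
      have hb' := mem_Ico.1 hb
      have hm := mu.rowLen_anti i k hik
      rw [cFactor, cFactor, hφ]
      simp only
      rw [h i, if_pos rfl, h.colLen_of_ne (by omega), hc]
      rw [← zpow_natCast q, ← zpow_natCast q, ← zpow_natCast t]
      congr 4
      · omega
      · omega
      · omega
      · omega
    rw [prod_congr rfl h1, prod_Ico_div_succ hφ0 (mu.rowLen_anti k (k + 1) (by omega))]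
    have ht := hg.t_ne_zero
    congr 1
    · simp only [hφ, rowRatio, mul_inv, ← zpow_neg]
      congr 3
      · ring
      · push_cast; ring
    · simp only [hφ, rowRatio, mul_inv, ← zpow_neg]
      rw [mul_left_comm, ← zpow_one_add₀ ht]
      congr 3
      · ring
      · ring

theorem cStat_boxAdded {q t : K} (hg : Generic q t) {mu lam : YoungDiagram} {i L : ℕ}
    (h : BoxAdded mu lam i) (hL : ∀ j, L ≤ j → mu.rowLen j = 0) (hiL : i ≤ L) :
    cStat q t lam = cStat q t mu * (1 - t) *
      (∏ a ∈ range i, (1 - q⁻¹ * t * rowRatio q t mu i a) / (1 - q⁻¹ * rowRatio q t mu i a)) *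
      ∏ k ∈ Ico i L, (1 - (rowRatio q t mu i (k + 1))⁻¹) / (1 - t * (rowRatio q t mu i k)⁻¹) := by
  have h1 : cStat q t lam = cFactor q t lam (i, mu.rowLen i) *
      ∏ c ∈ mu.cells, cFactor q t lam c := by
    rw [cStat, h.cells_eq, prod_insert h.notMem]; rfl
  have h2 : ∏ c ∈ mu.cells, cFactor q t lam c = cStat q t mu *
      ∏ c ∈ mu.cells, cFactor q t lam c / cFactor q t mu c := by
    rw [cStat, ← prod_mul_distrib]
    exact prod_congr rfl fun c _ => (mul_div_cancel₀ _ (hg.cFactor_ne_zero mu c)).symm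
  have h3 : cFactor q t lam (i, mu.rowLen i) = 1 - t := by
    rw [cFactor, h i, if_pos rfl, h.colLen_lam]; simp
  have h4 : ∀ a, i < a → ∏ b ∈ range (mu.rowLen a),
      cFactor q t lam (a, b) / cFactor q t mu (a, b) = 1 := by
    intro a ha
    refine prod_eq_one fun b hb => ?_
    have hb' := mem_range.1 hb
    have := mu.rowLen_anti i a ha.le
    have h5 : cFactor q t lam (a, b) = cFactor q t mu (a, b) := by
      rw [cFactor, cFactor]
      simp only
      rw [h a, if_neg (by omega), h.colLen_of_ne (by omega), Nat.add_zero]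
    rw [h5, div_self (hg.cFactor_ne_zero mu _)]
  have h5 : ∀ a, a < i → ∏ b ∈ range (mu.rowLen a),
      cFactor q t lam (a, b) / cFactor q t mu (a, b) =
        (1 - q⁻¹ * t * rowRatio q t mu i a) / (1 - q⁻¹ * rowRatio q t mu i a) := by
    intro a ha
    have hlt := h.lt_rowLen ha
    rw [prod_eq_single_of_mem (mu.rowLen i) (mem_range.2 hlt)]
    · rw [cFactor, cFactor]
      simp only
      rw [h a, if_neg ha.ne, h.colLen_lam, h.colLen_mu, Nat.add_zero, rowRatio,
        ← zpow_natCast q, ← zpow_natCast t, ← zpow_natCast t, mul_mul_mul_comm, ← mul_assoc q⁻¹,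
        ← zpow_neg_one, ← zpow_add₀ hg.q_ne_zero, ← zpow_one_add₀ hg.t_ne_zero]
      congr 4
      · omega
      · omega
      · omega
      · omega
    · intro b _ hb
      have h6 : cFactor q t lam (a, b) = cFactor q t mu (a, b) := by
        rw [cFactor, cFactor]
        simp only
        rw [h a, if_neg (by omega), h.colLen_of_ne hb, Nat.add_zero]
      rw [h6, div_self (hg.cFactor_ne_zero mu _)]
  have h6 : ∏ c ∈ mu.cells, cFactor q t lam c / cFactor q t mu c =
      (∏ a ∈ range i, (1 - q⁻¹ * t * rowRatio q t mu i a) / (1 - q⁻¹ * rowRatio q t mu i a)) *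
      ∏ k ∈ Ico i L, (1 - (rowRatio q t mu i (k + 1))⁻¹) / (1 - t * (rowRatio q t mu i k)⁻¹) := by
    rw [prod_cells_eq mu (L := L + 1) (fun j hj => hL j (by omega)),
      ← prod_subset (range_subset_range.2 (show i + 1 ≤ L + 1 by omega)) (fun a _ ha => h4 a
        (by rw [mem_range] at ha; omega)), prod_range_succ, prod_row_cFactor hg h hL le_rfl hiL]
    congr 1
    exact prod_congr rfl fun a ha => h5 a (mem_range.1 ha)
  rw [h1, h2, h3, h6]
  ring

end Boxes

/-! ### The coefficients of the vertical module -/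

section VerticalCoefficients

open Finset

variable {K : Type*} [Field K] {q t : K}

theorem rowRatio_self (q t : K) (mu : YoungDiagram) (i : ℕ) : rowRatio q t mu i i = 1 := by
  simp [rowRatio]

theorem Generic.rowX_div_eq (hg : Generic q t) (mu : YoungDiagram) (i j : ℕ) :
    rowX q t mu j / rowX q t mu i = rowRatio q t mu i j := hg.rowX_div mu i j

theorem APlus_eq (hg : Generic q t) (mu : YoungDiagram) (i : ℕ) :
    APlus q t mu (i + 1) = (1 - t) * ∏ a ∈ range i,
      ((1 - t⁻¹ * rowRatio q t mu i a) / (1 - rowRatio q t mu i a) *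
        ((1 - q⁻¹ * t * rowRatio q t mu i a) / (1 - q⁻¹ * rowRatio q t mu i a))) := by
  have hq := hg.q_ne_zero
  have ht := hg.t_ne_zero
  rw [APlus, Nat.add_sub_cancel, prod_Icc_one_eq]
  congr 1
  refine prod_congr rfl fun a ha => ?_
  have ha := mem_range.1 ha
  set y := rowRatio q t mu i a with hy
  have hy0 : y ≠ 0 := hg.rowRatio_ne_zero mu i a
  have e0 : q ^ ((part mu (i + 1) : ℤ) - part mu (a + 1)) * t ^ ((a : ℤ) - i) = y⁻¹ := by
    rw [hy, rowRatio, mul_inv, ← zpow_neg, ← zpow_neg, part, part, Nat.add_sub_cancel,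
      Nat.add_sub_cancel]
    congr 2 <;> ring
  have e1 : q ^ ((part mu (i + 1) : ℤ) - part mu (a + 1)) *
      t ^ (-((i + 1 : ℕ) : ℤ) + ((a + 1 : ℕ) : ℤ) + 1) = t * y⁻¹ := by
    rw [← e0, mul_left_comm, ← zpow_one_add₀ ht]
    congr 2; push_cast; ring
  have e2 : q ^ ((part mu (i + 1) : ℤ) - part mu (a + 1) + 1) *
      t ^ (-((i + 1 : ℕ) : ℤ) + ((a + 1 : ℕ) : ℤ) - 1) = q * t⁻¹ * y⁻¹ := by
    rw [← e0, mul_mul_mul_comm, ← zpow_one_add₀ hq, ← zpow_neg_one, ← zpow_add₀ ht]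
    congr 2
    · ring
    · push_cast; ring
  have e3 : q ^ ((part mu (i + 1) : ℤ) - part mu (a + 1)) *
      t ^ (-((i + 1 : ℕ) : ℤ) + ((a + 1 : ℕ) : ℤ)) = y⁻¹ := by
    rw [← e0]
    congr 2; push_cast; ring
  have e4 : q ^ ((part mu (i + 1) : ℤ) - part mu (a + 1) + 1) *
      t ^ (-((i + 1 : ℕ) : ℤ) + ((a + 1 : ℕ) : ℤ)) = q * y⁻¹ := by
    rw [← e0, ← mul_assoc, ← zpow_one_add₀ hq]
    congr 2
    · ring
    · push_cast; ring
  rw [e1, e2, e3, e4]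
  have n1 : 1 - y ≠ 0 := by
    have := hg.one_sub_mul_rowRatio_ne_zero mu (i := i) (a := a) (m := 0) (n := 0) (by omega)
    simpa [hy] using this
  have n2 : 1 - q⁻¹ * y ≠ 0 := by
    have := hg.one_sub_mul_rowRatio_ne_zero mu (i := i) (a := a) (m := -1) (n := 0) (by omega)
    simpa [hy] using this
  have n1' : y - 1 ≠ 0 := by rw [← neg_sub]; exact neg_ne_zero.2 n1
  have n2' : q - y ≠ 0 := by
    have : q - y = q * (1 - q⁻¹ * y) := by field_simp
    rw [this]; exact mul_ne_zero hq n2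
  have n2'' : y - q ≠ 0 := by rw [← neg_sub]; exact neg_ne_zero.2 n2'
  have f1 : 1 - y⁻¹ = (y - 1) / y := by field_simp
  have f2 : 1 - q * y⁻¹ = (y - q) / y := by field_simp
  have f3 : 1 - q⁻¹ * y = (q - y) / q := by field_simp
  have f4 : 1 - t * y⁻¹ = (y - t) / y := by field_simp
  have f5 : 1 - q * t⁻¹ * y⁻¹ = (t * y - q) / (t * y) := by field_simp
  have f6 : 1 - t⁻¹ * y = (t - y) / t := by field_simp
  have f7 : 1 - q⁻¹ * t * y = (q - t * y) / q := by field_simp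
  rw [f1, f2, f3, f4, f5, f6, f7]
  field_simp
  ring

theorem prod_erase_range {M : Type*} [CommMonoid M] {n i : ℕ} (h : i < n) (f : ℕ → M) :
    ∏ j ∈ (range n).erase i, f j = (∏ j ∈ range i, f j) * ∏ j ∈ Ico (i + 1) n, f j := by
  have h1 : (range n).erase i = range i ∪ Ico (i + 1) n := by
    ext j; simp only [mem_erase, mem_range, mem_union, mem_Ico]; omega
  rw [h1, prod_union]
  rw [disjoint_left]
  intro j hj hj'
  rw [mem_range] at hj
  rw [mem_Ico] at hj'
  omega

theorem prod_Ico_succ_shift {M : Type*} [CommMonoid M] (i L : ℕ) (f : ℕ → M) :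
    ∏ j ∈ Ico (i + 1) (L + 1), f j = ∏ k ∈ Ico i L, f (k + 1) := by
  rw [prod_Ico_add' f i L 1]

theorem rhoCoeff_eq (hg : Generic q t) (mu : YoungDiagram) {L i : ℕ} (h : i ≤ L) :
    rhoCoeff q t mu L i =
      (∏ a ∈ range i, (1 - t⁻¹ * rowRatio q t mu i a) / (1 - rowRatio q t mu i a)) *
      ∏ k ∈ Ico i L, (1 - t⁻¹ * rowRatio q t mu i k) / (1 - rowRatio q t mu i (k + 1)) := by
  rw [rhoCoeff, residue, prod_erase_range (by omega), prod_Ico_succ_shift,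
    ← prod_range_mul_prod_Ico _ h]
  simp only [mul_div_assoc, hg.rowX_div_eq]
  rw [mul_inv, prod_div_distrib, prod_div_distrib]
  simp only [div_eq_mul_inv]
  ring

theorem sigmaCoeff_eq (hg : Generic q t) (lam : YoungDiagram) {L i : ℕ} (h : i < L) :
    sigmaCoeff q t lam L i =
      (∏ a ∈ range i, (1 - t * rowRatio q t lam i a) / (1 - rowRatio q t lam i a)) * (1 - t) *
      (∏ k ∈ Ico i L, (1 - t * rowRatio q t lam i (k + 1))) *
      ∏ k ∈ Ico (i + 1) L, (1 - rowRatio q t lam i k)⁻¹ := by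
  have h1 : ∀ j, rowX q t lam j / (t⁻¹ * rowX q t lam i) = t * rowRatio q t lam i j := by
    intro j
    rw [← hg.rowX_div_eq, div_mul_eq_div_div, div_inv_eq_mul]; ring
  have h2 : ∀ j, t⁻¹ * rowX q t lam j / (t⁻¹ * rowX q t lam i) = rowRatio q t lam i j := by
    intro j
    rw [mul_div_mul_left _ _ (inv_ne_zero hg.t_ne_zero), hg.rowX_div_eq]
  rw [sigmaCoeff, residue, prod_erase_range h]
  simp only [h1, h2]
  rw [← prod_range_mul_prod_Ico _ (show i + 1 ≤ L + 1 by omega), prod_range_succ,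
    prod_Ico_succ_shift, rowRatio_self, mul_one, mul_inv, prod_div_distrib, prod_inv_distrib]
  simp only [div_eq_mul_inv]
  ring

theorem prod_Ico_rowRatio (hg : Generic q t) (mu : YoungDiagram) {i L : ℕ} (h : i ≤ L) :
    ∏ k ∈ Ico i L, t⁻¹ * rowRatio q t mu i k * (rowRatio q t mu i (k + 1))⁻¹ =
      q ^ ((mu.rowLen i : ℤ) - mu.rowLen L) := by
  induction L, h using Nat.le_induction with
  | base => simp
  | succ L hL ih =>
    rw [prod_Ico_succ_top hL, ih, rowRatio, rowRatio, mul_inv, ← zpow_neg, ← zpow_neg]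
    have hq := hg.q_ne_zero
    have ht := hg.t_ne_zero
    have e : ∀ a b c d : ℤ, t⁻¹ * (q ^ a * t ^ b) * (q ^ c * t ^ d) = q ^ (a + c) * t ^ (b + d - 1) := by
      intro a b c d
      rw [zpow_add₀ hq, zpow_sub_one₀ ht, zpow_add₀ ht]; ring
    rw [e, ← mul_assoc, ← zpow_add₀ hq]
    have : (i : ℤ) - L + -((i : ℤ) - (L + 1 : ℕ)) - 1 = 0 := by push_cast; ring
    rw [this, zpow_zero, mul_one]
    congr 1; ring

/-- The creation coefficients of the vertical module in terms of the normalization `c_lam`. -/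
theorem APlus_mul_cStat (hg : Generic q t) {mu lam : YoungDiagram} {i L : ℕ}
    (h : BoxAdded mu lam i) (hL : ∀ j, L ≤ j → mu.rowLen j = 0) (hiL : i ≤ L) :
    APlus q t mu (i + 1) * q ^ mu.rowLen i * cStat q t mu = rhoCoeff q t mu L i * cStat q t lam := by
  have ht := hg.t_ne_zero
  have key : ∏ k ∈ Ico i L, (1 - t⁻¹ * rowRatio q t mu i k) / (1 - rowRatio q t mu i (k + 1)) *
      ((1 - (rowRatio q t mu i (k + 1))⁻¹) / (1 - t * (rowRatio q t mu i k)⁻¹)) =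
        q ^ mu.rowLen i := by
    have h1 := prod_Ico_rowRatio hg mu hiL
    rw [hL L le_rfl, Nat.cast_zero, sub_zero, zpow_natCast] at h1
    rw [← h1]
    refine prod_congr rfl fun k hk => ?_
    have hk := mem_Ico.1 hk
    have y0 := hg.rowRatio_ne_zero mu i k
    have z0 := hg.rowRatio_ne_zero mu i (k + 1)
    have n1 : 1 - rowRatio q t mu i (k + 1) ≠ 0 := by
      have := hg.one_sub_mul_rowRatio_ne_zero mu (i := i) (a := k + 1) (m := 0) (n := 0)
        (by push_cast; omega)
      simpa using this
    have n2 : 1 - t * (rowRatio q t mu i k)⁻¹ ≠ 0 := by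
      have := hg.one_sub_mul_rowRatio_inv_ne_zero mu (i := i) (a := k) (m := 0) (n := 1)
        (by omega)
      simpa using this
    generalize rowRatio q t mu i k = y at *
    generalize rowRatio q t mu i (k + 1) = z at *
    have e1 : 1 - t⁻¹ * y = -(t⁻¹ * y) * (1 - t * y⁻¹) := by field_simp; ring
    have e2 : 1 - z⁻¹ = -z⁻¹ * (1 - z) := by field_simp; ring
    rw [e1, e2]
    generalize 1 - t * y⁻¹ = A at *
    generalize 1 - z = B at *
    field_simp
  rw [APlus_eq hg, rhoCoeff_eq hg mu hiL, cStat_boxAdded hg h hL hiL, ← key, prod_mul_distrib,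
    prod_mul_distrib]
  ring

/-- The product of the creation and the annihilation coefficient of a box. -/
theorem AMinus_mul_APlus (hg : Generic q t) {mu lam : YoungDiagram} {i : ℕ}
    (h : BoxAdded mu lam i) (hi : i < len lam) :
    AMinus q t lam (i + 1) * APlus q t mu (i + 1) =
      rhoCoeff q t mu (len lam) i * sigmaCoeff q t lam (len lam) i := by
  have hq := hg.q_ne_zero
  have ht := hg.t_ne_zero
  set L := len lam with hLdef
  have hr : ∀ j, j ≠ i → rowRatio q t mu i j = q * rowRatio q t lam i j := by
    intro j hj
    rw [← hg.rowX_div_eq, ← hg.rowX_div_eq, h.rowX_self hq, h.rowX_of_ne q t hj,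
      mul_comm q (rowX q t mu i), ← div_div, mul_div_cancel₀ _ hq]
  have hA : AMinus q t lam (i + 1) = (1 - t⁻¹) *
      (∏ k ∈ Ico i L, (1 - t * rowRatio q t lam i (k + 1)) / (1 - q * rowRatio q t lam i (k + 1))) *
      ∏ k ∈ Ico (i + 1) L, (1 - t⁻¹ * q * rowRatio q t lam i k) / (1 - rowRatio q t lam i k) := by
    have e0 : ∀ k, q ^ ((part lam (k + 1) : ℤ) - part lam (i + 1)) * t ^ ((i : ℤ) - k) =
        rowRatio q t lam i k := by
      intro k
      rw [rowRatio, part, part, Nat.add_sub_cancel, Nat.add_sub_cancel]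
    have e0' : ∀ k, q ^ ((part lam (k + 1) : ℤ) - part lam (i + 1) + 1) * t ^ ((i : ℤ) - k) =
        q * rowRatio q t lam i k := by
      intro k
      rw [← e0, zpow_add_one₀ hq]; ring
    have e1 : ∀ k, q ^ ((part lam (k + 1) : ℤ) - part lam (i + 1) + 1) *
        t ^ (-((k + 1 : ℕ) : ℤ) + ((i + 1 : ℕ) : ℤ) - 1) = t⁻¹ * q * rowRatio q t lam i k := by
      intro k
      rw [mul_assoc, ← e0', mul_left_comm, ← zpow_neg_one, ← zpow_add₀ ht]
      congr 2; push_cast; ring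
    have e2 : ∀ k, q ^ ((part lam (k + 1 + 1) : ℤ) - part lam (i + 1)) *
        t ^ (-((k + 1 : ℕ) : ℤ) + ((i + 1 : ℕ) : ℤ)) = t * rowRatio q t lam i (k + 1) := by
      intro k
      rw [← e0, mul_left_comm, ← zpow_one_add₀ ht]
      congr 2; push_cast; ring
    have e3 : ∀ k, q ^ ((part lam (k + 1 + 1) : ℤ) - part lam (i + 1) + 1) *
        t ^ (-((k + 1 : ℕ) : ℤ) + ((i + 1 : ℕ) : ℤ) - 1) = q * rowRatio q t lam i (k + 1) := by
      intro k
      rw [← e0']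
      congr 2; push_cast; ring
    have e4 : ∀ k, q ^ ((part lam (k + 1) : ℤ) - part lam (i + 1)) *
        t ^ (-((k + 1 : ℕ) : ℤ) + ((i + 1 : ℕ) : ℤ)) = rowRatio q t lam i k := by
      intro k
      rw [← e0]
      congr 2; push_cast; ring
    have e5 : q ^ ((part lam (i + 1 + 1) : ℤ) - part lam (i + 1)) =
        t * rowRatio q t lam i (i + 1) := by
      have := e2 i; simpa using this
    have e6 : q ^ ((part lam (i + 1 + 1) : ℤ) - part lam (i + 1) + 1) * t⁻¹ =
        q * rowRatio q t lam i (i + 1) := by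
      have := e3 i; simpa using this
    have hIcc : ∀ f : ℕ → K, ∏ j ∈ Icc (i + 1 + 1) L, f j = ∏ k ∈ Ico (i + 1) L, f (k + 1) := by
      intro f
      rw [← prod_Ico_succ_shift]
      rfl
    rw [AMinus, ← hLdef, hIcc, e5, e6, prod_eq_prod_Ico_succ_bot hi, mul_assoc, mul_assoc,
      mul_assoc, ← prod_mul_distrib]
    congr 2
    refine prod_congr rfl fun k _ => ?_
    rw [e1, e2, e3, e4, div_mul_div_comm, mul_comm (1 - t⁻¹ * q * _)]
  have hP : APlus q t mu (i + 1) = (1 - t) *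
      ((∏ a ∈ range i, (1 - t⁻¹ * q * rowRatio q t lam i a) / (1 - q * rowRatio q t lam i a)) *
      ∏ a ∈ range i, (1 - t * rowRatio q t lam i a) / (1 - rowRatio q t lam i a)) := by
    rw [APlus_eq hg, ← prod_mul_distrib]
    congr 1
    refine prod_congr rfl fun a ha => ?_
    rw [hr a (mem_range.1 ha).ne, mul_assoc t⁻¹, mul_comm q⁻¹ t, mul_assoc t q⁻¹,
      inv_mul_cancel_left₀ hq]
  have hR : rhoCoeff q t mu L i =
      (∏ a ∈ range i, (1 - t⁻¹ * q * rowRatio q t lam i a) / (1 - q * rowRatio q t lam i a)) *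
      ((1 - t⁻¹) * (∏ k ∈ Ico (i + 1) L, (1 - t⁻¹ * q * rowRatio q t lam i k)) *
      ∏ k ∈ Ico i L, (1 - q * rowRatio q t lam i (k + 1))⁻¹) := by
    rw [rhoCoeff_eq hg mu hi.le]
    congr 1
    · refine prod_congr rfl fun a ha => ?_
      rw [hr a (mem_range.1 ha).ne, mul_assoc t⁻¹]
    · simp only [div_eq_mul_inv]
      rw [prod_mul_distrib, prod_eq_prod_Ico_succ_bot hi (fun k => 1 - t⁻¹ * rowRatio q t mu i k),
        rowRatio_self, mul_one]
      congr 1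
      · congr 1
        refine prod_congr rfl fun k hk => ?_
        rw [hr k (by have := mem_Ico.1 hk; omega), mul_assoc t⁻¹]
      · refine prod_congr rfl fun k hk => ?_
        rw [hr (k + 1) (by have := mem_Ico.1 hk; omega)]
  rw [hA, hP, hR, sigmaCoeff_eq hg lam hi]
  simp only [div_eq_mul_inv, prod_mul_distrib]
  ring

/-- A row to which a box can be added. -/
def Addable (lam : YoungDiagram) (i : ℕ) : Prop := i = 0 ∨ lam.rowLen i < lam.rowLen (i - 1)

theorem rowRatio_pred_of_not_addable {lam : YoungDiagram} {i : ℕ} (q t : K) (h : ¬Addable lam i) :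
    rowRatio q t lam i (i - 1) = t ∧ 0 < i := by
  rw [Addable, not_or, not_lt] at h
  have h1 := lam.rowLen_anti (i - 1) i (by omega)
  refine ⟨?_, by omega⟩
  rw [rowRatio, show lam.rowLen (i - 1) = lam.rowLen i by omega, sub_self, zpow_zero, one_mul,
    show (i : ℤ) - (i - 1 : ℕ) = 1 by omega, zpow_one]

theorem APlus_of_not_addable (hg : Generic q t) {lam : YoungDiagram} {i : ℕ}
    (h : ¬Addable lam i) : APlus q t lam (i + 1) = 0 := by
  obtain ⟨h1, h2⟩ := rowRatio_pred_of_not_addable q t h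
  rw [APlus_eq hg, prod_eq_zero (i := i - 1) (mem_range.2 (by omega)), mul_zero]
  rw [h1, inv_mul_cancel₀ hg.t_ne_zero]
  simp

theorem rhoCoeff_of_not_addable (hg : Generic q t) {lam : YoungDiagram} {i L : ℕ} (hi : i ≤ L)
    (h : ¬Addable lam i) : rhoCoeff q t lam L i = 0 := by
  obtain ⟨h1, h2⟩ := rowRatio_pred_of_not_addable q t h
  rw [rhoCoeff_eq hg lam hi, prod_eq_zero (i := i - 1) (mem_range.2 (by omega)), zero_mul]
  rw [h1, inv_mul_cancel₀ hg.t_ne_zero]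
  simp

theorem AMinus_of_not_removable {lam : YoungDiagram} {i : ℕ}
    (h : ¬lam.rowLen (i + 1) < lam.rowLen i) : AMinus q t lam (i + 1) = 0 := by
  have h1 := lam.rowLen_anti i (i + 1) (by omega)
  have h2 : (part lam (i + 1 + 1) : ℤ) - part lam (i + 1) = 0 := by
    rw [part, part, Nat.add_sub_cancel, Nat.add_sub_cancel]; omega
  rw [AMinus, h2]
  simp

theorem sigmaCoeff_of_not_removable (hg : Generic q t) {lam : YoungDiagram} {i L : ℕ} (hi : i < L)
    (h : ¬lam.rowLen (i + 1) < lam.rowLen i) : sigmaCoeff q t lam L i = 0 := by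
  have h1 := lam.rowLen_anti i (i + 1) (by omega)
  have h2 : rowRatio q t lam i (i + 1) = t⁻¹ := by
    rw [rowRatio, show lam.rowLen (i + 1) = lam.rowLen i by omega, sub_self, zpow_zero, one_mul,
      show (i : ℤ) - (i + 1 : ℕ) = -1 by omega, zpow_neg_one]
  have h3 : ∏ k ∈ Ico i L, (1 - t * rowRatio q t lam i (k + 1)) = 0 := by
    refine prod_eq_zero (mem_Ico.2 ⟨le_rfl, hi⟩) ?_
    rw [h2, mul_inv_cancel₀ hg.t_ne_zero, sub_self]
  rw [sigmaCoeff_eq hg lam hi, h3]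
  simp

theorem APlus_ne_zero (hg : Generic q t) {mu lam : YoungDiagram} {i : ℕ} (h : BoxAdded mu lam i) :
    APlus q t mu (i + 1) ≠ 0 := by
  have h1 : 1 - t ≠ 0 := by
    have := hg.one_sub_t_pow_ne_zero one_pos; simpa using this
  rw [APlus_eq hg]
  refine mul_ne_zero h1 (prod_ne_zero_iff.2 fun a ha => ?_)
  have ha := mem_range.1 ha
  have hlt := h.lt_rowLen ha
  have hne : ∀ m n : ℤ, (m + ((mu.rowLen a : ℤ) - mu.rowLen i) ≠ 0 ∨ n + ((i : ℤ) - a) ≠ 0) →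
      1 - q ^ m * t ^ n * rowRatio q t mu i a ≠ 0 := by
    intro m n hmn
    have := hg.one_sub_ne_zero hmn
    rwa [zpow_add₀ hg.q_ne_zero, zpow_add₀ hg.t_ne_zero, mul_mul_mul_comm] at this
  have n1 := hne 0 (-1) (Or.inl (by omega))
  have n2 := hne 0 0 (Or.inl (by omega))
  have n3 := hne (-1) 1 (Or.inr (by omega))
  have n4 := hne (-1) 0 (Or.inr (by omega))
  simp only [zpow_zero, zpow_neg_one, one_mul, mul_one, zpow_one] at n1 n2 n3 n4
  exact mul_ne_zero (div_ne_zero n1 n2) (div_ne_zero n3 n4)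

end VerticalCoefficients

/-! ### Exponential series and intertwining maps -/

section ExpIntertwining

open PowerSeries Finset

variable {K : Type*} [Field K]

theorem expZ_zero_fun {A : Type*} [Ring A] [Algebra K A] (k : ℤ) : expZ K (0 : ℕ → A) k = if k = 0 then 1 else 0 := by
  have h : (PowerSeries.mk fun n => if n = 0 then 0 else (0 : ℕ → A) n) = 0 := by
    ext n; simp
  rcases lt_trichotomy k 0 with hk | hk | hk
  · rw [expZ_of_neg _ hk, if_neg hk.ne]
  · rw [hk, expZ_zero, if_pos rfl]
  · rw [if_neg hk.ne', expZ, if_pos hk.le, expCoeff, h]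
    refine sum_eq_zero fun r _ => ?_
    rcases Nat.eq_zero_or_pos r with hr | hr
    · have : k.toNat ≠ 0 := by omega
      simp [hr, coeff_one, this]
    · rw [zero_pow hr.ne', map_zero, smul_zero]

variable [CharZero K]

section

variable {V W : Type*} [AddCommGroup V] [Module K V] [AddCommGroup W] [Module K W]
  {c : ℕ → Module.End K V} {d : ℕ → Module.End K W}

theorem expZ_apply_of_intertwines (hc : ∀ i j, 0 < i → 0 < j → Commute (c i) (c j))
    (hd : ∀ i j, 0 < i → 0 < j → Commute (d i) (d j)) {T : V →ₗ[K] W}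
    (h : ∀ j, 0 < j → ∀ f, d j (T f) = T (c j f)) (k : ℤ) (f : V) :
    expZ K d k (T f) = T (expZ K c k f) := by
  induction k using int_strong_induction with
  | hneg k hk => simp [expZ_of_neg _ hk]
  | h0 => simp [expZ_zero]
  | hpos k hk ih =>
    have hk0 : (k : K) ≠ 0 := by exact_mod_cast hk.ne'
    apply smul_right_injective W hk0
    have hM : k ≤ k.toNat := by omega
    simp only
    rw [← LinearMap.smul_apply, intCast_smul_expZ hd hM, ← map_smul, ← LinearMap.smul_apply,
      intCast_smul_expZ hc hM, LinearMap.sum_apply, LinearMap.sum_apply, map_sum]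
    refine sum_congr rfl fun j _ => ?_
    rw [LinearMap.smul_apply, LinearMap.smul_apply, Module.End.mul_apply, Module.End.mul_apply,
      map_smul, ih _ (by omega), h _ j.succ_pos]

theorem intertwines_of_expZ_apply (hc : ∀ i j, 0 < i → 0 < j → Commute (c i) (c j))
    (hd : ∀ i j, 0 < i → 0 < j → Commute (d i) (d j)) {T : V →ₗ[K] W}
    (h : ∀ (k : ℕ) f, expZ K d k (T f) = T (expZ K c k f)) :
    ∀ j, 0 < j → ∀ f, d j (T f) = T (c j f) := by
  intro j
  induction j using Nat.strong_induction_on with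
  | _ j ih =>
    intro hj f
    obtain ⟨m, rfl⟩ : ∃ m, j = m + 1 := ⟨j - 1, by omega⟩
    have hk0 : ((m + 1 : ℕ) : K) ≠ 0 := by exact_mod_cast m.succ_ne_zero
    have h1 := congrArg (fun x => ((((m + 1 : ℕ) : ℤ) : K)) • x) (h (m + 1) f)
    rw [← LinearMap.smul_apply, ← map_smul, ← LinearMap.smul_apply,
      intCast_smul_expZ hd le_rfl, intCast_smul_expZ hc le_rfl, LinearMap.sum_apply,
      LinearMap.sum_apply, map_sum, sum_range_succ, sum_range_succ] at h1
    have h2 : ∀ i ∈ range m, (((i + 1 : ℕ) : K) • (d (i + 1) *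
        expZ K d (((m + 1 : ℕ) : ℤ) - (i + 1 : ℕ)))) (T f) =
        T ((((i + 1 : ℕ) : K) • (c (i + 1) * expZ K c (((m + 1 : ℕ) : ℤ) - (i + 1 : ℕ)))) f) := by
      intro i hi
      have hi := mem_range.1 hi
      rw [LinearMap.smul_apply, LinearMap.smul_apply, Module.End.mul_apply, Module.End.mul_apply,
        map_smul, ← ih (i + 1) (by omega) (by omega),
        show ((m + 1 : ℕ) : ℤ) - (i + 1 : ℕ) = (m - i : ℕ) by omega, h]
    rw [sum_congr rfl h2, add_right_inj, sub_self, expZ_zero, expZ_zero, mul_one, mul_one,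
      LinearMap.smul_apply, LinearMap.smul_apply, map_smul] at h1
    exact smul_right_injective W hk0 h1

end

variable {A : Type*} [Ring A] [Algebra K A]

variable (K) in
/-- The exponential series as a power series. -/
noncomputable def expSeries (c : ℕ → A) : PowerSeries A := PowerSeries.mk fun k => expCoeff K c k

theorem eulerDeriv_expSeries {c : ℕ → A} (hc : ∀ i j, 0 < i → 0 < j → Commute (c i) (c j)) :
    eulerDeriv (expSeries K c) = (PowerSeries.mk fun n => (n : K) • c n) * expSeries K c := by
  ext n
  rw [eulerDeriv, expSeries, coeff_mk, coeff_mk, ← Nat.cast_smul_eq_nsmul K,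
    natCast_smul_expCoeff hc, coeff_mul]
  simp

theorem eq_expSeries {c : ℕ → A} (hc : ∀ i j, 0 < i → 0 < j → Commute (c i) (c j))
    {F : PowerSeries A} (h0 : PowerSeries.coeff 0 F = 1)
    (h : eulerDeriv F = (PowerSeries.mk fun n => (n : K) • c n) * F) : F = expSeries K c := by
  ext k
  induction k using Nat.strong_induction_on with
  | _ k ih =>
    rcases Nat.eq_zero_or_pos k with hk | hk
    · subst hk; rw [h0, expSeries, coeff_mk, expCoeff_zero]
    · have hk0 : (k : K) ≠ 0 := by exact_mod_cast hk.ne'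
      apply smul_right_injective A hk0
      have h1 := congrArg (PowerSeries.coeff k) h
      have h2 := congrArg (PowerSeries.coeff k) (eulerDeriv_expSeries (K := K) hc)
      rw [eulerDeriv, coeff_mk, ← Nat.cast_smul_eq_nsmul K, coeff_mul] at h1 h2
      simp only
      rw [h1, h2]
      refine sum_congr rfl fun p hp => ?_
      have := mem_antidiagonal.1 hp
      rcases Nat.eq_zero_or_pos p.1 with hp0 | hp0
      · simp [hp0]
      · rw [ih p.2 (by omega)]

theorem expCoeff_add_smul_one {c : ℕ → A} (hc : ∀ i j, 0 < i → 0 < j → Commute (c i) (c j))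
    (β : ℕ → K) (k : ℕ) : expCoeff K (fun n => c n + β n • (1 : A)) k =
      ∑ p ∈ antidiagonal k, expCoeff K β p.1 • expCoeff K c p.2 := by
  set G : PowerSeries A := PowerSeries.mk fun j => expCoeff K β j • (1 : A) with hG
  have hcomm : ∀ F : PowerSeries A, F * G = G * F := by
    intro F
    ext n
    rw [coeff_mul, coeff_mul, ← Nat.sum_antidiagonal_swap]
    refine sum_congr rfl fun p _ => ?_
    simp [hG]
  have hG' : eulerDeriv G = (PowerSeries.mk fun n => ((n : K) * β n) • (1 : A)) * G := by
    ext n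
    have := natCast_smul_expCoeff (K := K) (c := β) (fun _ _ _ _ => Commute.all _ _) n
    rw [eulerDeriv, hG, coeff_mk, coeff_mk, ← Nat.cast_smul_eq_nsmul K, smul_smul,
      ← smul_eq_mul (n : K), this, coeff_mul, sum_smul]
    refine sum_congr rfl fun p _ => ?_
    simp only [coeff_mk, smul_mul_smul_comm, mul_one, smul_eq_mul]
    congr 1
    ring
  have h1 : G * expSeries K c = expSeries K fun n => c n + β n • (1 : A) := by
    refine eq_expSeries (fun i j hi hj => ?_) ?_ ?_
    · refine Commute.add_left (Commute.add_right (hc i j hi hj) ?_) ?_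
      · exact (Commute.one_right _).smul_right _
      · exact (Commute.one_left _).smul_left _
    · simp [hG, expSeries, coeff_mul, expCoeff_zero]
    · have h2 : (PowerSeries.mk fun n => (n : K) • (c n + β n • (1 : A))) =
          (PowerSeries.mk fun n => (n : K) • c n) +
            PowerSeries.mk fun n => ((n : K) * β n) • (1 : A) := by
        ext n; simp [smul_smul]
      rw [eulerDeriv_mul, hG', eulerDeriv_expSeries hc, h2, add_mul, ← mul_assoc G, ← hcomm,
        mul_assoc, mul_assoc, add_comm]
  have h3 := congrArg (PowerSeries.coeff k) h1
  rw [coeff_mul, expSeries, expSeries, coeff_mk] at h3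
  rw [← h3]
  refine sum_congr rfl fun p _ => ?_
  simp [hG]

end ExpIntertwining

/-! ### One-sided vertex operators -/

section OneSided

open Finset

variable {K : Type*} [Field K] [CharZero K]

theorem mode_of_fst_eq_zero (q t : K) (d : ℕ → K) (k : ℤ) (f : Fock K) :
    mode q t (0, d) (-k) f = expPos q t d k f := by
  obtain ⟨D, hD⟩ := exists_mem_fockFiltration f
  have hz : (fun n => (0 : ℕ → K) n • aNeg K n) = 0 := by funext n; simp
  rw [mode_apply q t (0, d) (-k) hD (show D < D + k.toNat + 1 by omega)]
  simp only [expNeg, hz]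
  rcases lt_or_ge k 0 with hk | hk
  · rw [expPos, expZ_of_neg _ hk]
    refine sum_eq_zero fun l _ => ?_
    rw [expZ_zero_fun, if_neg (by omega)]
    simp
  · rw [sum_eq_single_of_mem k.toNat (mem_range.2 (by omega))]
    · rw [expZ_zero_fun, if_pos (by omega), Module.End.one_apply, Int.toNat_of_nonneg hk]
    · intro l _ hl
      rw [expZ_zero_fun, if_neg (by omega), LinearMap.zero_apply]

theorem modeHat_of_fst_eq_zero (q t : K) (d : ℕ → K) (k : ℤ) (g : FockHat K) :
    modeHat q t (0, d) (-k) g = expPosHat q t d k g := by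
  have hz : (fun n => (0 : ℕ → K) n • aNegHat K n) = 0 := by funext n; simp
  ext m
  rw [coeff_modeHat q t (0, d) (-k) g (Nat.lt_succ_self (weight m)), sum_range_succ']
  simp only [expNegHat, hz]
  rw [sum_eq_zero, zero_add, Nat.cast_zero, expZ_zero, Module.End.one_apply, zero_sub, neg_neg]
  intro j _
  rw [expZ_zero_fun, if_neg (by omega), LinearMap.zero_apply, map_zero]

theorem mode_of_snd_eq_zero (q t : K) (b : ℕ → K) (k : ℤ) (f : Fock K) :
    mode q t (b, 0) k f = expNeg b k f := by
  obtain ⟨D, hD⟩ := exists_mem_fockFiltration f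
  have hz : (fun n => (0 : ℕ → K) n • aPos q t n) = 0 := by funext n; simp
  rw [mode_apply q t (b, 0) k hD (Nat.lt_succ_self D), sum_range_succ']
  simp only [expPos, hz]
  rw [sum_eq_zero, zero_add, Nat.cast_zero, expZ_zero, Module.End.one_apply, add_zero]
  intro j _
  rw [expZ_zero_fun, if_neg (by omega), LinearMap.zero_apply, map_zero]

theorem modeHat_of_snd_eq_zero (q t : K) (b : ℕ → K) (k : ℤ) (g : FockHat K) :
    modeHat q t (b, 0) k g = expNegHat b k g := by
  have hz : (fun n => (0 : ℕ → K) n • aPosHat q t n) = 0 := by funext n; simp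
  ext m
  rw [coeff_modeHat q t (b, 0) k g (show weight m < weight m + k.toNat + 1 by omega)]
  simp only [expPosHat, hz]
  rcases lt_or_ge k 0 with hk | hk
  · rw [expNegHat, expZ_of_neg _ hk, LinearMap.zero_apply, map_zero]
    refine sum_eq_zero fun l _ => ?_
    rw [expZ_zero_fun, if_neg (by omega), LinearMap.zero_apply, map_zero, map_zero]
  · rw [sum_eq_single_of_mem k.toNat (mem_range.2 (by omega))]
    · rw [expZ_zero_fun, if_pos (by omega), Module.End.one_apply, Int.toNat_of_nonneg hk]
    · intro l _ hl
      rw [expZ_zero_fun, if_neg (by omega), LinearMap.zero_apply, map_zero, map_zero]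

end OneSided

/-! ### The intertwining relations for the generators -/

section Relations

open Finset TensorProduct

variable {K : Type*} [Field K]

/-- The intertwining relation for a generator. -/
def GenRelation [CharZero K] (s r : K) (N : ℤ) (u v w : K)
    (Phi : Fock K ⊗[K] Fock K →ₗ[K] FockHat K) (x : Gen) : Prop :=
  horizontalActHat s r (N + 1) w x ∘ₗ Phi =
    Phi ∘ₗ coproductAct (verticalAct s r v) (horizontalAct s r N u) x

theorem isIntertwiner_iff [CharZero K] (s r : K) (N : ℤ) (u v w : K)
    (Phi : Fock K ⊗[K] Fock K →ₗ[K] FockHat K) :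
    IsIntertwiner s r N u v w Phi ↔ ∀ x, GenRelation s r N u v w Phi x := by
  constructor
  · intro h x
    have := h _ (FreeAlgebra.ι K x) rfl
    rwa [FreeAlgebra.lift_ι_apply, FreeAlgebra.lift_ι_apply] at this
  · intro h a x hx
    clear hx a
    induction x using FreeAlgebra.induction with
    | grade0 c =>
      rw [AlgHom.commutes, AlgHom.commutes]
      refine LinearMap.ext fun f => ?_
      simp [Module.algebraMap_end_apply]
    | grade1 x =>
      rw [FreeAlgebra.lift_ι_apply, FreeAlgebra.lift_ι_apply]
      exact h x
    | mul x y hx hy =>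
      rw [map_mul, map_mul, Module.End.mul_eq_comp, Module.End.mul_eq_comp, LinearMap.comp_assoc,
        hy, ← LinearMap.comp_assoc, hx, LinearMap.comp_assoc]
    | add x y hx hy =>
      rw [map_add, map_add, LinearMap.add_comp, LinearMap.comp_add, hx, hy]

theorem sum_Icc_one_eq {M : Type*} [AddCommMonoid M] (L : ℕ) (f : ℕ → M) :
    ∑ i ∈ Icc 1 L, f i = ∑ i ∈ range L, f (i + 1) := by
  induction L with
  | zero => simp
  | succ L ih => rw [sum_Icc_succ_top (by omega), sum_range_succ, ih]

theorem tensorSum_tmul {V : Type*} [AddCommGroup V] [Module K V] (A : ℕ → Module.End K V)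
    (B : ℕ → Module.End K (Fock K)) (x : V) {D L : ℕ} {f : Fock K}
    (hf : f ∈ fockFiltration K (-(D : ℤ)))
    (hB : ∀ m, weight m ≤ D → ∀ k, L ≤ k → B k (MvPolynomial.monomial m 1) = 0) :
    tensorSum A B (x ⊗ₜ f) = ∑ k ∈ range L, A k x ⊗ₜ B k f := by
  have key := eq_of_eq_on_filtration (K := K)
    (S := tensorSum A B ∘ₗ TensorProduct.mk K V (Fock K) x)
    (T := ∑ k ∈ range L, TensorProduct.mk K V (Fock K) (A k x) ∘ₗ B k) (D := D) (fun m hm => ?_) hf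
  · simpa [LinearMap.sum_apply] using key
  · have hb : MvPolynomial.monomial m (1 : K) = MvPolynomial.basisMonomials ℕ K m := by simp
    rw [LinearMap.comp_apply, TensorProduct.mk_apply, tensorSum, TensorProduct.lift.tmul,
      LinearMap.flip_apply, hb, Module.Basis.constr_basis, ← hb,
      finsum_eq_sum_of_support_subset (s := range L), LinearMap.sum_apply, LinearMap.sum_apply]
    · rfl
    · intro k hk
      by_contra hkL
      refine hk ?_
      have h0 := hB m hm k (by simpa using hkL)
      dsimp only
      rw [h0, map_zero, LinearMap.zero_comp]

theorem gammaPow_horizontalAct (s r : K) (N : ℤ) (u : K) (k : ℤ) :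
    gammaPow (horizontalAct s r N u) k = ((r / s) ^ k) • (1 : Module.End K (Fock K)) := by
  rw [gammaPow]
  split_ifs with h
  · rw [horizontalAct, horizontalActOf, smul_pow, one_pow, ← zpow_natCast, Int.toNat_of_nonneg h]
  · rw [horizontalAct, horizontalActOf, smul_pow, one_pow, ← inv_div r s, inv_pow, ← zpow_natCast,
      ← zpow_neg, Int.toNat_of_nonneg (by omega), neg_neg]

variable [CharZero K]

theorem macdonaldBasis_apply (q t : K) (lam : YoungDiagram) :
    macdonaldBasis q t lam = macdonaldP q t lam :=
  Module.Basis.mk_apply _ _ _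

theorem gammaPow_verticalAct (s r v : K) (k : ℤ) : gammaPow (verticalAct s r v) k = 1 := by
  rw [gammaPow]
  split_ifs <;> simp [verticalAct]

theorem verticalAct_xPlus (s r v : K) (n : ℤ) (lam : YoungDiagram) :
    verticalAct s r v (.xPlus n) (macdonaldP (s ^ 4) (r ^ 4) lam) =
      ∑ i ∈ range (len lam + 1), (APlus (s ^ 4) (r ^ 4) lam (i + 1) *
        (rowX (s ^ 4) (r ^ 4) lam i * v) ^ n) • macdonaldP (s ^ 4) (r ^ 4) (addBox lam (i + 1)) := by
  rw [← macdonaldBasis_apply, verticalAct, Module.Basis.constr_basis, sum_Icc_one_eq]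
  refine sum_congr rfl fun i _ => ?_
  rw [rowX, part, Nat.add_sub_cancel, Nat.cast_succ, neg_add, neg_add_cancel_right]

theorem verticalAct_xMinus (s r v : K) (n : ℤ) (lam : YoungDiagram) :
    verticalAct s r v (.xMinus n) (macdonaldP (s ^ 4) (r ^ 4) lam) =
      ∑ i ∈ range (len lam), (s ^ 2 * (r ^ 2)⁻¹ * AMinus (s ^ 4) (r ^ 4) lam (i + 1) *
        ((s ^ 4) ^ ((lam.rowLen i : ℤ) - 1) * (r ^ 4) ^ (-(i : ℤ)) * v) ^ n) •
          macdonaldP (s ^ 4) (r ^ 4) (removeBox lam (i + 1)) := by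
  rw [← macdonaldBasis_apply, verticalAct, Module.Basis.constr_basis, sum_Icc_one_eq, smul_sum]
  refine sum_congr rfl fun i _ => ?_
  rw [smul_smul, part, Nat.add_sub_cancel, Nat.cast_succ, neg_add, neg_add_cancel_right]
  simp only [mul_assoc]

theorem verticalAct_psiPlus (s r v : K) (n : ℕ) (lam : YoungDiagram) :
    verticalAct s r v (.psiPlus n) (macdonaldP (s ^ 4) (r ^ 4) lam) =
      (s ^ 2 * (r ^ 2)⁻¹ * PowerSeries.coeff n (BPlus (s ^ 4) (r ^ 4) lam) * v ^ n) •
        macdonaldP (s ^ 4) (r ^ 4) lam := by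
  conv_lhs => rw [← macdonaldBasis_apply, verticalAct, Module.Basis.constr_basis]

theorem verticalAct_psiMinus (s r v : K) (n : ℕ) (lam : YoungDiagram) :
    verticalAct s r v (.psiMinus n) (macdonaldP (s ^ 4) (r ^ 4) lam) =
      ((s ^ 2)⁻¹ * r ^ 2 * PowerSeries.coeff n (BMinus (s ^ 4) (r ^ 4) lam) * (v ^ n)⁻¹) •
        macdonaldP (s ^ 4) (r ^ 4) lam := by
  conv_lhs => rw [← macdonaldBasis_apply, verticalAct, Module.Basis.constr_basis]

variable (s r : K) (N : ℤ) (u v w : K) (Phi : Fock K ⊗[K] Fock K →ₗ[K] FockHat K)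

/-- The difference of the two sides of the intertwining relation on `P_lam ⊗ -`. -/
noncomputable def relationDefect (lam : YoungDiagram) (x : Gen) : Fock K →ₗ[K] FockHat K :=
  (horizontalActHat s r (N + 1) w x ∘ₗ Phi -
    Phi ∘ₗ coproductAct (verticalAct s r v) (horizontalAct s r N u) x) ∘ₗ
      TensorProduct.mk K (Fock K) (Fock K) (macdonaldP (s ^ 4) (r ^ 4) lam)

theorem genRelation_iff (x : Gen) :
    GenRelation s r N u v w Phi x ↔ ∀ lam, relationDefect s r N u v w Phi lam x = 0 := by
  constructor
  · intro h lam
    rw [GenRelation] at h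
    rw [relationDefect, h, sub_self, LinearMap.zero_comp]
  · intro h
    rw [GenRelation, ← sub_eq_zero]
    refine TensorProduct.ext ((macdonaldBasis (s ^ 4) (r ^ 4)).ext fun lam => ?_)
    rw [macdonaldBasis_apply]
    refine LinearMap.ext fun f => ?_
    exact LinearMap.congr_fun (h lam) f

theorem relationDefect_xPlus (lam : YoungDiagram) (n : ℤ) (f : Fock K) :
    ∀ᶠ L in Filter.atTop, relationDefect s r N u v w Phi lam (.xPlus n) f =
      (w * (s ^ 2) ^ (-(N + 1)) * (r ^ 2) ^ (N + 1)) •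
        modeHat (s ^ 4) (r ^ 4) (eta (r ^ 4)) (N + 1 - n) (component s r Phi lam f) -
      ∑ i ∈ range (len lam + 1), (APlus (s ^ 4) (r ^ 4) lam (i + 1) *
        (rowX (s ^ 4) (r ^ 4) lam i * v) ^ n) • component s r Phi (addBox lam (i + 1)) f -
      ∑ k ∈ range L, (u * (s ^ 2) ^ (-N) * (r ^ 2) ^ N * ((s ^ 2)⁻¹ * r ^ 2) *
        (PowerSeries.coeff k (BMinus (s ^ 4) (r ^ 4) lam) * (v ^ k)⁻¹)) •
          component s r Phi lam (mode (s ^ 4) (r ^ 4) (eta (r ^ 4)) (N - (n + k)) f) := by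
  obtain ⟨D, hD⟩ := exists_mem_fockFiltration f
  filter_upwards [Filter.eventually_ge_atTop ((N - n).toNat + D + 1)] with L hL
  have hB : ∀ m, weight m ≤ D → ∀ k, L ≤ k →
      horizontalAct s r N u (.xPlus (n + k)) (MvPolynomial.monomial m 1) = 0 := by
    intro m hm k hk
    rw [horizontalAct, horizontalActOf, LinearMap.smul_apply,
      mode_eq_zero _ _ _ (monomial_mem_fockFiltration m) (by omega), smul_zero]
  rw [relationDefect, LinearMap.comp_apply, TensorProduct.mk_apply, LinearMap.sub_apply,
    LinearMap.comp_apply, LinearMap.comp_apply, coproductAct, LinearMap.add_apply,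
    TensorProduct.map_tmul, tensorSum_tmul _ _ _ hD hB, map_add, sub_sub]
  congr 1
  congr 1
  · rw [verticalAct_xPlus, sum_tmul, map_sum, Module.End.one_apply]
    refine sum_congr rfl fun i _ => ?_
    rw [← smul_tmul', map_smul]; rfl
  · rw [map_sum]
    refine sum_congr rfl fun k _ => ?_
    rw [gammaPow_verticalAct, one_mul, verticalAct_psiMinus, horizontalAct, horizontalActOf,
      LinearMap.smul_apply, smul_tmul_smul, map_smul]
    congr 1
    ring

theorem relationDefect_xMinus (lam : YoungDiagram) (n : ℤ) (f : Fock K) :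
    ∀ᶠ L in Filter.atTop, relationDefect s r N u v w Phi lam (.xMinus n) f =
      (w⁻¹ * (s ^ 2) ^ (N + 1) * (r ^ 2) ^ (-(N + 1))) •
        modeHat (s ^ 4) (r ^ 4) (xi s r) (-(N + 1) - n) (component s r Phi lam f) -
      ∑ k ∈ range L, ∑ i ∈ range (len lam),
        (s ^ 2 * (r ^ 2)⁻¹ * AMinus (s ^ 4) (r ^ 4) lam (i + 1) *
        ((s ^ 4) ^ ((lam.rowLen i : ℤ) - 1) * (r ^ 4) ^ (-(i : ℤ)) * v) ^ (n - k) *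
          ((r / s) ^ (k - 2 * n) * ((s ^ 2) ^ N * (r ^ 2) ^ (-N)))) •
          component s r Phi (removeBox lam (i + 1))
            (mode (s ^ 4) (r ^ 4) (phiPlus s r) (-(k : ℤ)) f) -
      (u⁻¹ * (s ^ 2) ^ N * (r ^ 2) ^ (-N)) •
        component s r Phi lam (mode (s ^ 4) (r ^ 4) (xi s r) (-N - n) f) := by
  obtain ⟨D, hD⟩ := exists_mem_fockFiltration f
  filter_upwards [Filter.eventually_ge_atTop (D + 1)] with L hL
  have hB : ∀ m, weight m ≤ D → ∀ k : ℕ, L ≤ k →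
      (gammaPow (horizontalAct s r N u) (k - 2 * n) * horizontalAct s r N u (.psiPlus k))
        (MvPolynomial.monomial m 1) = 0 := by
    intro m hm k hk
    rw [Module.End.mul_apply, horizontalAct, horizontalActOf, LinearMap.smul_apply,
      mode_eq_zero _ _ _ (monomial_mem_fockFiltration m) (by omega), smul_zero, map_zero]
  rw [relationDefect, LinearMap.comp_apply, TensorProduct.mk_apply, LinearMap.sub_apply,
    LinearMap.comp_apply, LinearMap.comp_apply, coproductAct, LinearMap.add_apply,
    TensorProduct.map_tmul, tensorSum_tmul _ _ _ hD hB, map_add, sub_sub]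
  congr 1
  congr 1
  · rw [map_sum]
    refine sum_congr rfl fun k _ => ?_
    rw [verticalAct_xMinus, sum_tmul, map_sum, gammaPow_horizontalAct, smul_one_mul]
    refine sum_congr rfl fun i _ => ?_
    rw [LinearMap.smul_apply, horizontalAct, horizontalActOf, LinearMap.smul_apply, smul_smul,
      smul_tmul_smul, map_smul]
    rfl
  · rw [horizontalAct, horizontalActOf, LinearMap.smul_apply, tmul_smul, map_smul]
    rfl

theorem relationDefect_psiPlus (lam : YoungDiagram) (n : ℕ) (f : Fock K) :
    relationDefect s r N u v w Phi lam (.psiPlus n) f =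
      ((s ^ 2) ^ (N + 1) * (r ^ 2) ^ (-(N + 1))) •
        modeHat (s ^ 4) (r ^ 4) (phiPlus s r) (-(n : ℤ)) (component s r Phi lam f) -
      ∑ p ∈ antidiagonal n, ((s ^ 2) ^ N * (r ^ 2) ^ (-N) * (s ^ 2 * (r ^ 2)⁻¹) *
        (PowerSeries.coeff p.1 (BPlus (s ^ 4) (r ^ 4) lam) * (v ^ p.1 * (s / r) ^ p.1))) •
          component s r Phi lam (mode (s ^ 4) (r ^ 4) (phiPlus s r) (-(p.2 : ℤ)) f) := by
  rw [relationDefect, LinearMap.comp_apply, TensorProduct.mk_apply, LinearMap.sub_apply,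
    LinearMap.comp_apply, LinearMap.comp_apply, coproductAct, LinearMap.sum_apply, map_sum]
  congr 1
  refine sum_congr rfl fun p _ => ?_
  have e : (r / s) ^ (-(p.1 : ℤ)) = (s / r) ^ p.1 := by
    rw [zpow_neg, zpow_natCast, ← inv_pow, inv_div]
  rw [TensorProduct.map_tmul, gammaPow_verticalAct, one_mul, gammaPow_horizontalAct, smul_one_mul,
    verticalAct_psiPlus, LinearMap.smul_apply, horizontalAct, horizontalActOf,
    LinearMap.smul_apply, smul_smul, smul_tmul_smul, map_smul, e]
  congr 1
  ring

theorem relationDefect_psiMinus (lam : YoungDiagram) (n : ℕ) (f : Fock K) :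
    relationDefect s r N u v w Phi lam (.psiMinus n) f =
      ((s ^ 2) ^ (-(N + 1)) * (r ^ 2) ^ (N + 1)) •
        modeHat (s ^ 4) (r ^ 4) (phiMinus s r) n (component s r Phi lam f) -
      ∑ p ∈ antidiagonal n, ((s ^ 2) ^ (-N) * (r ^ 2) ^ N * ((s ^ 2)⁻¹ * r ^ 2) *
        (PowerSeries.coeff p.1 (BMinus (s ^ 4) (r ^ 4) lam) * ((v ^ p.1)⁻¹ * (s / r) ^ p.1))) •
          component s r Phi lam (mode (s ^ 4) (r ^ 4) (phiMinus s r) p.2 f) := by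
  rw [relationDefect, LinearMap.comp_apply, TensorProduct.mk_apply, LinearMap.sub_apply,
    LinearMap.comp_apply, LinearMap.comp_apply, coproductAct, LinearMap.sum_apply, map_sum]
  congr 1
  refine sum_congr rfl fun p _ => ?_
  have e : (r / s) ^ (-(p.1 : ℤ)) = (s / r) ^ p.1 := by
    rw [zpow_neg, zpow_natCast, ← inv_pow, inv_div]
  rw [TensorProduct.map_tmul, gammaPow_verticalAct, one_mul, gammaPow_horizontalAct, smul_one_mul,
    verticalAct_psiMinus, LinearMap.smul_apply, horizontalAct, horizontalActOf,
    LinearMap.smul_apply, smul_smul, smul_tmul_smul, map_smul, e]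
  congr 1
  ring

theorem relationDefect_gamma (lam : YoungDiagram) :
    relationDefect s r N u v w Phi lam .gammaHalf = 0 ∧
      relationDefect s r N u v w Phi lam .gammaHalfInv = 0 := by
  constructor <;>
  · refine LinearMap.ext fun f => ?_
    rw [relationDefect, LinearMap.comp_apply, TensorProduct.mk_apply, LinearMap.sub_apply,
      LinearMap.comp_apply, LinearMap.comp_apply, coproductAct, TensorProduct.map_tmul,
      verticalAct, horizontalAct, horizontalActOf, horizontalActHat, horizontalActOf,
      LinearMap.smul_apply, LinearMap.smul_apply, Module.End.one_apply, Module.End.one_apply,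
      Module.End.one_apply, tmul_smul, map_smul, sub_self, LinearMap.zero_apply]

end Relations

/-! ### Further Heisenberg families -/

section MoreFamilies

open Finset

variable {K : Type*} [Field K]

namespace HeisFamily

variable {q t : K} {β β' γ γ' : ℕ → K}

theorem shift {T : ℤ → Fock K →ₗ[K] FockHat K} (h : HeisFamily q t β β' γ γ' T) (k : ℤ) :
    HeisFamily q t β β' γ γ' fun n => T (n + k) := by
  refine ⟨fun m hm n f => ?_, fun m hm n f => ?_⟩
  · rw [h.pos m hm, show n + (m : ℤ) + k = n + k + m by ring]
  · rw [h.neg m hm, show n - (m : ℤ) + k = n + k - m by ring]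

theorem of_eventually {T : ℤ → Fock K →ₗ[K] FockHat K} {S : ℕ → ℤ → Fock K →ₗ[K] FockHat K}
    (hS : ∀ L, HeisFamily q t β β' γ γ' (S L))
    (h : ∀ n f, ∀ᶠ L in Filter.atTop, T n f = S L n f) : HeisFamily q t β β' γ γ' T := by
  refine ⟨fun m hm n f => ?_, fun m hm n f => ?_⟩
  · obtain ⟨L, h1, h2, h3⟩ := ((h n f).and ((h n (aPos q t m f)).and (h (n + m) f))).exists
    rw [h1, h2, h3, (hS L).pos m hm]
  · obtain ⟨L, h1, h2, h3⟩ := ((h n f).and ((h n (aNeg K m f)).and (h (n - m) f))).exists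
    rw [h1, h2, h3, (hS L).neg m hm]

theorem zpow_smul {T : Fock K →ₗ[K] FockHat K} {x : K} (hx : x ≠ 0)
    (h : IsHeis q t (fun m => β m + γ m * x ^ m) (fun m => β' m + γ' m * (x ^ m)⁻¹) T) :
    HeisFamily q t β β' γ γ' fun n => x ^ n • T := by
  refine ⟨fun m hm n f => ?_, fun m hm n f => ?_⟩
  · rw [LinearMap.smul_apply, LinearMap.smul_apply, LinearMap.smul_apply, map_smul, h.pos hm,
      smul_add, add_assoc]
    congr 1
    rw [zpow_add₀ hx, zpow_natCast]
    module
  · rw [LinearMap.smul_apply, LinearMap.smul_apply, LinearMap.smul_apply, map_smul, h.neg hm,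
      smul_add, add_assoc]
    congr 1
    rw [zpow_sub₀ hx, zpow_natCast, div_eq_mul_inv]
    module

variable [CharZero K]

theorem modeHat_comp {T : Fock K →ₗ[K] FockHat K} (h : IsHeis q t β β' T) (E : VertexExponent K)
    (M : ℤ) : HeisFamily q t β β' (fun m => kappa q t m * E.1 m) (fun m => kappa q t m * E.2 m)
      fun n => modeHat q t E (M - n) ∘ₗ T := by
  refine ⟨fun m hm n f => ?_, fun m hm n f => ?_⟩
  · simp only [LinearMap.comp_apply]
    rw [aPosHat_modeHat q t E _ hm, h.pos hm, map_add, map_smul, sub_sub]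
  · simp only [LinearMap.comp_apply]
    rw [h.neg hm, map_add, map_smul, modeHat_aNegHat q t E _ hm, add_right_comm, sub_sub_eq_add_sub,
      sub_add_eq_add_sub]

theorem comp_mode {T : Fock K →ₗ[K] FockHat K} (h : IsHeis q t β β' T) (E : VertexExponent K)
    (M : ℤ) : HeisFamily q t β β' (fun m => kappa q t m * E.1 m) (fun m => kappa q t m * E.2 m)
      fun n => T ∘ₗ mode q t E (M - n) := by
  refine ⟨fun m hm n f => ?_, fun m hm n f => ?_⟩
  · simp only [LinearMap.comp_apply]
    rw [h.pos hm, aPos_mode q t E _ hm, map_add, map_smul, sub_sub, add_right_comm]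
  · simp only [LinearMap.comp_apply]
    rw [mode_aNeg q t E _ hm, map_add, map_smul, h.neg hm, sub_sub_eq_add_sub, sub_add_eq_add_sub]

end HeisFamily

theorem isHeis_vertexOperator [CharZero K] (q t : K) (E : VertexExponent K) :
    IsHeis q t (fun n => kappa q t n * E.1 n) (fun n => kappa q t n * E.2 n)
      (vertexOperator q t E) :=
  IsHeis.mk (fun _ hm f => aPosHat_vertexOperator q t E hm f)
    (fun _ hm f => vertexOperator_aNeg q t E hm f)

theorem IsHeis.smul {q t : K} {β β' : ℕ → K} {T : Fock K →ₗ[K] FockHat K}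
    (h : IsHeis q t β β' T) (c : K) : IsHeis q t β β' (c • T) :=
  HeisFamily.smul h c

theorem IsHeis.congr {q t : K} {β β' δ δ' : ℕ → K} {T : Fock K →ₗ[K] FockHat K}
    (h : IsHeis q t β β' T) (h1 : ∀ n, 0 < n → β n = δ n) (h2 : ∀ n, 0 < n → β' n = δ' n) :
    IsHeis q t δ δ' T :=
  IsHeis.mk (fun m hm f => by rw [← h1 m hm, h.pos hm]) (fun m hm f => by rw [← h2 m hm, h.neg hm])

variable [CharZero K]

/-- The operator `exp(∑ d_n a_n y^n)` on the Fock space. -/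
noncomputable def annihilationExp (q t : K) (d : ℕ → K) (y : K) : Module.End K (Fock K) :=
  (MvPolynomial.basisMonomials ℕ K).constr K fun m =>
    ∑ k ∈ range (weight m + 1), y ^ k • expPos q t d k (MvPolynomial.monomial m 1)

theorem annihilationExp_apply (q t : K) (d : ℕ → K) (y : K) {D L : ℕ} {f : Fock K}
    (hf : f ∈ fockFiltration K (-(D : ℤ))) (hL : D < L) :
    annihilationExp q t d y f = ∑ k ∈ range L, y ^ k • expPos q t d k f := by
  have key : annihilationExp q t d y f =
      (∑ k ∈ range L, y ^ k • expPos q t d k : Module.End K (Fock K)) f := by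
    refine eq_of_eq_on_filtration (D := D) (fun m hm => ?_) hf
    have hb : MvPolynomial.monomial m (1 : K) = MvPolynomial.basisMonomials ℕ K m := by simp
    rw [annihilationExp, hb, Module.Basis.constr_basis, LinearMap.sum_apply, ← hb]
    refine sum_subset (range_subset_range.2 (show weight m + 1 ≤ L by omega)) fun l _ hl => ?_
    rw [mem_range, not_lt] at hl
    rw [expPos, expZ_aPos_eq_zero q t d (monomial_mem_fockFiltration m) (by omega), smul_zero]
  rw [key, LinearMap.sum_apply]
  rfl

theorem annihilationExp_one (q t : K) (d : ℕ → K) (y : K) : annihilationExp q t d y 1 = 1 := by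
  have h1 : (1 : Fock K) ∈ fockFiltration K (-((0 : ℕ) : ℤ)) := by
    have := monomial_mem_fockFiltration (K := K) 0
    rw [weight_zero] at this
    exact this
  rw [annihilationExp_apply q t d y h1 Nat.zero_lt_one, sum_range_one]
  simp [expZ_zero]

theorem aPos_annihilationExp (q t : K) (d : ℕ → K) (y : K) {n : ℕ} (hn : 0 < n) (f : Fock K) :
    aPos q t n (annihilationExp q t d y f) = annihilationExp q t d y (aPos q t n f) := by
  obtain ⟨D, hD⟩ := exists_mem_fockFiltration f
  have hD' := fockFiltration_antitone (by omega) (aPos_mem_filtration q t hn _ hD) (i := -(D : ℤ))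
  rw [annihilationExp_apply q t d y hD (Nat.lt_succ_self D),
    annihilationExp_apply q t d y hD' (Nat.lt_succ_self D), map_sum]
  refine sum_congr rfl fun k _ => ?_
  rw [map_smul, ← Module.End.mul_apply, ← Module.End.mul_apply,
    (isHeisenberg_fock q t).pos_mul_expZ_pos d hn k]

theorem annihilationExp_aNeg (q t : K) (d : ℕ → K) (y : K) {n : ℕ} (hn : 0 < n) (f : Fock K) :
    annihilationExp q t d y (aNeg K n f) = aNeg K n (annihilationExp q t d y f) +
      (kappa q t n * (d n * y ^ n)) • annihilationExp q t d y f := by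
  obtain ⟨D, hD⟩ := exists_mem_fockFiltration f
  have hD' : aNeg K n f ∈ fockFiltration K (-((n + D : ℕ) : ℤ)) :=
    fockFiltration_antitone (by push_cast; omega) (aNeg_mem_filtration hn _ hD)
  have h3 : ∑ l ∈ range (n + (D + 1)), y ^ l • expPos q t d (l - n) f =
      y ^ n • ∑ l ∈ range (D + 1), y ^ l • expPos q t d l f := by
    rw [sum_range_add_of_eq_zero, smul_sum]
    · refine sum_congr rfl fun l _ => ?_
      push_cast
      rw [add_sub_cancel_left, pow_add, mul_smul]
    · intro l hl
      rw [expPos, expZ_of_neg _ (by omega), LinearMap.zero_apply, smul_zero]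
  rw [annihilationExp_apply q t d y hD' (show n + D < n + (D + 1) by omega), ← mul_assoc, mul_smul]
  conv_rhs => rw [annihilationExp_apply q t d y hD (Nat.lt_succ_self D), ← h3,
    ← annihilationExp_apply q t d y hD (Nat.lt_succ_self D),
    annihilationExp_apply q t d y hD (show D < n + (D + 1) by omega)]
  rw [map_sum, smul_sum, ← sum_add_distrib]
  refine sum_congr rfl fun l _ => ?_
  have h2 := (isHeisenberg_fock q t).expZ_pos_mul_neg d hn l
  rw [← Module.End.mul_apply _ (aNeg K n), h2, LinearMap.add_apply, Module.End.mul_apply,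
    LinearMap.smul_apply, smul_add, map_smul, smul_comm (y ^ l)]

theorem IsHeis.comp_annihilationExp {q t : K} {β β' : ℕ → K} {T : Fock K →ₗ[K] FockHat K}
    (h : IsHeis q t β β' T) (d : ℕ → K) (y : K) :
    IsHeis q t β (fun m => β' m + kappa q t m * (d m * y ^ m))
      (T ∘ₗ annihilationExp q t d y) := by
  refine IsHeis.mk (fun m hm f => ?_) (fun m hm f => ?_)
  · rw [LinearMap.comp_apply, LinearMap.comp_apply, h.pos hm, aPos_annihilationExp q t d y hm]
  · rw [LinearMap.comp_apply, LinearMap.comp_apply, annihilationExp_aNeg q t d y hm, map_add,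
      map_smul, h.neg hm, add_smul, add_assoc]

/-- The relation between the exponentials of two families of operators is equivalent to the relation
between the families. -/
theorem expZ_apply_iff {V W : Type*} [AddCommGroup V] [Module K V] [AddCommGroup W] [Module K W]
    {c : ℕ → Module.End K V} {d : ℕ → Module.End K W} {T : V →ₗ[K] W}
    (hc : ∀ i j, 0 < i → 0 < j → Commute (c i) (c j))
    (hd : ∀ i j, 0 < i → 0 < j → Commute (d i) (d j)) {b : ℕ → K} {F : PowerSeries K}
    (hF : IsExp b F) :
    (∀ (n : ℕ) f, expZ K d n (T f) =
      ∑ p ∈ antidiagonal n, PowerSeries.coeff p.1 F • T (expZ K c p.2 f)) ↔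
    ∀ j, 0 < j → ∀ f, d j (T f) = T (c j f) + b j • T f := by
  have hc' : ∀ i j, 0 < i → 0 < j → Commute (c i + b i • (1 : Module.End K V))
      (c j + b j • (1 : Module.End K V)) := fun i j hi hj =>
    Commute.add_left (Commute.add_right (hc i j hi hj) ((Commute.one_right _).smul_right _))
      ((Commute.one_left _).smul_left _)
  have h1 : ∀ (n : ℕ) f, ∑ p ∈ antidiagonal n, PowerSeries.coeff p.1 F • T (expZ K c p.2 f) =
      T (expZ K (fun j => c j + b j • (1 : Module.End K V)) n f) := by
    intro n f
    rw [expZ_natCast, expCoeff_add_smul_one hc, LinearMap.sum_apply, map_sum]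
    refine sum_congr rfl fun p _ => ?_
    rw [hF.coeff_eq, LinearMap.smul_apply, map_smul, expZ_natCast]
  have h2 : ∀ j f, T ((c j + b j • (1 : Module.End K V)) f) = T (c j f) + b j • T f := by
    intro j f
    rw [LinearMap.add_apply, LinearMap.smul_apply, Module.End.one_apply, map_add, map_smul]
  simp only [h1, ← h2]
  exact ⟨intertwines_of_expZ_apply hc' hd, fun h n => expZ_apply_of_intertwines hc' hd h n⟩

end MoreFamilies

/-! ### The relations for the Cartan currents -/

section CartanRelations

open Finset TensorProduct

variable {K : Type*} [Field K]

theorem xi_fst {s r : K} (hs : s ≠ 0) (n : ℕ) : (xi s r).1 n = -((eta (r ^ 4)).1 n * ((r / s) ^ 2) ^ n) := by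
  rw [xi, eta, div_pow, div_pow]
  field_simp

theorem xi_snd {s r : K} (hs : s ≠ 0) (n : ℕ) : (xi s r).2 n = -((eta (r ^ 4)).2 n * ((r / s) ^ 2) ^ n) := by
  rw [xi, eta, div_pow, div_pow]
  field_simp

theorem phiPlus_snd (s r : K) (n : ℕ) : (phiPlus s r).2 n =
    (eta (r ^ 4)).2 n * (1 - (r ^ 4 / s ^ 4) ^ n) * (s / r) ^ n := by
  rw [phiPlus, eta, div_pow, div_pow]
  ring

theorem phiMinus_fst (s r : K) (n : ℕ) : (phiMinus s r).1 n =
    (eta (r ^ 4)).1 n * (1 - (r ^ 4 / s ^ 4) ^ n) * (s / r) ^ n := by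
  rw [phiMinus, eta, div_pow, div_pow]
  ring

theorem Generic.one_sub_div_pow_ne_zero {q t : K} (h : Generic q t) {n : ℕ} (hn : 0 < n) :
    1 - (t / q) ^ n ≠ 0 := by
  have := h.one_sub_ne_zero (a := -n) (b := n) (Or.inr (by omega))
  rwa [zpow_neg, zpow_natCast, zpow_natCast, mul_comm, ← div_eq_mul_inv, ← div_pow] at this

variable [CharZero K]

theorem Generic.kappa_ne_zero {q t : K} (h : Generic q t) {n : ℕ} (hn : 0 < n) :
    kappa q t n ≠ 0 :=
  mul_ne_zero (by exact_mod_cast hn.ne')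
    (div_ne_zero (h.one_sub_q_pow_ne_zero hn) (h.one_sub_t_pow_ne_zero hn))

/-- The commutator of `a_n` with `:Φ̃_∅(v) η_lam(v):`. -/
noncomputable def betaPos (q t v : K) (lam : YoungDiagram) (n : ℕ) : K :=
  kappa q t n * (phiEmpty q v + etaLam q t v lam).1 n

/-- The commutator of `:Φ̃_∅(v) η_lam(v):` with `a_(-n)`. -/
noncomputable def betaNeg (q t v : K) (lam : YoungDiagram) (n : ℕ) : K :=
  kappa q t n * (phiEmpty q v + etaLam q t v lam).2 n

theorem Generic.betaPos_eq {q t : K} (h : Generic q t) (v : K) (lam : YoungDiagram) {n : ℕ}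
    (hn : 0 < n) : betaPos q t v lam n = -(n / (1 - t ^ n) * rowLog q t lam n * v ^ n) := by
  have hq := h.one_sub_q_pow_ne_zero hn
  have ht := h.one_sub_t_pow_ne_zero hn
  rw [betaPos, phiEmpty_add_etaLam_fst h lam hn, kappa]
  field_simp

theorem Generic.betaNeg_eq {q t : K} (h : Generic q t) (v : K) (lam : YoungDiagram) {n : ℕ}
    (hn : 0 < n) : betaNeg q t v lam n =
      -(n / (1 - t ^ n) * q ^ n * rowLog q⁻¹ t⁻¹ lam n * (v ^ n)⁻¹) := by
  have hq := h.one_sub_q_pow_ne_zero hn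
  have ht := h.one_sub_t_pow_ne_zero hn
  rw [betaNeg, phiEmpty_add_etaLam_snd h lam hn, kappa]
  field_simp

theorem eta_snd_mul_betaPos {q t : K} (h : Generic q t) (v : K) (lam : YoungDiagram) {n : ℕ}
    (hn : 0 < n) : (eta t).2 n * betaPos q t v lam n = rowLog q t lam n * v ^ n := by
  have ht := h.one_sub_t_pow_ne_zero hn
  have hn0 : (n : K) ≠ 0 := by exact_mod_cast hn.ne'
  rw [h.betaPos_eq v lam hn, eta]
  field_simp

theorem eta_fst_mul_betaNeg {q t : K} (h : Generic q t) (v : K) (lam : YoungDiagram) {n : ℕ}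
    (hn : 0 < n) : (eta t).1 n * betaNeg q t v lam n =
      rowLog q⁻¹ t⁻¹ lam n * (q / t) ^ n * v⁻¹ ^ n := by
  have ht := h.one_sub_t_pow_ne_zero hn
  have ht0 := pow_ne_zero n h.t_ne_zero
  have hn0 : (n : K) ≠ 0 := by exact_mod_cast hn.ne'
  rw [h.betaNeg_eq v lam hn, eta, div_pow, inv_pow]
  have e : (1 - (t ^ n)⁻¹) = -(1 - t ^ n) * (t ^ n)⁻¹ := by field_simp; ring
  simp only [e]
  field_simp

variable {s r : K}

theorem eta_ne_zero {q t : K} (h : Generic q t) {n : ℕ} (hn : 0 < n) :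
    (eta t).1 n ≠ 0 ∧ (eta t).2 n ≠ 0 := by
  have hn0 : (n : K) ≠ 0 := by exact_mod_cast hn.ne'
  refine ⟨div_ne_zero ?_ hn0, neg_ne_zero.2 (div_ne_zero (h.one_sub_t_pow_ne_zero hn) hn0)⟩
  have := h.inv.one_sub_t_pow_ne_zero hn
  rwa [inv_pow] at this

variable (N : ℤ) (u v w : K) (Phi : Fock K ⊗[K] Fock K →ₗ[K] FockHat K) (lam : YoungDiagram)

theorem psiPlus_relation_iff (hs : s ≠ 0) (hr : r ≠ 0) (hg : Generic (s ^ 4) (r ^ 4)) :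
    (∀ n, relationDefect s r N u v w Phi lam (.psiPlus n) = 0) ↔
      ∀ j, 0 < j → ∀ f, aPosHat (s ^ 4) (r ^ 4) j (component s r Phi lam f) =
        component s r Phi lam (aPos (s ^ 4) (r ^ 4) j f) +
          betaPos (s ^ 4) (r ^ 4) v lam j • component s r Phi lam f := by
  have hF := (isExp_BPlus hg lam).rescale (v * (s / r))
  have key := expZ_apply_iff (T := component s r Phi lam)
    ((isHeisenberg_fock (s ^ 4) (r ^ 4)).commute_smul_pos (phiPlus s r).2)
    ((isHeisenberg_fockHat (s ^ 4) (r ^ 4)).commute_smul_pos (phiPlus s r).2) hF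
  have hpre : (s ^ 2) ^ (N + 1) * (r ^ 2) ^ (-(N + 1)) ≠ 0 :=
    mul_ne_zero (zpow_ne_zero _ (pow_ne_zero _ hs)) (zpow_ne_zero _ (pow_ne_zero _ hr))
  have hpre' : (s ^ 2) ^ N * (r ^ 2) ^ (-N) * (s ^ 2 * (r ^ 2)⁻¹) =
      (s ^ 2) ^ (N + 1) * (r ^ 2) ^ (-(N + 1)) := by
    rw [zpow_add_one₀ (pow_ne_zero _ hs), neg_add, zpow_add₀ (pow_ne_zero _ hr), zpow_neg_one]
    ring
  have hphi : phiPlus s r = (0, (phiPlus s r).2) := rfl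
  have h1 : (∀ n, relationDefect s r N u v w Phi lam (.psiPlus n) = 0) ↔ _ := Iff.trans ?_ key
  · rw [h1]
    refine forall₂_congr fun j hj => forall_congr' fun f => ?_
    have hd : (phiPlus s r).2 j ≠ 0 := by
      rw [phiPlus_snd]
      exact mul_ne_zero (mul_ne_zero (eta_ne_zero hg hj).2 (hg.one_sub_div_pow_ne_zero hj))
        (pow_ne_zero _ (div_ne_zero hs hr))
    have hb : rowLog (s ^ 4) (r ^ 4) lam j * (1 - (r ^ 4 / s ^ 4) ^ j) * (v * (s / r)) ^ j =
        (phiPlus s r).2 j * betaPos (s ^ 4) (r ^ 4) v lam j := by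
      rw [phiPlus_snd, mul_pow]
      linear_combination (-((1 - (r ^ 4 / s ^ 4) ^ j) * (s / r) ^ j)) *
        eta_snd_mul_betaPos hg v lam hj
    rw [hb, LinearMap.smul_apply, LinearMap.smul_apply, map_smul, mul_smul, ← smul_add]
    exact (smul_right_injective _ hd).eq_iff
  · refine forall_congr' fun n => ?_
    rw [LinearMap.ext_iff]
    refine forall_congr' fun f => ?_
    rw [relationDefect_psiPlus, LinearMap.zero_apply, hpre', hphi, modeHat_of_fst_eq_zero,
      sub_eq_zero]
    simp only [mode_of_fst_eq_zero, mul_smul _ (PowerSeries.coeff _ _ * _), ← smul_sum]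
    rw [(smul_right_injective _ hpre).eq_iff]
    refine Eq.congr rfl (sum_congr rfl fun p _ => ?_)
    rw [PowerSeries.coeff_rescale, mul_pow, mul_comm]

theorem psiMinus_relation_iff (hs : s ≠ 0) (hr : r ≠ 0) (hg : Generic (s ^ 4) (r ^ 4)) :
    (∀ n, relationDefect s r N u v w Phi lam (.psiMinus n) = 0) ↔
      ∀ j, 0 < j → ∀ f, component s r Phi lam (aNeg K j f) =
        aNegHat K j (component s r Phi lam f) +
          betaNeg (s ^ 4) (r ^ 4) v lam j • component s r Phi lam f := by
  have hF := (isExp_BPlus hg.inv lam).rescale (v⁻¹ * (s / r))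
  have key := expZ_apply_iff (T := component s r Phi lam)
    ((isHeisenberg_fock (s ^ 4) (r ^ 4)).commute_smul_neg (phiMinus s r).1)
    ((isHeisenberg_fockHat (s ^ 4) (r ^ 4)).commute_smul_neg (phiMinus s r).1) hF
  have hpre : (s ^ 2) ^ (-(N + 1)) * (r ^ 2) ^ (N + 1) ≠ 0 :=
    mul_ne_zero (zpow_ne_zero _ (pow_ne_zero _ hs)) (zpow_ne_zero _ (pow_ne_zero _ hr))
  have hpre' : (s ^ 2) ^ (-N) * (r ^ 2) ^ N * ((s ^ 2)⁻¹ * r ^ 2) =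
      (s ^ 2) ^ (-(N + 1)) * (r ^ 2) ^ (N + 1) := by
    rw [zpow_add_one₀ (pow_ne_zero _ hr), neg_add, zpow_add₀ (pow_ne_zero _ hs), zpow_neg_one]
    ring
  have hphi : phiMinus s r = ((phiMinus s r).1, 0) := rfl
  have h1 : (∀ n, relationDefect s r N u v w Phi lam (.psiMinus n) = 0) ↔ _ := Iff.trans ?_ key
  · rw [h1]
    refine forall₂_congr fun j hj => forall_congr' fun f => ?_
    have hd : (phiMinus s r).1 j ≠ 0 := by
      rw [phiMinus_fst]
      exact mul_ne_zero (mul_ne_zero (eta_ne_zero hg hj).1 (hg.one_sub_div_pow_ne_zero hj))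
        (pow_ne_zero _ (div_ne_zero hs hr))
    have hb : rowLog (s ^ 4)⁻¹ (r ^ 4)⁻¹ lam j * (1 - ((r ^ 4)⁻¹ / (s ^ 4)⁻¹) ^ j) *
        (v⁻¹ * (s / r)) ^ j = -((phiMinus s r).1 j * betaNeg (s ^ 4) (r ^ 4) v lam j) := by
      rw [phiMinus_fst, mul_pow, inv_div_inv]
      have e : (s ^ 4 / r ^ 4) ^ j * (r ^ 4 / s ^ 4) ^ j = 1 := by
        rw [← mul_pow, div_mul_div_cancel₀ (pow_ne_zero _ hr), div_self (pow_ne_zero _ hs), one_pow]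
      linear_combination (-(rowLog (s ^ 4)⁻¹ (r ^ 4)⁻¹ lam j * v⁻¹ ^ j * (s / r) ^ j)) * e +
        ((1 - (r ^ 4 / s ^ 4) ^ j) * (s / r) ^ j) * eta_fst_mul_betaNeg hg v lam hj
    rw [hb, LinearMap.smul_apply, LinearMap.smul_apply, map_smul, neg_smul, mul_smul, ← sub_eq_add_neg,
      ← smul_sub, (smul_right_injective _ hd).eq_iff, eq_sub_iff_add_eq, eq_comm]
  · refine forall_congr' fun n => ?_
    rw [LinearMap.ext_iff]
    refine forall_congr' fun f => ?_
    rw [relationDefect_psiMinus, LinearMap.zero_apply, hpre', hphi, modeHat_of_snd_eq_zero,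
      sub_eq_zero]
    simp only [mode_of_snd_eq_zero, mul_smul _ (PowerSeries.coeff _ _ * _), ← smul_sum]
    rw [(smul_right_injective _ hpre).eq_iff, BMinus_eq]
    refine Eq.congr rfl (sum_congr rfl fun p _ => ?_)
    rw [PowerSeries.coeff_rescale, mul_pow, mul_comm, inv_pow]

theorem psi_relations_iff (hs : s ≠ 0) (hr : r ≠ 0) (hg : Generic (s ^ 4) (r ^ 4)) :
    ((∀ n, relationDefect s r N u v w Phi lam (.psiPlus n) = 0) ∧
      ∀ n, relationDefect s r N u v w Phi lam (.psiMinus n) = 0) ↔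
    IsHeis (s ^ 4) (r ^ 4) (betaPos (s ^ 4) (r ^ 4) v lam) (betaNeg (s ^ 4) (r ^ 4) v lam)
      (component s r Phi lam) := by
  rw [psiPlus_relation_iff N u v w Phi lam hs hr hg, psiMinus_relation_iff N u v w Phi lam hs hr hg]
  exact ⟨fun h => IsHeis.mk h.1 h.2, fun h => ⟨fun j hj => h.pos hj, fun j hj => h.neg hj⟩⟩

end CartanRelations

/-! ### The relations for the currents `x^±` -/

section CurrentRelations

open Finset TensorProduct

variable {K : Type*} [Field K]

theorem HeisFamily.mul_zpow_smul {q t : K} {β β' γ γ' : ℕ → K} {T : Fock K →ₗ[K] FockHat K}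
    {x a : K} (hx : x ≠ 0) (h : a ≠ 0 →
      IsHeis q t (fun m => β m + γ m * x ^ m) (fun m => β' m + γ' m * (x ^ m)⁻¹) T) :
    HeisFamily q t β β' γ γ' fun n => (a * x ^ n) • T := by
  by_cases ha : a = 0
  · refine ⟨fun m hm n f => ?_, fun m hm n f => ?_⟩ <;> simp [ha]
  · have := ((HeisFamily.zpow_smul hx (h ha)).smul a)
    simpa only [smul_smul] using this

theorem betaPos_boxAdded {mu lam : YoungDiagram} {i : ℕ} (q t v : K) (h : BoxAdded mu lam i) (m : ℕ) :
    betaPos q t v lam m = betaPos q t v mu m +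
      kappa q t m * (eta t).1 m * (rowX q t mu i * v) ^ m := by
  rw [betaPos, betaPos, h.etaLam_eq, ← add_assoc, Prod.fst_add, Pi.add_apply, mul_add, mul_assoc]
  rfl

theorem betaNeg_boxAdded {mu lam : YoungDiagram} {i : ℕ} (q t v : K) (h : BoxAdded mu lam i) (m : ℕ) :
    betaNeg q t v lam m = betaNeg q t v mu m +
      kappa q t m * (eta t).2 m * ((rowX q t mu i * v) ^ m)⁻¹ := by
  rw [betaNeg, betaNeg, h.etaLam_eq, ← add_assoc, Prod.snd_add, Pi.add_apply, mul_add, mul_assoc]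
  rfl

theorem zpow_prefactor (s r : K) (a : ℤ) :
    (s ^ 2) ^ (-a) * (r ^ 2) ^ a = ((r / s) ^ 2) ^ a := by
  rw [div_pow, div_zpow, zpow_neg]; ring

variable [CharZero K]

/-- The components of `Phi` have the commutators with the Heisenberg generators which are implied by
the relations for `ψ^±`. -/
def HasHeisComponents (s r v : K) (Phi : Fock K ⊗[K] Fock K →ₗ[K] FockHat K) : Prop :=
  ∀ lam, IsHeis (s ^ 4) (r ^ 4) (betaPos (s ^ 4) (r ^ 4) v lam) (betaNeg (s ^ 4) (r ^ 4) v lam)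
    (component s r Phi lam)

/-- The vacuum expectation value of a component. -/
noncomputable def vacuumValue (s r : K) (Phi : Fock K ⊗[K] Fock K →ₗ[K] FockHat K)
    (lam : YoungDiagram) : K :=
  MvPowerSeries.constantCoeff (component s r Phi lam 1)

variable {s r u v w : K} {N : ℤ} {Phi : Fock K ⊗[K] Fock K →ₗ[K] FockHat K}

theorem HasHeisComponents.heisFamily_xPlus (hg : Generic (s ^ 4) (r ^ 4)) (hv : v ≠ 0)
    (hPhi : HasHeisComponents s r v Phi) (lam : YoungDiagram) :
    HeisFamily (s ^ 4) (r ^ 4) (betaPos (s ^ 4) (r ^ 4) v lam) (betaNeg (s ^ 4) (r ^ 4) v lam)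
      (fun m => kappa (s ^ 4) (r ^ 4) m * (eta (r ^ 4)).1 m)
      (fun m => kappa (s ^ 4) (r ^ 4) m * (eta (r ^ 4)).2 m)
      fun n => relationDefect s r N u v w Phi lam (.xPlus n) := by
  refine HeisFamily.of_eventually (S := fun L n =>
      (w * (s ^ 2) ^ (-(N + 1)) * (r ^ 2) ^ (N + 1)) •
        (modeHat (s ^ 4) (r ^ 4) (eta (r ^ 4)) (N + 1 - n) ∘ₗ component s r Phi lam) -
      ∑ i ∈ range (len lam + 1), (APlus (s ^ 4) (r ^ 4) lam (i + 1) *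
        (rowX (s ^ 4) (r ^ 4) lam i * v) ^ n) • component s r Phi (addBox lam (i + 1)) -
      ∑ k ∈ range L, (u * (s ^ 2) ^ (-N) * (r ^ 2) ^ N * ((s ^ 2)⁻¹ * r ^ 2) *
        (PowerSeries.coeff k (BMinus (s ^ 4) (r ^ 4) lam) * (v ^ k)⁻¹)) •
          (component s r Phi lam ∘ₗ mode (s ^ 4) (r ^ 4) (eta (r ^ 4)) (N - (n + k))))
    (fun L => ?_) fun n f => ?_
  · refine ((HeisFamily.modeHat_comp (hPhi lam) _ _).smul _).sub (HeisFamily.sum _ fun i _ => ?_)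
      |>.sub (HeisFamily.sum _ fun k _ =>
        ((HeisFamily.comp_mode (hPhi lam) _ _).shift (k : ℤ)).smul _)
    refine HeisFamily.mul_zpow_smul (mul_ne_zero (hg.rowX_ne_zero lam i) hv) fun ha => ?_
    have hadd : Addable lam i := by
      by_contra h
      exact ha (APlus_of_not_addable hg h)
    have hb := boxAdded_addBox lam hadd
    exact (hPhi _).congr (fun m _ => betaPos_boxAdded _ _ v hb m)
      (fun m _ => betaNeg_boxAdded _ _ v hb m)
  · filter_upwards [relationDefect_xPlus s r N u v w Phi lam n f] with L hL
    rw [hL]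
    simp only [LinearMap.sub_apply, LinearMap.smul_apply, LinearMap.comp_apply,
      LinearMap.sum_apply]

theorem HasHeisComponents.constantCoeff_xPlus (hg : Generic (s ^ 4) (r ^ 4)) (hv : v ≠ 0)
    (hPhi : HasHeisComponents s r v Phi) (lam : YoungDiagram) (n : ℤ) :
    MvPowerSeries.constantCoeff (relationDefect s r N u v w Phi lam (.xPlus n) 1) =
      ((r / s) ^ 2) ^ (N + 1) *
        (w * v ^ (n - N - 1) * expZ K (rowLog (s ^ 4) (r ^ 4) lam) (n - N - 1) -
          u * v ^ (n - N) * expZ K (rowLog (s ^ 4)⁻¹ (r ^ 4)⁻¹ lam) (N - n)) *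
            vacuumValue s r Phi lam -
      ∑ i ∈ range (len lam + 1), APlus (s ^ 4) (r ^ 4) lam (i + 1) *
        (rowX (s ^ 4) (r ^ 4) lam i * v) ^ n * vacuumValue s r Phi (addBox lam (i + 1)) := by
  obtain ⟨L, hL, hLn⟩ := ((relationDefect_xPlus s r N u v w Phi lam n 1).and
    (Filter.eventually_ge_atTop ((N - n).toNat + 1))).exists
  have hv' := inv_ne_zero hv
  have hs0 : s ≠ 0 := fun h => hg.q_ne_zero (by rw [h]; ring)
  have hr0 : r ≠ 0 := fun h => hg.t_ne_zero (by rw [h]; ring)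
  have h1 := constantCoeff_modeHat (s ^ 4) (r ^ 4) (eta (r ^ 4)) (N + 1 - n)
    (β := betaPos (s ^ 4) (r ^ 4) v lam) (g := component s r Phi lam 1) fun m hm => by
      rw [(hPhi lam).pos hm, aPos_one, map_zero, zero_add]
  rw [expZ_congr (fun m hm => eta_snd_mul_betaPos hg v lam hm), expZ_mul_pow _ hv] at h1
  have h2 : ∀ k, MvPowerSeries.constantCoeff (component s r Phi lam
      (mode (s ^ 4) (r ^ 4) (eta (r ^ 4)) k 1)) =
      expZ K (fun m => rowLog (s ^ 4)⁻¹ (r ^ 4)⁻¹ lam m * (s ^ 4 / r ^ 4) ^ m * v⁻¹ ^ m) k *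
        vacuumValue s r Phi lam := by
    intro k
    have := functional_mode_one (s ^ 4) (r ^ 4) (eta (r ^ 4)) k
      (β := betaNeg (s ^ 4) (r ^ 4) v lam)
      (φ := MvPowerSeries.coeff 0 ∘ₗ component s r Phi lam) fun m hm f => by
        rw [LinearMap.comp_apply, (hPhi lam).neg hm, map_add, map_smul, smul_eq_mul, aNegHat]
        simp
    rw [expZ_congr (fun m hm => eta_fst_mul_betaNeg hg v lam hm)] at this
    exact this
  have h3 : ∑ k ∈ range L, PowerSeries.coeff k (BMinus (s ^ 4) (r ^ 4) lam) * (v ^ k)⁻¹ *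
      expZ K (fun m => rowLog (s ^ 4)⁻¹ (r ^ 4)⁻¹ lam m * (s ^ 4 / r ^ 4) ^ m * v⁻¹ ^ m)
        (N - (n + k)) = v ^ (n - N) * expZ K (rowLog (s ^ 4)⁻¹ (r ^ 4)⁻¹ lam) (N - n) := by
    have hF := (isExp_BPlus hg.inv lam).rescale v⁻¹
    rw [← BMinus_eq] at hF
    have := expZ_add _ (fun m => rowLog (s ^ 4)⁻¹ (r ^ 4)⁻¹ lam m * (s ^ 4 / r ^ 4) ^ m * v⁻¹ ^ m)
      hF (k := N - n) (L := L) (by omega)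
    rw [expZ_congr (d := fun m => rowLog (s ^ 4)⁻¹ (r ^ 4)⁻¹ lam m * v⁻¹ ^ m)
      (fun m _ => by rw [inv_div_inv]; ring), expZ_mul_pow _ hv', inv_zpow', neg_sub] at this
    rw [this]
    refine sum_congr rfl fun k _ => ?_
    rw [PowerSeries.coeff_rescale, inv_pow, mul_comm (PowerSeries.coeff k _), sub_sub]
  rw [hL, map_sub, map_sub, map_sum, map_sum, MvPowerSeries.constantCoeff_smul, h1]
  have h4 : ∀ k ∈ range L, MvPowerSeries.constantCoeff
      ((u * (s ^ 2) ^ (-N) * (r ^ 2) ^ N * ((s ^ 2)⁻¹ * r ^ 2) *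
        (PowerSeries.coeff k (BMinus (s ^ 4) (r ^ 4) lam) * (v ^ k)⁻¹)) •
          component s r Phi lam (mode (s ^ 4) (r ^ 4) (eta (r ^ 4)) (N - (n + k)) 1)) =
      u * ((r / s) ^ 2) ^ (N + 1) * vacuumValue s r Phi lam *
        (PowerSeries.coeff k (BMinus (s ^ 4) (r ^ 4) lam) * (v ^ k)⁻¹ *
      expZ K (fun m => rowLog (s ^ 4)⁻¹ (r ^ 4)⁻¹ lam m * (s ^ 4 / r ^ 4) ^ m * v⁻¹ ^ m)
        (N - (n + k))) := by
    intro k _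
    have e : (s ^ 2) ^ (-N) * (r ^ 2) ^ N * ((s ^ 2)⁻¹ * r ^ 2) = ((r / s) ^ 2) ^ (N + 1) := by
      rw [zpow_prefactor, zpow_add_one₀ (pow_ne_zero _ (div_ne_zero hr0 hs0)), div_pow r s 2]
      ring
    rw [MvPowerSeries.constantCoeff_smul, h2, smul_eq_mul, ← e]
    ring
  rw [sum_congr rfl h4, ← mul_sum, h3, mul_assoc w, zpow_prefactor,
    show -(N + 1 - n) = n - N - 1 by ring]
  have h5 : ∀ i ∈ range (len lam + 1), MvPowerSeries.constantCoeff
      ((APlus (s ^ 4) (r ^ 4) lam (i + 1) * (rowX (s ^ 4) (r ^ 4) lam i * v) ^ n) •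
        component s r Phi (addBox lam (i + 1)) 1) = APlus (s ^ 4) (r ^ 4) lam (i + 1) *
        (rowX (s ^ 4) (r ^ 4) lam i * v) ^ n * vacuumValue s r Phi (addBox lam (i + 1)) := by
    intro i _
    rw [MvPowerSeries.constantCoeff_smul, smul_eq_mul]; rfl
  rw [sum_congr rfl h5, smul_eq_mul, vacuumValue]
  ring

theorem HasHeisComponents.xPlus_relation_iff (hg : Generic (s ^ 4) (r ^ 4)) (hv : v ≠ 0)
    (hPhi : HasHeisComponents s r v Phi) (lam : YoungDiagram) :
    (∀ n, relationDefect s r N u v w Phi lam (.xPlus n) = 0) ↔ ∀ n,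
      ∑ i ∈ range (len lam + 1), APlus (s ^ 4) (r ^ 4) lam (i + 1) *
        (rowX (s ^ 4) (r ^ 4) lam i * v) ^ n * vacuumValue s r Phi (addBox lam (i + 1)) =
      ((r / s) ^ 2) ^ (N + 1) *
        (w * v ^ (n - N - 1) * expZ K (rowLog (s ^ 4) (r ^ 4) lam) (n - N - 1) -
          u * v ^ (n - N) * expZ K (rowLog (s ^ 4)⁻¹ (r ^ 4)⁻¹ lam) (N - n)) *
            vacuumValue s r Phi lam := by
  constructor
  · intro h n
    have := hPhi.constantCoeff_xPlus (N := N) (u := u) (w := w) hg hv lam n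
    rw [h n, LinearMap.zero_apply, map_zero] at this
    exact (sub_eq_zero.1 this.symm).symm
  · intro h n
    refine HeisFamily.eq_zero (fun m hm => hg.kappa_ne_zero hm)
      (hPhi.heisFamily_xPlus (N := N) (u := u) (w := w) hg hv lam) (fun n => ?_) n
    rw [hPhi.constantCoeff_xPlus hg hv, h n, sub_self]

/-- The difference of the vacuum expectation values of the two terms with the current `η` is a sum of
delta functions. -/
theorem sum_rhoCoeff {q t : K} (hg : Generic q t) (hv : v ≠ 0) (u : K) (N : ℤ) (lam : YoungDiagram)
    (n : ℤ) :
    -(v * u) * v ^ (n - N - 1) * expZ K (rowLog q t lam) (n - N - 1) -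
      u * v ^ (n - N) * expZ K (rowLog q⁻¹ t⁻¹ lam) (N - n) =
    -u * v ^ (n - N) * ∑ i ∈ range (len lam + 1),
      rhoCoeff q t lam (len lam) i * rowX q t lam i ^ (n - N - 1) := by
  rw [← expZ_rowLog_add hg, show -1 - (n - N - 1) = N - n by ring]
  have : v ^ (n - N) = v * v ^ (n - N - 1) := by
    rw [← zpow_one_add₀ hv]; congr 1; ring
  rw [this]
  ring

/-- The recursion for the vacuum expectation values. -/
def VacuumRecursion (s r u v : K) (N : ℤ) (C : YoungDiagram → K) : Prop :=
  ∀ lam i, i ≤ len lam → APlus (s ^ 4) (r ^ 4) lam (i + 1) * C (addBox lam (i + 1)) =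
    -u * ((r / s) ^ 2) ^ (N + 1) * v ^ (-N) * rowX (s ^ 4) (r ^ 4) lam i ^ (-N - 1) *
      rhoCoeff (s ^ 4) (r ^ 4) lam (len lam) i * C lam

theorem HasHeisComponents.xPlus_of_recursion (hg : Generic (s ^ 4) (r ^ 4)) (hv : v ≠ 0)
    (hPhi : HasHeisComponents s r v Phi)
    (hC : VacuumRecursion s r u v N (vacuumValue s r Phi)) (lam : YoungDiagram) (n : ℤ) :
    relationDefect s r N u v (-(v * u)) Phi lam (.xPlus n) = 0 := by
  refine (hPhi.xPlus_relation_iff hg hv lam).2 (fun n => ?_) n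
  rw [sum_rhoCoeff hg hv, mul_sum, mul_sum, sum_mul]
  refine sum_congr rfl fun i hi => ?_
  have hx := hg.rowX_ne_zero lam i
  have h := hC lam i (by have := mem_range.1 hi; omega)
  have e1 : rowX (s ^ 4) (r ^ 4) lam i ^ (n - N - 1) =
      rowX (s ^ 4) (r ^ 4) lam i ^ n * rowX (s ^ 4) (r ^ 4) lam i ^ (-N - 1) := by
    rw [← zpow_add₀ hx]; congr 1; ring
  have e2 : v ^ (n - N) = v ^ n * v ^ (-N) := by rw [← zpow_add₀ hv]; rfl
  rw [mul_right_comm, h, mul_zpow, e1, e2]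
  ring

theorem HasHeisComponents.eq_neg_mul (hs : s ≠ 0) (hr : r ≠ 0) (hg : Generic (s ^ 4) (r ^ 4))
    (hv : v ≠ 0) (hPhi : HasHeisComponents s r v Phi)
    (h : ∀ n, relationDefect s r N u v w Phi ⊥ (.xPlus n) = 0) (h0 : vacuumValue s r Phi ⊥ = 1) :
    w = -(v * u) := by
  have key := (hPhi.xPlus_relation_iff hg hv ⊥).1 h
  have hlen : len (⊥ : YoungDiagram) = 0 := by simp [len, YoungDiagram.colLen_eq_card, YoungDiagram.col]
  have hrow : rowX (s ^ 4) (r ^ 4) ⊥ 0 = 1 := by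
    have : (⊥ : YoungDiagram).rowLen 0 = 0 := rowLen_eq_zero_of_len_le hlen.le
    simp [rowX, this]
  have k1 := key (N + 1)
  have k2 := key N
  rw [hlen, sum_range_one, hrow, h0, one_mul, mul_one] at k1 k2
  rw [show N + 1 - N - 1 = 0 by ring, show N - (N + 1) = -1 by ring, expZ_zero,
    expZ_of_neg _ (show (-1 : ℤ) < 0 by norm_num), zpow_zero] at k1
  rw [show N - N - 1 = -1 by ring, sub_self, expZ_zero,
    expZ_of_neg _ (show (-1 : ℤ) < 0 by norm_num), zpow_zero] at k2
  have hg0 : ((r / s) ^ 2) ^ (N + 1) ≠ 0 := zpow_ne_zero _ (pow_ne_zero _ (div_ne_zero hr hs))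
  apply mul_left_cancel₀ hg0
  rw [zpow_add_one₀ hv] at k1
  linear_combination v * k2 - k1

theorem HasHeisComponents.recursion_of_xPlus (hg : Generic (s ^ 4) (r ^ 4)) (hv : v ≠ 0)
    (hPhi : HasHeisComponents s r v Phi)
    (h : ∀ lam n, relationDefect s r N u v (-(v * u)) Phi lam (.xPlus n) = 0) :
    VacuumRecursion s r u v N (vacuumValue s r Phi) := by
  intro lam i hi
  have key := (hPhi.xPlus_relation_iff hg hv lam).1 (h lam)
  simp only [sum_rhoCoeff hg hv] at key
  set x := rowX (s ^ 4) (r ^ 4) lam with hx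
  set F : ℕ → K := fun i => APlus (s ^ 4) (r ^ 4) lam (i + 1) *
      vacuumValue s r Phi (addBox lam (i + 1)) -
    -u * ((r / s) ^ 2) ^ (N + 1) * v ^ (-N) * x i ^ (-N - 1) *
      rhoCoeff (s ^ 4) (r ^ 4) lam (len lam) i * vacuumValue s r Phi lam with hF
  have hzero : ∀ n : ℕ, ∑ i ∈ range (len lam + 1), F i * x i ^ n = 0 := by
    intro n
    have hn := key n
    rw [mul_sum, mul_sum, sum_mul, ← sub_eq_zero, ← sum_sub_distrib] at hn
    refine (mul_eq_zero.1 (?_ : _ * v ^ n = 0)).resolve_right (pow_ne_zero n hv)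
    rw [sum_mul]
    refine Eq.trans (sum_congr rfl fun i _ => ?_) hn
    have hxi := hg.rowX_ne_zero lam i
    have e1 : x i ^ ((n : ℤ) - N - 1) = x i ^ n * x i ^ (-N - 1) := by
      rw [← zpow_natCast, ← zpow_add₀ hxi]; congr 1; ring
    have e2 : v ^ ((n : ℤ) - N) = v ^ n * v ^ (-N) := by
      rw [← zpow_natCast, ← zpow_add₀ hv]; rfl
    rw [e1, e2, zpow_natCast, mul_pow]
    ring
  have hinj : Function.Injective fun j : Fin (len lam + 1) => x j := fun a b hab =>
    Fin.ext (hg.rowX_injective lam hab)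
  have hF0 := Matrix.eq_zero_of_forall_pow_sum_mul_pow_eq_zero hinj
    (v := fun j : Fin (len lam + 1) => F j) fun n => by
      rw [Fin.sum_univ_eq_sum_range (fun j => F j * x j ^ (n : ℕ))]
      exact hzero n
  exact sub_eq_zero.1 (congrFun hF0 ⟨i, by omega⟩)

end CurrentRelations

section AnnihilationRelations

open Finset TensorProduct

variable {K : Type*} [Field K]

/-- The parameter `q^(lam_i - 1) t^(1 - i) v` of the last box of a row. -/
noncomputable def lastBoxX (q t v : K) (lam : YoungDiagram) (i : ℕ) : K :=
  q ^ ((lam.rowLen i : ℤ) - 1) * t ^ (-(i : ℤ)) * v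

theorem lastBoxX_eq {q t : K} (hq : q ≠ 0) (v : K) (lam : YoungDiagram) (i : ℕ) :
    lastBoxX q t v lam i = q⁻¹ * rowX q t lam i * v := by
  rw [lastBoxX, rowX, sub_eq_neg_add, zpow_add₀ hq, zpow_neg_one]; ring

theorem lastBoxX_of_boxAdded {q t : K} (hq : q ≠ 0) (v : K) {mu lam : YoungDiagram} {i : ℕ}
    (h : BoxAdded mu lam i) : lastBoxX q t v lam i = rowX q t mu i * v := by
  rw [lastBoxX_eq hq, h.rowX_self hq, inv_mul_cancel_left₀ hq]

variable [CharZero K] {s r u v w : K} {N : ℤ} {Phi : Fock K ⊗[K] Fock K →ₗ[K] FockHat K}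

theorem relationDefect_xMinus_eq (hs : s ≠ 0) (hr : r ≠ 0) (hv : v ≠ 0) (lam : YoungDiagram)
    (n : ℤ) : relationDefect s r N u v w Phi lam (.xMinus n) =
      (w⁻¹ * ((r / s) ^ 2) ^ (-(N + 1))) •
        (modeHat (s ^ 4) (r ^ 4) (xi s r) (-(N + 1) - n) ∘ₗ component s r Phi lam) -
      ∑ i ∈ range (len lam), (AMinus (s ^ 4) (r ^ 4) lam (i + 1) * ((r / s) ^ 2) ^ (-(N + 1)) *
        (lastBoxX (s ^ 4) (r ^ 4) v lam i / (r / s) ^ 2) ^ n) •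
          (component s r Phi (removeBox lam (i + 1)) ∘ₗ
            annihilationExp (s ^ 4) (r ^ 4) (phiPlus s r).2
              (r / s / lastBoxX (s ^ 4) (r ^ 4) v lam i)) -
      (u⁻¹ * ((r / s) ^ 2) ^ (-N)) •
        (component s r Phi lam ∘ₗ mode (s ^ 4) (r ^ 4) (xi s r) (-N - n)) := by
  refine LinearMap.ext fun f => ?_
  obtain ⟨D, hD⟩ := exists_mem_fockFiltration f
  obtain ⟨L, hL, hLD⟩ := ((relationDefect_xMinus s r N u v w Phi lam n f).and
    (Filter.eventually_gt_atTop D)).exists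
  have hrs : r / s ≠ 0 := div_ne_zero hr hs
  have hpre : ∀ a : ℤ, (s ^ 2) ^ a * (r ^ 2) ^ (-a) = ((r / s) ^ 2) ^ (-a) := by
    intro a
    have := zpow_prefactor s r (-a)
    rwa [neg_neg] at this
  have hphi : phiPlus s r = (0, (phiPlus s r).2) := rfl
  rw [hL, sum_comm]
  simp only [LinearMap.sub_apply, LinearMap.smul_apply, LinearMap.comp_apply, LinearMap.sum_apply]
  rw [mul_assoc w⁻¹, mul_assoc u⁻¹, hpre, hpre]
  congr 2
  refine sum_congr rfl fun i _ => ?_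
  rw [annihilationExp_apply _ _ _ _ hD hLD, map_sum, smul_sum]
  refine sum_congr rfl fun k _ => ?_
  rw [map_smul, smul_smul, hphi, mode_of_fst_eq_zero]
  congr 1
  change _ * lastBoxX (s ^ 4) (r ^ 4) v lam i ^ (n - k) * _ = _
  have hp : lastBoxX (s ^ 4) (r ^ 4) v lam i ≠ 0 :=
    mul_ne_zero (mul_ne_zero (zpow_ne_zero _ (pow_ne_zero _ hs)) (zpow_ne_zero _ (pow_ne_zero _ hr)))
      hv
  generalize lastBoxX (s ^ 4) (r ^ 4) v lam i = p at hp ⊢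
  have e1 : ((r / s) ^ 2) ^ (-N) * (s ^ 2 * (r ^ 2)⁻¹) = ((r / s) ^ 2) ^ (-(N + 1)) := by
    rw [neg_add, zpow_add₀ (pow_ne_zero _ hrs), zpow_neg_one, div_pow, inv_div,
      div_eq_mul_inv (s ^ 2)]
  have e2 : (r / s) ^ ((k : ℤ) - 2 * n) = (r / s) ^ k * (((r / s) ^ 2) ^ n)⁻¹ := by
    rw [zpow_sub₀ hrs, zpow_natCast, zpow_mul, div_eq_mul_inv, zpow_ofNat]
  have e3 : p ^ (n - k) = p ^ n * (p ^ k)⁻¹ := by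
    rw [zpow_sub₀ hp, zpow_natCast, div_eq_mul_inv]
  rw [← e1, e2, e3, div_zpow, div_pow _ p, div_eq_mul_inv, div_eq_mul_inv]
  ring

theorem HasHeisComponents.heisFamily_xMinus (hs : s ≠ 0) (hr : r ≠ 0)
    (hg : Generic (s ^ 4) (r ^ 4)) (hv : v ≠ 0)
    (hPhi : HasHeisComponents s r v Phi) (lam : YoungDiagram) :
    HeisFamily (s ^ 4) (r ^ 4) (betaPos (s ^ 4) (r ^ 4) v lam) (betaNeg (s ^ 4) (r ^ 4) v lam)
      (fun m => kappa (s ^ 4) (r ^ 4) m * (xi s r).1 m)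
      (fun m => kappa (s ^ 4) (r ^ 4) m * (xi s r).2 m)
      fun n => relationDefect s r N u v w Phi lam (.xMinus n) := by
  have hrs : r / s ≠ 0 := div_ne_zero hr hs
  simp only [relationDefect_xMinus_eq (N := N) (u := u) (w := w) hs hr hv lam]
  refine (((HeisFamily.modeHat_comp (hPhi lam) _ _).smul _).sub
    (HeisFamily.sum _ fun i _ => ?_)).sub ((HeisFamily.comp_mode (hPhi lam) _ _).smul _)
  have hp : lastBoxX (s ^ 4) (r ^ 4) v lam i ≠ 0 := by
    rw [lastBoxX_eq hg.q_ne_zero]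
    exact mul_ne_zero (mul_ne_zero (inv_ne_zero hg.q_ne_zero) (hg.rowX_ne_zero lam i)) hv
  refine HeisFamily.mul_zpow_smul (div_ne_zero hp (pow_ne_zero _ hrs)) fun ha => ?_
  have hrem : lam.rowLen (i + 1) < lam.rowLen i := by
    by_contra h
    exact ha (by rw [AMinus_of_not_removable h, zero_mul])
  have hb := boxAdded_removeBox lam hrem
  have hx := lastBoxX_of_boxAdded (t := r ^ 4) hg.q_ne_zero v hb
  have e : ∀ m : ℕ, ((r / s) ^ 2) ^ m ≠ 0 := fun m => pow_ne_zero _ (pow_ne_zero _ hrs)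
  refine ((hPhi _).comp_annihilationExp _ _).congr (fun m _ => ?_) (fun m _ => ?_)
  · rw [betaPos_boxAdded _ _ v hb, ← hx, xi_fst hs, div_pow (lastBoxX _ _ _ _ _)]
    have := e m
    generalize ((r / s) ^ 2) ^ m = G at *
    field_simp
    ring
  · rw [betaNeg_boxAdded _ _ v hb, ← hx, xi_snd hs, phiPlus_snd]
    have h0 : lastBoxX (s ^ 4) (r ^ 4) v lam i ^ m ≠ 0 := pow_ne_zero _ hp
    have e1 : (s / r) ^ m * (r / s) ^ m = 1 := by
      rw [← mul_pow, div_mul_div_cancel₀ hr, div_self hs, one_pow]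
    have e2 : (r ^ 4 / s ^ 4) ^ m = ((r / s) ^ 2) ^ m * ((r / s) ^ 2) ^ m := by
      rw [← div_pow, ← mul_pow]; congr 1; ring
    rw [e2, div_pow _ (lastBoxX _ _ _ _ _), div_pow (lastBoxX _ _ _ _ _), inv_div,
      div_eq_mul_inv _ (lastBoxX _ _ _ _ _ ^ m), div_eq_mul_inv _ (lastBoxX _ _ _ _ _ ^ m)]
    linear_combination (kappa (s ^ 4) (r ^ 4) m * (eta (r ^ 4)).2 m *
      (1 - ((r / s) ^ 2) ^ m * ((r / s) ^ 2) ^ m) *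
      (lastBoxX (s ^ 4) (r ^ 4) v lam i ^ m)⁻¹) * e1

theorem HasHeisComponents.constantCoeff_xMinus (hs : s ≠ 0) (hr : r ≠ 0)
    (hg : Generic (s ^ 4) (r ^ 4)) (hv : v ≠ 0)
    (hPhi : HasHeisComponents s r v Phi) (lam : YoungDiagram) (n : ℤ) :
    MvPowerSeries.constantCoeff (relationDefect s r N u v w Phi lam (.xMinus n) 1) =
      w⁻¹ * ((r / s) ^ 2) ^ (-(N + 1)) * (((r / s) ^ 2 * v) ^ (N + 1 + n) *
        expZ K (fun m => -rowLog (s ^ 4) (r ^ 4) lam m) (N + 1 + n) * vacuumValue s r Phi lam) -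
      ∑ i ∈ range (len lam), AMinus (s ^ 4) (r ^ 4) lam (i + 1) * ((r / s) ^ 2) ^ (-(N + 1)) *
        (lastBoxX (s ^ 4) (r ^ 4) v lam i / (r / s) ^ 2) ^ n *
          vacuumValue s r Phi (removeBox lam (i + 1)) -
      u⁻¹ * ((r / s) ^ 2) ^ (-N) * (((r / s) ^ 2 * v) ^ (N + n) *
        expZ K (fun m => -rowLog (s ^ 4)⁻¹ (r ^ 4)⁻¹ lam m) (-N - n) *
          vacuumValue s r Phi lam) := by
  have hrs : r / s ≠ 0 := div_ne_zero hr hs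
  have hγ : (r / s) ^ 2 * v ≠ 0 := mul_ne_zero (pow_ne_zero _ hrs) hv
  have h1 := constantCoeff_modeHat (s ^ 4) (r ^ 4) (xi s r) (-(N + 1) - n)
    (β := betaPos (s ^ 4) (r ^ 4) v lam) (g := component s r Phi lam 1) fun m hm => by
      rw [(hPhi lam).pos hm, aPos_one, map_zero, zero_add]
  have e1 : ∀ m, 0 < m → (xi s r).2 m * betaPos (s ^ 4) (r ^ 4) v lam m =
      -rowLog (s ^ 4) (r ^ 4) lam m * ((r / s) ^ 2 * v) ^ m := by
    intro m hm
    rw [xi_snd hs, mul_pow _ v]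
    linear_combination (-((r / s) ^ 2) ^ m) * eta_snd_mul_betaPos hg v lam hm
  rw [expZ_congr e1, expZ_mul_pow _ hγ, show -(-(N + 1) - n) = N + 1 + n by ring] at h1
  have h2 : MvPowerSeries.constantCoeff (component s r Phi lam
      (mode (s ^ 4) (r ^ 4) (xi s r) (-N - n) 1)) =
      ((r / s) ^ 2 * v) ^ (N + n) *
        expZ K (fun m => -rowLog (s ^ 4)⁻¹ (r ^ 4)⁻¹ lam m) (-N - n) *
        vacuumValue s r Phi lam := by
    have := functional_mode_one (s ^ 4) (r ^ 4) (xi s r) (-N - n)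
      (β := betaNeg (s ^ 4) (r ^ 4) v lam)
      (φ := MvPowerSeries.coeff 0 ∘ₗ component s r Phi lam) fun m hm f => by
        rw [LinearMap.comp_apply, (hPhi lam).neg hm, map_add, map_smul, smul_eq_mul, aNegHat]
        simp
    have e2 : ∀ m, 0 < m → (xi s r).1 m * betaNeg (s ^ 4) (r ^ 4) v lam m =
        -rowLog (s ^ 4)⁻¹ (r ^ 4)⁻¹ lam m * (((r / s) ^ 2 * v)⁻¹) ^ m := by
      intro m hm
      have e3 : ((r / s) ^ 2) ^ m * (s ^ 4 / r ^ 4) ^ m = (((r / s) ^ 2)⁻¹) ^ m := by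
        rw [← mul_pow]; congr 1; field_simp
      rw [xi_fst hs, mul_inv, mul_pow _ v⁻¹]
      linear_combination (-((r / s) ^ 2) ^ m) * eta_fst_mul_betaNeg hg v lam hm -
        rowLog (s ^ 4)⁻¹ (r ^ 4)⁻¹ lam m * v⁻¹ ^ m * e3
    rw [expZ_congr e2, expZ_mul_pow _ (inv_ne_zero hγ), inv_zpow',
      show -(-N - n) = N + n by ring] at this
    exact this
  rw [relationDefect_xMinus_eq hs hr hv]
  simp only [LinearMap.sub_apply, LinearMap.smul_apply, LinearMap.comp_apply, LinearMap.sum_apply,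
    map_sub, map_sum, MvPowerSeries.constantCoeff_smul, h1, h2, annihilationExp_one, smul_eq_mul]
  rfl

/-- The difference of the vacuum expectation values of the two terms with the current `ξ` is a sum of
delta functions. -/
theorem sum_sigmaCoeff {q t γ : K} (hg : Generic q t) (hv : v ≠ 0) (hγ : γ ≠ 0) (u : K) (N : ℤ)
    (lam : YoungDiagram) (n : ℤ) :
    (-(v * u))⁻¹ * γ ^ (-(N + 1)) * ((γ * v) ^ (N + 1 + n) *
        expZ K (fun m => -rowLog q t lam m) (N + 1 + n)) -
      u⁻¹ * γ ^ (-N) * ((γ * v) ^ (N + n) * expZ K (fun m => -rowLog q⁻¹ t⁻¹ lam m) (-N - n)) =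
    -(u⁻¹ * γ ^ (-N) * (γ * v) ^ (N + n)) * ∑ i ∈ range (len lam),
      sigmaCoeff q t lam (len lam) i * (t⁻¹ * rowX q t lam i) ^ (N + 1 + n) := by
  rw [← expZ_neg_rowLog_add hg, show 1 - (N + 1 + n) = -N - n by ring, neg_add, zpow_add₀ hγ,
    zpow_neg_one, show N + 1 + n = N + n + 1 by ring, zpow_add_one₀ (mul_ne_zero hγ hv),
    inv_neg, mul_inv]
  field_simp
  ring

theorem HasHeisComponents.xMinus_of_recursion (hs : s ≠ 0) (hr : r ≠ 0)
    (hg : Generic (s ^ 4) (r ^ 4)) (hu : u ≠ 0) (hv : v ≠ 0)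
    (hPhi : HasHeisComponents s r v Phi)
    (hC : ∀ mu lam i, BoxAdded mu lam i → ∀ L, i ≤ L → (∀ j, L ≤ j → mu.rowLen j = 0) →
      APlus (s ^ 4) (r ^ 4) mu (i + 1) * vacuumValue s r Phi lam =
        -u * ((r / s) ^ 2) ^ (N + 1) * v ^ (-N) * rowX (s ^ 4) (r ^ 4) mu i ^ (-N - 1) *
          rhoCoeff (s ^ 4) (r ^ 4) mu L i * vacuumValue s r Phi mu)
    (lam : YoungDiagram) (n : ℤ) :
    relationDefect s r N u v (-(v * u)) Phi lam (.xMinus n) = 0 := by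
  have hrs : r / s ≠ 0 := div_ne_zero hr hs
  have hγ : (r / s) ^ 2 ≠ 0 := pow_ne_zero _ hrs
  refine HeisFamily.eq_zero (fun m hm => hg.kappa_ne_zero hm)
    (hPhi.heisFamily_xMinus (N := N) (u := u) (w := -(v * u)) hs hr hg hv lam) (fun n => ?_) n
  rw [hPhi.constantCoeff_xMinus hs hr hg hv, sub_right_comm, ← mul_assoc, ← mul_assoc _ _
    (vacuumValue s r Phi lam), ← sub_mul, sum_sigmaCoeff hg hv hγ, mul_sum, sum_mul, sub_eq_zero]
  refine sum_congr rfl fun i hi => ?_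
  have hi := mem_range.1 hi
  by_cases hrem : lam.rowLen (i + 1) < lam.rowLen i
  swap
  · rw [AMinus_of_not_removable hrem, sigmaCoeff_of_not_removable hg hi hrem]
    ring
  have hb := boxAdded_removeBox lam hrem
  set mu := removeBox lam (i + 1)
  have hA := APlus_ne_zero hg hb
  have h1 := AMinus_mul_APlus hg hb hi
  have hL : ∀ j, len lam ≤ j → mu.rowLen j = 0 := by
    intro j hj
    have h2 := hb j
    have h3 := rowLen_eq_zero_of_len_le hj
    omega
  have h2 := hC mu lam i hb (len lam) hi.le hL
  have hx := hg.rowX_ne_zero mu i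
  rw [lastBoxX_of_boxAdded hg.q_ne_zero v hb, hb.rowX_self hg.q_ne_zero]
  generalize rowX (s ^ 4) (r ^ 4) mu i = x at *
  have e0 : (r ^ 4)⁻¹ * (s ^ 4 * x) = x / ((r / s) ^ 2 * (r / s) ^ 2) := by field_simp
  rw [e0]
  generalize (r / s) ^ 2 = γ at *
  apply mul_left_cancel₀ hA
  have h3 : APlus (s ^ 4) (r ^ 4) mu (i + 1) * (AMinus (s ^ 4) (r ^ 4) lam (i + 1) * γ ^ (-(N + 1)) *
      (x * v / γ) ^ n * vacuumValue s r Phi mu) = (rhoCoeff (s ^ 4) (r ^ 4) mu (len lam) i *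
        sigmaCoeff (s ^ 4) (r ^ 4) lam (len lam) i) * (γ ^ (-(N + 1)) *
      (x * v / γ) ^ n * vacuumValue s r Phi mu) := by
    rw [← h1]; ring
  rw [h3]
  have e1 : (x / (γ * γ)) ^ (N + 1 + n) * (γ * v) ^ (N + n) * γ ^ (-N) * γ ^ (N + 1) * v ^ (-N) *
      x ^ (-N - 1) = γ ^ (-(N + 1)) * (x * v / γ) ^ n := by
    simp only [div_zpow, mul_zpow, zpow_add₀ hx, zpow_add₀ hγ, zpow_add₀ hv, zpow_neg, zpow_sub₀ hx,
      zpow_one]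
    field_simp
  linear_combination (-(u⁻¹ * γ ^ (-N) * (γ * v) ^ (N + n)) *
    sigmaCoeff (s ^ 4) (r ^ 4) lam (len lam) i * (x / (γ * γ)) ^ (N + 1 + n)) * h2 +
    (u⁻¹ * u * sigmaCoeff (s ^ 4) (r ^ 4) lam (len lam) i *
      rhoCoeff (s ^ 4) (r ^ 4) mu (len lam) i * vacuumValue s r Phi mu) * e1 +
    (γ ^ (-(N + 1)) * (x * v / γ) ^ n * sigmaCoeff (s ^ 4) (r ^ 4) lam (len lam) i *
      rhoCoeff (s ^ 4) (r ^ 4) mu (len lam) i * vacuumValue s r Phi mu) * inv_mul_cancel₀ hu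

end AnnihilationRelations

section Main

open Finset TensorProduct

variable {K : Type*} [Field K]

theorem generic_of_algebraicIndependent [CharZero K] {s r : K}
    (h : AlgebraicIndependent ℚ ![s, r]) : Generic (s ^ 4) (r ^ 4) := by
  have hpoly : ∀ a b c d : ℕ, s ^ a * r ^ b = s ^ c * r ^ d → a = c ∧ b = d := by
    intro a b c d e
    have h1 : MvPolynomial.aeval ![s, r] (MvPolynomial.X 0 ^ a * MvPolynomial.X 1 ^ b :
        MvPolynomial (Fin 2) ℚ) = MvPolynomial.aeval ![s, r]
          (MvPolynomial.X 0 ^ c * MvPolynomial.X 1 ^ d : MvPolynomial (Fin 2) ℚ) := by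
      simpa using e
    have h2 := h h1
    have h3 : ∀ a b : ℕ, (MvPolynomial.X 0 ^ a * MvPolynomial.X 1 ^ b : MvPolynomial (Fin 2) ℚ) =
        MvPolynomial.monomial (Finsupp.single 0 a + Finsupp.single 1 b) 1 := by
      intro a b
      rw [MvPolynomial.X_pow_eq_monomial, MvPolynomial.X_pow_eq_monomial,
        MvPolynomial.monomial_mul, one_mul]
    rw [h3, h3] at h2
    have h4 := MvPolynomial.monomial_left_injective (R := ℚ) one_ne_zero h2
    have h5 := DFunLike.congr_fun h4 0
    have h6 := DFunLike.congr_fun h4 1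
    simp at h5 h6
    exact ⟨h5, h6⟩
  have hs : s ≠ 0 := by
    rintro rfl
    have := hpoly 1 0 1 1 (by simp)
    omega
  have hr : r ≠ 0 := by
    rintro rfl
    have := hpoly 0 1 1 1 (by simp)
    omega
  refine ⟨pow_ne_zero _ hs, pow_ne_zero _ hr, fun a b hab => ?_⟩
  have e1 : (s ^ 4) ^ a.toNat * (r ^ 4) ^ b.toNat =
      (s ^ 4) ^ (-a).toNat * (r ^ 4) ^ (-b).toNat := by
    have hz : ∀ (x : K) (a : ℤ), x ≠ 0 → x ^ a = x ^ a.toNat / x ^ (-a).toNat := by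
      intro x a hx
      rw [← zpow_natCast x a.toNat, ← zpow_natCast x (-a).toNat, ← zpow_sub₀ hx]; congr 1; omega
    rw [hz _ a (pow_ne_zero _ hs), hz _ b (pow_ne_zero _ hr), div_mul_div_comm, div_eq_one_iff_eq
      (mul_ne_zero (pow_ne_zero _ (pow_ne_zero _ hs)) (pow_ne_zero _ (pow_ne_zero _ hr)))] at hab
    exact hab
  rw [← pow_mul, ← pow_mul, ← pow_mul, ← pow_mul] at e1
  have := hpoly _ _ _ _ e1
  omega

/-- The scalar factor of the component with the index `lam`. -/
noncomputable def vacuumFactor (s r u v : K) (N : ℤ) (lam : YoungDiagram) : K :=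
  tFactor s r u v N lam * ((s ^ 4) ^ nStat lam.transpose / cStat (s ^ 4) (r ^ 4) lam)

theorem smul_phiTilde (s r u v : K) (N : ℤ) (lam : YoungDiagram) :
    tFactor s r u v N lam • phiTilde (s ^ 4) (r ^ 4) v lam = vacuumFactor s r u v N lam •
      vertexOperator (s ^ 4) (r ^ 4) (phiEmpty (s ^ 4) v + etaLam (s ^ 4) (r ^ 4) v lam) := by
  rw [phiTilde, smul_smul, vacuumFactor]

theorem vacuumFactor_bot (s r u v : K) (N : ℤ) : vacuumFactor s r u v N ⊥ = 1 := by
  have h1 : (⊥ : YoungDiagram).card = 0 := by simp [YoungDiagram.card]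
  have h2 : nStat (⊥ : YoungDiagram) = 0 := by simp [nStat]
  have h3 : (⊥ : YoungDiagram).transpose = ⊥ := by
    ext ⟨i, j⟩
    simp
  rw [vacuumFactor, tFactor, framing, cStat, h3, h1, h2]
  simp

variable {s r u v : K} {N : ℤ}

theorem framing_boxAdded (hs : s ≠ 0) (hr : r ≠ 0) {mu lam : YoungDiagram} {i : ℕ}
    (h : BoxAdded mu lam i) : framing s r lam =
      -(rowX (s ^ 4) (r ^ 4) mu i / (r / s) ^ 2) * framing s r mu := by
  rw [framing, framing, h.card_eq, h.nStat_eq, h.nStat_transpose_eq, rowX, zpow_natCast, zpow_neg,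
    zpow_natCast]
  simp only [pow_add, pow_one, mul_inv]
  field_simp

theorem APlus_mul_vacuumFactor (hs : s ≠ 0) (hr : r ≠ 0) (hg : Generic (s ^ 4) (r ^ 4))
    (hv : v ≠ 0) {mu lam : YoungDiagram} {i : ℕ} (h : BoxAdded mu lam i) {L : ℕ} (hiL : i ≤ L)
    (hL : ∀ j, L ≤ j → mu.rowLen j = 0) :
    APlus (s ^ 4) (r ^ 4) mu (i + 1) * vacuumFactor s r u v N lam =
      -u * ((r / s) ^ 2) ^ (N + 1) * v ^ (-N) * rowX (s ^ 4) (r ^ 4) mu i ^ (-N - 1) *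
        rhoCoeff (s ^ 4) (r ^ 4) mu L i * vacuumFactor s r u v N mu := by
  have key := APlus_mul_cStat hg h hL hiL
  have hx := hg.rowX_ne_zero mu i
  have hγ : (r / s) ^ 2 ≠ 0 := pow_ne_zero _ (div_ne_zero hr hs)
  have hc := hg.cStat_ne_zero mu
  have hc' := hg.cStat_ne_zero lam
  have hv' : -v ≠ 0 := neg_ne_zero.2 hv
  rw [vacuumFactor, vacuumFactor, tFactor, tFactor, framing_boxAdded hs hr h, h.card_eq,
    h.nStat_transpose_eq]
  generalize framing s r mu = F at *
  generalize rowX (s ^ 4) (r ^ 4) mu i = x at *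
  generalize (r / s) ^ 2 = γ at *
  have e1 : (-v) ^ (-(N + 1) * ((mu.card + 1 : ℕ) : ℤ)) * (-(x / γ) * F) ^ (-N - 1) =
      (-v) ^ (-(N + 1) * (mu.card : ℤ)) * F ^ (-N - 1) *
        (v ^ (-N) * v⁻¹ * x ^ (-N - 1) * γ ^ (N + 1)) := by
    have e2 : (-(N + 1) * ((mu.card + 1 : ℕ) : ℤ)) = -(N + 1) * (mu.card : ℤ) + (-N - 1) := by
      push_cast; ring
    rw [e2, zpow_add₀ hv', mul_zpow (-(x / γ)), mul_assoc, ← mul_assoc ((-v) ^ (-N - 1)),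
      ← mul_zpow, neg_mul_neg, mul_zpow, div_zpow, zpow_sub₀ hv, zpow_one,
      show -N - 1 = -(N + 1) by ring, zpow_neg γ, div_inv_eq_mul, div_eq_mul_inv]
    ring
  have e3 : ∀ a b c d : K, a * (c * ((-v) ^ (-(N + 1) * ((mu.card + 1 : ℕ) : ℤ))) *
      (-(x / γ) * F) ^ (-N - 1) * d) = a * c * d * ((-v) ^ (-(N + 1) * (mu.card : ℤ)) *
        F ^ (-N - 1) * (v ^ (-N) * v⁻¹ * x ^ (-N - 1) * γ ^ (N + 1))) := by
    intro a b c d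
    rw [← e1]; ring
  rw [e3 _ 0, pow_add _ _ (mu.rowLen i), pow_succ _ mu.card]
  have e4 : APlus (s ^ 4) (r ^ 4) mu (i + 1) * ((s ^ 4) ^ nStat mu.transpose *
      (s ^ 4) ^ mu.rowLen i / cStat (s ^ 4) (r ^ 4) lam) =
      rhoCoeff (s ^ 4) (r ^ 4) mu L i * ((s ^ 4) ^ nStat mu.transpose / cStat (s ^ 4) (r ^ 4) mu) := by
    rw [← mul_div_assoc, ← mul_div_assoc, div_eq_div_iff hc' hc]
    linear_combination (s ^ 4) ^ nStat mu.transpose * key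
  linear_combination ((-(v * u)) ^ mu.card * -(v * u) * ((-v) ^ (-(N + 1) * (mu.card : ℤ)) *
        F ^ (-N - 1) * (v ^ (-N) * v⁻¹ * x ^ (-N - 1) * γ ^ (N + 1)))) * e4 +
    (-u * (-(v * u)) ^ mu.card * rhoCoeff (s ^ 4) (r ^ 4) mu L i *
      ((s ^ 4) ^ nStat mu.transpose / cStat (s ^ 4) (r ^ 4) mu) *
      ((-v) ^ (-(N + 1) * (mu.card : ℤ)) * F ^ (-N - 1) * (v ^ (-N) * x ^ (-N - 1) * γ ^ (N + 1)))) *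
      mul_inv_cancel₀ hv

theorem vacuumRecursion_vacuumFactor (hs : s ≠ 0) (hr : r ≠ 0) (hg : Generic (s ^ 4) (r ^ 4))
    (hv : v ≠ 0) : VacuumRecursion s r u v N (vacuumFactor s r u v N) := by
  intro lam i hi
  by_cases h : Addable lam i
  · exact APlus_mul_vacuumFactor hs hr hg hv (boxAdded_addBox lam h) hi
      fun j hj => rowLen_eq_zero_of_len_le hj
  · rw [APlus_of_not_addable hg h, rhoCoeff_of_not_addable hg hi h]
    ring

/-- A nonempty diagram is obtained by adding a box to its last row. -/
theorem exists_addBox_eq {lam : YoungDiagram} (h : len lam ≠ 0) :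
    ∃ mu i, i ≤ len mu ∧ BoxAdded mu lam i ∧ addBox mu (i + 1) = lam := by
  obtain ⟨i, hi⟩ := Nat.exists_eq_succ_of_ne_zero h
  have h0 : lam.rowLen (i + 1) = 0 := rowLen_eq_zero_of_len_le hi.le
  have h1 : 0 < lam.rowLen i := rowLen_pos_of_lt_len (by omega)
  have hb := boxAdded_removeBox lam (i := i) (by omega)
  refine ⟨removeBox lam (i + 1), i, ?_, hb, ?_⟩
  · by_contra hlt
    have h2 : (removeBox lam (i + 1)).rowLen (i - 1) = 0 := rowLen_eq_zero_of_len_le (by omega)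
    have h3 := hb (i - 1)
    have h4 := lam.rowLen_anti (i - 1) i (by omega)
    rw [h2, if_neg (by omega)] at h3
    omega
  · have hadd : Addable (removeBox lam (i + 1)) i := by
      rcases Nat.eq_zero_or_pos i with hi0 | hi0
      · exact Or.inl hi0
      · have h2 := hb i
        have h3 := hb (i - 1)
        have h4 := lam.rowLen_anti (i - 1) i (by omega)
        rw [if_pos rfl] at h2
        rw [if_neg (by omega)] at h3
        exact Or.inr (by omega)
    have hb' := boxAdded_addBox _ hadd
    ext ⟨a, b⟩
    rw [YoungDiagram.mem_cells, YoungDiagram.mem_cells, YoungDiagram.mem_iff_lt_rowLen,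
      YoungDiagram.mem_iff_lt_rowLen, hb', hb]

theorem VacuumRecursion.eq (hg : Generic (s ^ 4) (r ^ 4)) {C D : YoungDiagram → K}
    (hC : VacuumRecursion s r u v N C) (hD : VacuumRecursion s r u v N D) (h0 : C ⊥ = D ⊥) :
    C = D := by
  have key : ∀ d lam, lam.card = d → C lam = D lam := by
    intro d
    induction d with
    | zero =>
      intro lam h
      have : lam = ⊥ := by
        ext c
        rw [YoungDiagram.card, Finset.card_eq_zero] at h
        simp [h]
      rw [this, h0]
    | succ d ih =>
      intro lam h
      have hl : len lam ≠ 0 := by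
        intro hl
        have h1 : lam.cells = ∅ := by
          refine Finset.eq_empty_of_forall_notMem fun c hc => ?_
          have h2 := YoungDiagram.mem_iff_lt_rowLen.1 ((YoungDiagram.mem_cells _).1 hc)
          rw [rowLen_eq_zero_of_len_le (by omega)] at h2
          omega
        rw [YoungDiagram.card, h1, Finset.card_empty] at h
        omega
      obtain ⟨mu, i, hi, hb, hadd⟩ := exists_addBox_eq hl
      have h1 := hC mu i hi
      have h2 := hD mu i hi
      have h3 := hb.card_eq
      rw [hadd] at h1 h2
      rw [ih mu (by omega), ← h2] at h1
      exact mul_left_cancel₀ (APlus_ne_zero hg hb) h1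
  exact funext fun lam => key _ lam rfl

variable [CharZero K] {w : K} {Phi : Fock K ⊗[K] Fock K →ₗ[K] FockHat K}

theorem isIntertwiner_iff_relationDefect : IsIntertwiner s r N u v w Phi ↔
    ∀ x lam, relationDefect s r N u v w Phi lam x = 0 := by
  rw [isIntertwiner_iff]
  exact forall_congr' fun x => genRelation_iff s r N u v w Phi x

theorem IsIntertwiner.hasHeisComponents (hs : s ≠ 0) (hr : r ≠ 0) (hg : Generic (s ^ 4) (r ^ 4))
    (h : IsIntertwiner s r N u v w Phi) : HasHeisComponents s r v Phi := fun lam =>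
  (psi_relations_iff N u v w Phi lam hs hr hg).1
    ⟨fun _ => isIntertwiner_iff_relationDefect.1 h _ _,
      fun _ => isIntertwiner_iff_relationDefect.1 h _ _⟩

theorem IsNormalizedIntertwiner.eq_neg_mul (hs : s ≠ 0) (hr : r ≠ 0)
    (hg : Generic (s ^ 4) (r ^ 4)) (hv : v ≠ 0)
    (h : IsNormalizedIntertwiner s r N u v w Phi) : w = -(v * u) :=
  (h.1.hasHeisComponents hs hr hg).eq_neg_mul hs hr hg hv
    (fun _ => isIntertwiner_iff_relationDefect.1 h.1 _ _) h.2

theorem IsNormalizedIntertwiner.component_eq (hs : s ≠ 0) (hr : r ≠ 0)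
    (hg : Generic (s ^ 4) (r ^ 4)) (hv : v ≠ 0)
    (h : IsNormalizedIntertwiner s r N u v w Phi) (lam : YoungDiagram) :
    component s r Phi lam = tFactor s r u v N lam • phiTilde (s ^ 4) (r ^ 4) v lam := by
  obtain rfl := h.eq_neg_mul hs hr hg hv
  have hPhi := h.1.hasHeisComponents hs hr hg
  have hC := VacuumRecursion.eq hg
    (hPhi.recursion_of_xPlus hg hv fun _ _ => isIntertwiner_iff_relationDefect.1 h.1 _ _)
    (vacuumRecursion_vacuumFactor hs hr hg hv) (h.2.trans (vacuumFactor_bot s r u v N).symm)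
  rw [smul_phiTilde, ← hC]
  exact (hPhi lam).eq_smul_vertexOperator fun _ hm => hg.kappa_ne_zero hm

variable (s r u v N) in
/-- The intertwining operator with the explicit components. -/
noncomputable def intertwiner : Fock K ⊗[K] Fock K →ₗ[K] FockHat K :=
  TensorProduct.lift ((macdonaldBasis (s ^ 4) (r ^ 4)).constr K fun lam =>
    tFactor s r u v N lam • phiTilde (s ^ 4) (r ^ 4) v lam)

theorem component_intertwiner (lam : YoungDiagram) :
    component s r (intertwiner s r u v N) lam =
      tFactor s r u v N lam • phiTilde (s ^ 4) (r ^ 4) v lam := by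
  refine LinearMap.ext fun f => ?_
  rw [component, LinearMap.comp_apply, TensorProduct.mk_apply, intertwiner, TensorProduct.lift.tmul,
    ← macdonaldBasis_apply, Module.Basis.constr_basis]

theorem eq_of_component_eq {Psi : Fock K ⊗[K] Fock K →ₗ[K] FockHat K}
    (h : ∀ lam, component s r Phi lam = component s r Psi lam) : Phi = Psi := by
  refine TensorProduct.ext ((macdonaldBasis (s ^ 4) (r ^ 4)).ext fun lam => ?_)
  rw [macdonaldBasis_apply]
  exact h lam

theorem isNormalizedIntertwiner_intertwiner (hs : s ≠ 0) (hr : r ≠ 0)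
    (hg : Generic (s ^ 4) (r ^ 4)) (hu : u ≠ 0) (hv : v ≠ 0) :
    IsNormalizedIntertwiner s r N u v (-(v * u)) (intertwiner s r u v N) := by
  have hvac : vacuumValue s r (intertwiner s r u v N) = vacuumFactor s r u v N := by
    funext lam
    rw [vacuumValue, component_intertwiner, smul_phiTilde, LinearMap.smul_apply,
      MvPowerSeries.constantCoeff_smul, constantCoeff_vertexOperator_one, smul_eq_mul, mul_one]
  have hPhi : HasHeisComponents s r v (intertwiner s r u v N) := fun lam => by
    rw [component_intertwiner, smul_phiTilde]
    exact (isHeis_vertexOperator _ _ _).smul _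
  refine ⟨isIntertwiner_iff_relationDefect.2 fun x lam => ?_, ?_⟩
  · have hpsi := (psi_relations_iff N u v (-(v * u)) (intertwiner s r u v N) lam hs hr hg).2
      (hPhi lam)
    cases x with
    | xPlus n =>
      exact hPhi.xPlus_of_recursion hg hv (hvac ▸ vacuumRecursion_vacuumFactor hs hr hg hv) lam n
    | xMinus n =>
      refine hPhi.xMinus_of_recursion hs hr hg hu hv (fun mu lam i hb L hiL hL => ?_) lam n
      rw [hvac]
      exact APlus_mul_vacuumFactor hs hr hg hv hb hiL hL
    | psiPlus n => exact hpsi.1 n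
    | psiMinus n => exact hpsi.2 n
    | gammaHalf => exact (relationDefect_gamma s r N u v _ _ lam).1
    | gammaHalfInv => exact (relationDefect_gamma s r N u v _ _ lam).2
  · change vacuumValue s r (intertwiner s r u v N) ⊥ = 1
    rw [hvac, vacuumFactor_bot]

end Main

end FockVertex

open scoped TensorProduct in
/-- Here `s = q^(1/4)` and `r = t^(1/4)` are independent over `ℚ`, and `u`, `v`, `w` are the nonzero
spectral parameters. -/
theorem theorem3p2 {K : Type*} [Field K] [CharZero K] (s r u v w : K) (N : ℤ)
    (hsr : AlgebraicIndependent ℚ ![s, r]) (hu : u ≠ 0) (hv : v ≠ 0) (hw : w ≠ 0) :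
    ((∃ Phi : FockVertex.Fock K ⊗[K] FockVertex.Fock K →ₗ[K] FockVertex.FockHat K,
        FockVertex.IsNormalizedIntertwiner s r N u v w Phi) → w = -(v * u)) ∧
    (w = -(v * u) →
      ∃! Phi : FockVertex.Fock K ⊗[K] FockVertex.Fock K →ₗ[K] FockVertex.FockHat K,
        FockVertex.IsNormalizedIntertwiner s r N u v w Phi) ∧
    ∀ Phi : FockVertex.Fock K ⊗[K] FockVertex.Fock K →ₗ[K] FockVertex.FockHat K,
      FockVertex.IsNormalizedIntertwiner s r N u v w Phi → ∀ lam : YoungDiagram,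
        FockVertex.component s r Phi lam =
          FockVertex.tFactor s r u v N lam • FockVertex.phiTilde (s ^ 4) (r ^ 4) v lam := by
  have hg := FockVertex.generic_of_algebraicIndependent hsr
  have hs : s ≠ 0 := fun h => hg.q_ne_zero (by rw [h]; ring)
  have hr : r ≠ 0 := fun h => hg.t_ne_zero (by rw [h]; ring)
  refine ⟨?_, ?_, fun Phi h => h.component_eq hs hr hg hv⟩
  · rintro ⟨Phi, h⟩
    exact h.eq_neg_mul hs hr hg hv
  · rintro rfl
    refine ⟨FockVertex.intertwiner s r u v N,
      FockVertex.isNormalizedIntertwiner_intertwiner hs hr hg hu hv, fun Phi h => ?_⟩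
    exact FockVertex.eq_of_component_eq fun lam => by
      rw [h.component_eq hs hr hg hv, FockVertex.component_intertwiner]
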